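/- Let $(M,g_{ab})$ be a four-dimensional smooth Lorentzian spin spacetime of signature $(+---)$ which is Einstein ($R_{ab}=\lambda g_{ab}$ with $\lambda$ constant), with Weyl spinor $\Psi_{ABCD}$, and let $\{o^A,\iota^A\}$ be an arbitrary smooth (global) spin frame, $o_A\iota^A=1$, with null tetrad $\ell^a=o^A\bar o^{A'}$, $n^a=\iota^A\bar\iota^{A'}$, $m^a=o^A\bar\iota^{A'}$, $\bar m^a=\iota^A\bar o^{A'}$. Fix real $w_0,w_1$ with $w_0+w_1+1=0$ and regard $o^A$ and $\iota^A$ as having conformal weights $w_0,w_1$ and GHP types $\{1,0\},\{-1,0\}$: under $\hat g_{ab}=\Omega^2g_{ab}$ ($\Omega>0$ smooth) and a GHP transformation by a smooth nowhere vanishing complex function $\lambda$, $\hat o^A=\Omega^{w_0}\lambda\, o^A$, $\hat\iota^A=\Omega^{w_1}\lambda^{-1}\iota^A$. In any such gauge put (dropping hats) $J_a{}^b=i(\ell_an^b-n_a\ell^b+\bar m_am^b-m_a\bar m^b)$ and $f_a=-\tfrac12J_b{}^c\nabla_cJ_a{}^b$, with $\nabla_a$ the Levi-Civita connection. Let $\slashed\nabla_a$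 be the Weyl connection of $f_a$: $$\slashed\nabla_av^b=\nabla_av^b+(f_a\delta_c^b+f_c\delta_a^b-f^bg_{ac})v^c,\qquad \slashed\nabla_a\kappa^B=\nabla_a\kappa^B+f_{A'C}\,\epsilon_A{}^B\kappa^C.$$ With $K_a=w_1n_b\slashed\nabla_a\ell^b-w_0\ell_b\slashed\nabla_an^b$ and $L_a=\tfrac12(\bar m_b\slashed\nabla_am^b-m_b\slashed\nabla_a\bar m^b)$, the conformal-GHP derivative of a spinor field of conformal weight $w$ and GHP type $\{p,q\}$ is $$\mathscr C_a\kappa^B=\slashed\nabla_a\kappa^B+\big[wf_a+\tfrac p2(K_a+L_a)+\tfrac q2(K_a-L_a)\big]\kappa^B .$$ 1. Suppose that $\Psi_{ABCD}$ is non-zero on a dense set of points. Then, in every gauge $(\Omega,\lambda)$: (a) the spacetime is algebraically special with (repeated) principal null direction $o^A$, i.e. $\Psi_{ABCD}o^Bo^Co^D=0$ everywhere, if and only if $\mathscr C_ao^B=0$; (b) the spacetime is of Petrov type D with principal null directions $o^A,\iota^A$, i.e. $\Psi_{ABCD}$ vanishes nowhere and $\Psi_{ABCD}o^Bo^Co^D=0=\Psi_{ABCD}\iota^B\iota^C\iota^D$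 everywhere, if and only if $\mathscr C_ao^B=0$ and $\mathscr C_a\iota^B=0$. 2. Suppose that the spacetime is of Petrov type D with principal null directions $o^A,\iota^A$. In the metric $g_{ab}$, let $\Psi_2=\Psi_{ABCD}o^Ao^B\iota^C\iota^D$, let $D_a=\nabla_a+p(\omega_a+B_a)$ be the Teukolsky derivative on spinor fields of GHP type $\{p,0\}$, where $\omega_a=-\epsilon n_a+\epsilon'\ell_a-\beta'm_a+\beta\bar m_a$ is the GHP connection form and $B_a=-\rho n_a+\tau\bar m_a$ (with the GHP spin coefficients). Then for all integers $0\le k\le n$, every open $U\subseteq M$ and every smooth branch of $\Psi_2^{1/3}$ on $U$, the field $$P^{B_1\dots B_n}=\Psi_2^{-k/3}\,\iota^{(B_1}\cdots\iota^{B_k}o^{B_{k+1}}\cdots o^{B_n)},$$ of GHP type $\{n-2k,0\}$, satisfies the weighted Killing spinor equation $D_{A'}{}^{(A}P^{B_1\dots B_n)}=0$ on $U$. -/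

import Mathlib

open scoped Manifold ContDiff ComplexConjugate
open VectorField

noncomputable section

/-! ## Two-spinor algebra -/

/-- Unprimed spinors `κ^A`, in components with respect to a fixed spin frame with `ε_{01} = 1`.
The components of the complex conjugate primed spinor `κ̄^{A'}` are the conjugates. -/
abbrev Spinor : Type := Fin 2 → ℂ

/-- The components of `ε_{AB}` (equally of `ε^{AB}`, `ε_{A'B'}`, `ε^{A'B'}`). -/
def spinEps : Matrix (Fin 2) (Fin 2) ℂ := !![0, 1; -1, 0]

/-- The symplectic form `κ_B ξ^B = ε_{AB} κ^A ξ^B`. -/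
def spinProd (κ ξ : Spinor) : ℂ := ∑ A, ∑ B, spinEps A B * κ A * ξ B

/-- The diagonal entries of the Minkowski metric, signature `(+,-,-,-)`. -/
def minkowskiSign (i : Fin 4) : ℝ := if i = 0 then 1 else -1

/-- Components `η_{ij}` of the metric in an orthonormal frame. -/
def minkowski (i j : Fin 4) : ℝ := if i = j then minkowskiSign i else 0

/-- The Infeld-van der Waerden symbols `σ_i^{AA'}`; a vector with orthonormal components `v^i`
has spinor components `v^{AA'} = ∑ i, v^i σ_i^{AA'}`. -/
def infeld (i : Fin 4) : Matrix (Fin 2) (Fin 2) ℂ :=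
  ((1 / Real.sqrt 2 : ℝ) : ℂ) •
    (![!![1, 0; 0, 1], !![0, 1; 1, 0], !![0, Complex.I; -Complex.I, 0], !![1, 0; 0, -1]] i)

/-- The inverse symbols `σ^i_{AA'}`, obtained by raising `i` and lowering `A`, `A'`:
`v^i = σ^i_{AA'} v^{AA'}`, and a covector has spinor components `f_{AA'} = ∑ i, f_i σ^i_{AA'}`. -/
def infeldInv (i : Fin 4) (A A' : Fin 2) : ℂ :=
  (minkowskiSign i : ℂ) * ∑ B, ∑ B', infeld i B B' * spinEps B A * spinEps B' A'

/-- Frame components of the complex null vector `κ^A ξ̄^{A'}`. -/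
def nullVec (κ ξ : Spinor) (i : Fin 4) : ℂ :=
  ∑ A, ∑ A', infeldInv i A A' * κ A * conj (ξ A')

/-- Lowering a frame index. -/
def lower (v : Fin 4 → ℂ) (i : Fin 4) : ℂ := (minkowskiSign i : ℂ) * v i

/-- The symmetrised product `ι^{(B₁} ⋯ ι^{B_k} o^{B_{k+1}} ⋯ o^{B_n)}`. -/
def symDyadProduct (n k : ℕ) (o ι : Spinor) (B : Fin n → Fin 2) : ℂ :=
  ((n.factorial : ℂ))⁻¹ *
    ∑ π : Equiv.Perm (Fin n), ∏ r : Fin n, if (r : ℕ) < k then ι (B (π r)) else o (B (π r))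

/-! ## Spin spacetimes -/

/-- A four-dimensional Lorentzian spin spacetime: a metric `g` of signature `(+,-,-,-)` together with
a smooth global orthonormal frame `e`, the frame that belongs to a spin frame trivialising the spinor
bundle.  Spinor fields are therefore maps `M → Spinor`, and tensor fields are given by their
(complex) components in the frame `e`.  (Orthonormality makes `e` a basis of every tangent space,
and makes `g` smooth and symmetric.) -/
structure SpinSpacetime (M : Type*) [TopologicalSpace M]
    [ChartedSpace (EuclideanSpace ℝ (Fin 4)) M] [IsManifold (𝓡 4) ∞ M] where
  /-- the metric -/
  g : (x : M) → TangentSpace (𝓡 4) x →ₗ[ℝ] TangentSpace (𝓡 4) x →ₗ[ℝ] ℝ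
  /-- the orthonormal frame -/
  e : Fin 4 → (x : M) → TangentSpace (𝓡 4) x
  smooth_e : ∀ i, ContMDiff (𝓡 4) (𝓡 4).tangent ∞
    (fun x => (⟨x, e i x⟩ : TangentBundle (𝓡 4) M))
  orthonormal : ∀ x i j, g x (e i x) (e j x) = minkowski i j

namespace SpinSpacetime

variable {M : Type*} [TopologicalSpace M] [ChartedSpace (EuclideanSpace ℝ (Fin 4)) M]
  [IsManifold (𝓡 4) ∞ M]

/-- The conformally rescaled spacetime, with metric `ĝ = Ω² g` and orthonormal frame `Ω⁻¹ e`. -/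
def rescale (S : SpinSpacetime M) (Ω : M → ℝ) (hΩ : ContMDiff (𝓡 4) 𝓘(ℝ, ℝ) ∞ Ω)
    (hpos : ∀ x, 0 < Ω x) : SpinSpacetime M where
  g x := (Ω x ^ 2) • S.g x
  e i x := (Ω x)⁻¹ • S.e i x
  smooth_e i := by
    have h : ContMDiff (𝓡 4) 𝓘(ℝ, ℝ) ∞ (fun x => (Ω x)⁻¹) :=
      hΩ.inv₀ (fun x => (hpos x).ne')
    exact h.smul_section (S.smooth_e i)
  orthonormal x i j := by
    have h := (hpos x).ne'
    simp only [map_smul, LinearMap.smul_apply, smul_eq_mul, S.orthonormal]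
    field_simp

variable (S : SpinSpacetime M)

/-- The derivative of a (vector-valued) function along the frame vector `e_i`. -/
def frameDeriv {F : Type*} [NormedAddCommGroup F] [NormedSpace ℝ F] (i : Fin 4) (f : M → F)
    (x : M) : F :=
  mfderiv (𝓡 4) 𝓘(ℝ, F) f x (S.e i x)

/-- Structure functions `c_{ijk} = g([e_i, e_j], e_k)` of the frame. -/
def structureFun (i j k : Fin 4) (x : M) : ℝ :=
  S.g x (mlieBracket (𝓡 4) (S.e i) (S.e j) x) (S.e k x)

/-- The Levi-Civita connection, by the Koszul formula in the orthonormal frame: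
`Γ_{ij}{}^k`, with `∇_{e_i} e_j = ∑ k, Γ_{ij}{}^k e_k`. -/
def christoffel (i j k : Fin 4) (x : M) : ℝ :=
  minkowskiSign k *
    ((S.structureFun i j k x - S.structureFun j k i x + S.structureFun k i j x) / 2)

/-! ### Curvature -/

/-- `R_{ijk}{}^l`, with `(∇_i ∇_j - ∇_j ∇_i) v^l = R_{ijk}{}^l v^k`. -/
def riemann (i j k l : Fin 4) (x : M) : ℝ :=
  S.frameDeriv i (S.christoffel j k l) x - S.frameDeriv j (S.christoffel i k l) x
    + ∑ m, (S.christoffel j k m x * S.christoffel i m l x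
        - S.christoffel i k m x * S.christoffel j m l x)
    - ∑ m, minkowskiSign m * S.structureFun i j m x * S.christoffel m k l x

/-- `R_{ijkl}`. -/
def riemannLow (i j k l : Fin 4) (x : M) : ℝ := minkowskiSign l * S.riemann i j k l x

/-- The Ricci tensor `R_{ij} = R_{ikj}{}^k`. -/
def ricci (i j : Fin 4) (x : M) : ℝ := ∑ k, S.riemann i k j k x

/-- The scalar curvature. -/
def scalar (x : M) : ℝ := ∑ i, minkowskiSign i * S.ricci i i x

/-- The Weyl tensor `C_{ijkl}`, the trace-free part of `R_{ijkl}`. -/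
def weyl (i j k l : Fin 4) (x : M) : ℝ :=
  S.riemannLow i j k l x
    - (minkowski i k * S.ricci j l x - minkowski i l * S.ricci j k x
        - minkowski j k * S.ricci i l x + minkowski j l * S.ricci i k x) / 2
    + S.scalar x / 6 * (minkowski i k * minkowski j l - minkowski i l * minkowski j k)

/-- Einstein spacetime: `R_{ab} = λ g_{ab}` for a constant `λ`. -/
def IsEinstein : Prop := ∃ lam : ℝ, ∀ x i j, S.ricci i j x = lam * minkowski i j

/-- The Weyl spinor `Ψ_{ABCD} = ¼ C_{AA'BB'CC'DD'} ε^{A'B'} ε^{C'D'}`. -/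
def weylSpinor (A B C D : Fin 2) (x : M) : ℂ :=
  1 / 4 * ∑ i, ∑ j, ∑ k, ∑ l, (S.weyl i j k l x : ℂ) *
    (∑ A', ∑ B', infeldInv i A A' * infeldInv j B B' * spinEps A' B') *
    (∑ C', ∑ D', infeldInv k C C' * infeldInv l D D' * spinEps C' D')

/-- The Weyl spinor is non-zero at `x`. -/
def WeylNonzeroAt (x : M) : Prop := ∃ A B C D, S.weylSpinor A B C D x ≠ 0

/-- `o` is (at least) a two-fold principal spinor of the Weyl spinor everywhere:
`Ψ_{ABCD} o^B o^C o^D = 0`. -/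
def IsRepeatedPrincipal (o : M → Spinor) : Prop :=
  ∀ x A, ∑ B, ∑ C, ∑ D, S.weylSpinor A B C D x * o x B * o x C * o x D = 0

/-- Petrov type D with principal spinors `o`, `ι`: the Weyl spinor vanishes nowhere, and the
(pointwise linearly independent) spinors `o` and `ι` are both two-fold principal spinors of it. -/
def IsTypeD (o ι : M → Spinor) : Prop :=
  (∀ x, S.WeylNonzeroAt x) ∧ S.IsRepeatedPrincipal o ∧ S.IsRepeatedPrincipal ι

/-- The Weyl scalar `Ψ₂ = Ψ_{ABCD} o^A o^B ι^C ι^D`. -/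
def psi2 (o ι : M → Spinor) (x : M) : ℂ :=
  ∑ A, ∑ B, ∑ C, ∑ D, S.weylSpinor A B C D x * o x A * o x B * ι x C * ι x D

/-! ### Levi-Civita covariant derivatives -/

/-- `∇_i v^j` for a complex vector field. -/
def nablaVec (v : M → Fin 4 → ℂ) (x : M) (i j : Fin 4) : ℂ :=
  S.frameDeriv i (fun y => v y j) x + ∑ k, (S.christoffel i k j x : ℂ) * v x k

/-- `∇_i J_j{}^k` for a complex endomorphism field `J_j{}^k = J x j k`. -/
def nablaEnd (J : M → Fin 4 → Fin 4 → ℂ) (x : M) (i j k : Fin 4) : ℂ :=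
  S.frameDeriv i (fun y => J y j k) x + ∑ m, (S.christoffel i m k x : ℂ) * J x j m
    - ∑ m, (S.christoffel i j m x : ℂ) * J x m k

/-- The spin connection coefficients `γ_{iC}{}^B = ½ σ^j_{CA'} Γ_{ij}{}^k σ_k^{BA'}`, the unique
trace-free ones for which the symbols `σ_j^{AA'}` are covariantly constant. -/
def spinConn (i : Fin 4) (C B : Fin 2) (x : M) : ℂ :=
  1 / 2 * ∑ j, ∑ k, ∑ A', infeldInv j C A' * (S.christoffel i j k x : ℂ) * infeld k B A'

/-- `∇_i κ^B` for a spinor field. -/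
def nablaSpin (κ : M → Spinor) (x : M) (i : Fin 4) (B : Fin 2) : ℂ :=
  S.frameDeriv i (fun y => κ y B) x + ∑ C, S.spinConn i C B x * κ x C

/-- `∇_i P^{B₁…B_n}` for a spinor field with `n` upper indices. -/
def nablaMulti {n : ℕ} (P : M → (Fin n → Fin 2) → ℂ) (x : M) (i : Fin 4) (B : Fin n → Fin 2) : ℂ :=
  S.frameDeriv i (fun y => P y B) x
    + ∑ r, ∑ C, S.spinConn i C (B r) x * P x (Function.update B r C)

/-! ### The almost-complex structure and the preferred Weyl connection -/

/-- The almost-complex structure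
`J_a{}^b = i (ℓ_a n^b - n_a ℓ^b + m̄_a m^b - m_a m̄^b)` of the dyad, where
`ℓ = o ō`, `n = ι ῑ`, `m = o ῑ`, `m̄ = ι ō`. -/
def acs (o ι : M → Spinor) (x : M) (a b : Fin 4) : ℂ :=
  Complex.I *
    (lower (nullVec (o x) (o x)) a * nullVec (ι x) (ι x) b
      - lower (nullVec (ι x) (ι x)) a * nullVec (o x) (o x) b
      + lower (nullVec (ι x) (o x)) a * nullVec (o x) (ι x) b
      - lower (nullVec (o x) (ι x)) a * nullVec (ι x) (o x) b)

/-- The 1-form `f_a = -½ J_b{}^c ∇_c J_a{}^b` of the Weyl connection compatible with `J`. -/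
def weylForm (o ι : M → Spinor) (x : M) (a : Fin 4) : ℂ :=
  -(1 / 2) * ∑ b, ∑ c, acs o ι x b c * S.nablaEnd (acs o ι) x c a b

/-- The Weyl connection on complex vector fields: `∇_a v^b + Q_a{}^b{}_c v^c`, with
`Q_a{}^b{}_c = f_a δ_c^b + f_c δ_a^b - f^b g_{ac}`. -/
def weylVec (o ι : M → Spinor) (v : M → Fin 4 → ℂ) (x : M) (a b : Fin 4) : ℂ :=
  S.nablaVec v x a b + ∑ c,
    (S.weylForm o ι x a * (if b = c then 1 else 0) + S.weylForm o ι x c * (if b = a then 1 else 0)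
      - (minkowskiSign b : ℂ) * S.weylForm o ι x b * (minkowski a c : ℂ)) * v x c

/-- The Weyl connection on spinor fields: `∇_a κ^B + f_{A'C} κ^C ε_A{}^B`. -/
def weylSpin (o ι : M → Spinor) (κ : M → Spinor) (x : M) (a : Fin 4) (B : Fin 2) : ℂ :=
  S.nablaSpin κ x a B + ∑ A', ∑ C,
    infeld a B A' * (∑ j, S.weylForm o ι x j * infeldInv j C A') * κ x C

/-! ### The conformal GHP connection -/

/-- `w₁ ω_a{}⁰{}₀ - w₀ ω_a{}¹{}₁` with `ω_a{}⁰{}₀ = n_b ∇̸_a ℓ^b`, `ω_a{}¹{}₁ = ℓ_b ∇̸_a n^b`, where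
`∇̸` is the Weyl connection. -/
def boostForm (w₀ w₁ : ℝ) (o ι : M → Spinor) (x : M) (a : Fin 4) : ℂ :=
  (w₁ : ℂ) * ∑ b, lower (nullVec (ι x) (ι x)) b *
      S.weylVec o ι (fun y => nullVec (o y) (o y)) x a b
    - (w₀ : ℂ) * ∑ b, lower (nullVec (o x) (o x)) b *
      S.weylVec o ι (fun y => nullVec (ι y) (ι y)) x a b

/-- `½ (ω_a{}³{}₃ - ω_a{}²{}₂)` with `ω_a{}²{}₂ = -m̄_b ∇̸_a m^b`, `ω_a{}³{}₃ = -m_b ∇̸_a m̄^b`, where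
`∇̸` is the Weyl connection. -/
def spinForm (o ι : M → Spinor) (x : M) (a : Fin 4) : ℂ :=
  1 / 2 *
    (-(∑ b, lower (nullVec (o x) (ι x)) b * S.weylVec o ι (fun y => nullVec (ι y) (o y)) x a b)
      + ∑ b, lower (nullVec (ι x) (o x)) b * S.weylVec o ι (fun y => nullVec (o y) (ι y)) x a b)

/-- The connection 1-form on densities of conformal weight `w` and GHP type `{p,q}` induced by the
preferred Weyl connection: `w f + p (K + L)/2 + q (K - L)/2` for the boost and spin forms `K`, `L`. -/
def densityForm (w₀ w₁ : ℝ) (o ι : M → Spinor) (w : ℝ) (p q : ℤ) (x : M) (a : Fin 4) : ℂ :=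
  (w : ℂ) * S.weylForm o ι x a
    + (p : ℂ) * ((S.boostForm w₀ w₁ o ι x a + S.spinForm o ι x a) / 2)
    + (q : ℂ) * ((S.boostForm w₀ w₁ o ι x a - S.spinForm o ι x a) / 2)

/-- The conformal GHP covariant derivative `𝒞_a κ^B` of a spinor field of conformal weight `w` and
GHP type `{p,q}`. -/
def confGHP (w₀ w₁ : ℝ) (o ι : M → Spinor) (w : ℝ) (p q : ℤ) (κ : M → Spinor) (x : M)
    (a : Fin 4) (B : Fin 2) : ℂ :=
  S.weylSpin o ι κ x a B + S.densityForm w₀ w₁ o ι w p q x a * κ x B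

/-! ### The Teukolsky connection -/

/-- `ζ^A u^a ∇_a ξ_A`, from which the GHP spin coefficients are obtained. -/
def spinCoeff (ζ ξ : M → Spinor) (u : Fin 4 → ℂ) (x : M) : ℂ :=
  ∑ a, u a * spinProd (S.nablaSpin ξ x a) (ζ x)

/-- The GHP connection form `ω_a = -ε n_a + ε' ℓ_a - β' m_a + β m̄_a`, where
`ε = ι^A ℓ^a ∇_a o_A`, `β = ι^A m^a ∇_a o_A`, and, by the prime operation `o ↦ iι`, `ι ↦ io`,
`ε' = -o^A n^a ∇_a ι_A`, `β' = -o^A m̄^a ∇_a ι_A`. -/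
def ghpForm (o ι : M → Spinor) (x : M) (a : Fin 4) : ℂ :=
  -S.spinCoeff ι o (nullVec (o x) (o x)) x * lower (nullVec (ι x) (ι x)) a
    + -S.spinCoeff o ι (nullVec (ι x) (ι x)) x * lower (nullVec (o x) (o x)) a
    - -S.spinCoeff o ι (nullVec (ι x) (o x)) x * lower (nullVec (o x) (ι x)) a
    + S.spinCoeff ι o (nullVec (o x) (ι x)) x * lower (nullVec (ι x) (o x)) a

/-- The 1-form `B_a = -ρ n_a + τ m̄_a`, with `ρ = o^A m̄^a ∇_a o_A` and `τ = o^A n^a ∇_a o_A`. -/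
def teukolskyForm (o ι : M → Spinor) (x : M) (a : Fin 4) : ℂ :=
  -S.spinCoeff o o (nullVec (ι x) (o x)) x * lower (nullVec (ι x) (ι x)) a
    + S.spinCoeff o o (nullVec (ι x) (ι x)) x * lower (nullVec (ι x) (o x)) a

/-- The Teukolsky derivative `D_a P = ∇_a P + p (ω_a + B_a) P` of a spinor field of GHP type
`{p,0}`. -/
def teukolskyD (o ι : M → Spinor) (p : ℤ) {n : ℕ} (P : M → (Fin n → Fin 2) → ℂ) (x : M)
    (a : Fin 4) (B : Fin n → Fin 2) : ℂ :=
  S.nablaMulti P x a B + (p : ℂ) * (S.ghpForm o ι x a + S.teukolskyForm o ι x a) * P x B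

/-- The weighted Killing spinor equation `D_{A'}{}^{(A} P^{B₁…B_n)} = 0` at the point `x`, for a
spinor field of GHP type `{p,0}`; here `D_{A'}{}^A = ε^{AC} D_{CA'}`. -/
def IsWeightedKillingAt (o ι : M → Spinor) (p : ℤ) {n : ℕ} (P : M → (Fin n → Fin 2) → ℂ)
    (x : M) : Prop :=
  ∀ (A' : Fin 2) (B : Fin (n + 1) → Fin 2),
    ∑ π : Equiv.Perm (Fin (n + 1)), ∑ C, spinEps (B (π 0)) C *
      ∑ a, infeldInv a C A' * S.teukolskyD o ι p P x a (fun r => B (π r.succ)) = 0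

end SpinSpacetime

/-- A smooth spin frame: `o_A ι^A = 1`. -/
structure IsSpinDyad {M : Type*} [TopologicalSpace M]
    [ChartedSpace (EuclideanSpace ℝ (Fin 4)) M] (o ι : M → Spinor) : Prop where
  smooth_o : ContMDiff (𝓡 4) 𝓘(ℝ, Spinor) ∞ o
  smooth_ι : ContMDiff (𝓡 4) 𝓘(ℝ, Spinor) ∞ ι
  normalized : ∀ x, spinProd (o x) (ι x) = 1

/-- The representative of a spinor field of conformal weight `w` and GHP type `{p,0}` after the
conformal and GHP transformation `(Ω, λ)`, that is `Ω^w λ^p κ^A`.  Components with respect to the spin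
frame of the rescaled spacetime, which is `Ω^{-1/2}` times the original one (as `ε̂ = Ω ε`), acquire
the further factor `Ω^{1/2}`. -/
def gaugeTransform {M : Type*} (w : ℝ) (p : ℤ) (Ω : M → ℝ) (lam : M → ℂ) (κ : M → Spinor) :
    M → Spinor :=
  fun x => (((Ω x ^ (w + 1 / 2) : ℝ) : ℂ) * lam x ^ p) • κ x

end

/-! Write `∇o = A o + B ι` and `∇ι = C o - A ι` with 1-forms `A`, `B`, `C` (`dyadA`, `dyadB`,
`dyadC`). Up to sign, `B` takes the values κ, σ, ρ, τ on ℓ, m, m̄, n, and `C` takes the values κ',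
σ', ρ', τ' on n, m̄, m, ℓ. The form `f` involves only ρ, τ, ρ', τ' (`weylForm_eq`), and with it
everything in `𝒞o` cancels except the terms κι and σι in the directions ℓ and m (`sum_confGHP`).
Thus `𝒞o = 0` says exactly that `o` is geodesic and shear-free, and `𝒞ι = 0` says the same of `ι`.
This condition does not depend on the conformal and GHP gauge (`pair_dyadB_rescale_eq_zero_iff`), so
the first statement is the Goldberg–Sachs theorem for Einstein metrics together with its converse.

For an Einstein metric the curvature of the spin connection consists of Ψ and a constant multiple of
εε (`spinCurv_eq_phi`), and the second Bianchi identity becomes `∇_{E'}{}^A Ψ_{ABCD} = 0`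
(`nablaWeyl_bianchi`). Let κ = σ = 0. The structure equation for `B`, evaluated on ℓ and m, gives Ψ₀
= 0. The Bianchi identity then gives linear equations for the derivatives of Ψ₁ along ℓ and m, and
comparing their commutator with the structure equations for `A` and `B` leaves 10 Ψ₁² = 0
(`psi_eq_zero_of_geodesic_shearfree`). Conversely, if Ψ₀ = Ψ₁ = 0 but κ or σ is nonzero at a point,
the Bianchi identities make Ψ₂, Ψ₃, Ψ₄ vanish in turn near that point, against density
(`geodesic_shearfree_of_psi`). Type D also requires that Ψ has no zeros: there `dΨ₂ = hΨ₂` with a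
smooth 1-form `h`, so a zero of Ψ₂ would spread to an open set (`psi_two_ne_zero`).

For the Killing spinors, raise the unprimed index of the 1-forms. In type D, `B` becomes a multiple
b of `o`, `C` a multiple -g of `ι`, the Teukolsky form becomes -bι, and the logarithmic derivative
of Ψ₂^{1/3} becomes bι - go (`raise_forms`). Hence each factor y of the product contributes to `D P`
a multiple of f ⊗ (product) - y ⊗ (product with y replaced by f), where f is the other spinor of the
dyad. Total symmetrisation kills every such difference (`sum_perm_exchange`). -/

noncomputable section

/-! ### Vector fields as derivations, brackets and smoothness of frame coefficients, through charts.
-/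

section ChartCommutator

lemma two_le_smooth : (2 : ℕ∞ω) ≤ ∞ := WithTop.coe_le_coe.2 le_top

variable {M : Type*} [TopologicalSpace M] [ChartedSpace (EuclideanSpace ℝ (Fin 4)) M]
  [IsManifold (𝓡 4) ∞ M] {F : Type*} [NormedAddCommGroup F] [NormedSpace ℝ F]

/-- The derivative of a function along a vector field. -/
def vecDeriv (V : (x : M) → TangentSpace (𝓡 4) x) (f : M → F) (x : M) : F :=
  mfderiv (𝓡 4) 𝓘(ℝ, F) f x (V x)

/-- A smooth vector field. -/
def SmoothField (V : (x : M) → TangentSpace (𝓡 4) x) : Prop :=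
  ContMDiff (𝓡 4) (𝓡 4).tangent ∞ (fun x => (⟨x, V x⟩ : TangentBundle (𝓡 4) M))

/-- A vector field read in the chart at `x₀`. -/
def chartField (x₀ : M) (V : (x : M) → TangentSpace (𝓡 4) x) (y : EuclideanSpace ℝ (Fin 4)) :
    EuclideanSpace ℝ (Fin 4) :=
  mpullbackWithin 𝓘(ℝ, EuclideanSpace ℝ (Fin 4)) (𝓡 4) (extChartAt (𝓡 4) x₀).symm V
    (Set.range (𝓡 4)) y

/-- The chain rule for `f` after the inverse chart. The pullback applies the inverse of the
derivative of that inverse chart, so the two cancel. -/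
lemma vecDeriv_eq_fderiv_chart {f : M → F} (hf : MDifferentiable (𝓡 4) 𝓘(ℝ, F) f) (x₀ : M)
    (V : (x : M) → TangentSpace (𝓡 4) x)
    {y : EuclideanSpace ℝ (Fin 4)} (hy : y ∈ (extChartAt (𝓡 4) x₀).target) :
    vecDeriv V f ((extChartAt (𝓡 4) x₀).symm y) =
      fderiv ℝ (f ∘ (extChartAt (𝓡 4) x₀).symm) y (chartField x₀ V y) := by
  have : IsManifold (𝓡 4) 1 M := IsManifold.of_le (n := ∞) (by simp)
  have hinv := isInvertible_mfderivWithin_extChartAt_symm (I := 𝓡 4) (x := x₀) hy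
  have hd : MDifferentiableAt 𝓘(ℝ, EuclideanSpace ℝ (Fin 4)) (𝓡 4) (extChartAt (𝓡 4) x₀).symm y := by
    have := (contMDiffOn_extChartAt_symm (I := 𝓡 4) (n := 1) x₀).contMDiffAt
      ((isOpen_extChartAt_target (I := 𝓡 4) x₀).mem_nhds hy)
    exact this.mdifferentiableAt one_ne_zero
  have hc := mfderiv_comp y (hf _) hd
  rw [← mfderiv_eq_fderiv, hc, vecDeriv, chartField]
  obtain ⟨A, hA⟩ := hinv
  simp only [mpullbackWithin, ModelWithCorners.Boundaryless.range_eq_univ, mfderivWithin_univ] at hA ⊢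
  rw [← hA, ContinuousLinearMap.inverse_equiv]
  exact congrArg _ (A.apply_symm_apply _).symm

lemma SmoothField.differentiableAt_chartField {V : (x : M) → TangentSpace (𝓡 4) x}
    (hV : SmoothField V) (x : M) :
    DifferentiableAt ℝ (chartField x V) (extChartAt (𝓡 4) x x) := by
  have : IsManifold (𝓡 4) 2 M := IsManifold.of_le (n := ∞) two_le_smooth
  have := ((hV.mdifferentiable (by simp)) x).mdifferentiableWithinAt (s := Set.univ)
    |>.differentiableWithinAt_mpullbackWithin_vectorField
  have h2 : ((extChartAt (𝓡 4) x).symm ⁻¹' Set.univ ∩ Set.range (𝓡 4) : Set _) = Set.univ := by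
    simp
  rw [h2] at this
  exact differentiableWithinAt_univ.1 this

/-- The manifold bracket is defined by a bracket in the preferred chart at `x`. The derivative of
that chart at `x` is the identity in the tangent coordinates, so no transformation remains. -/
lemma chartField_mlieBracket (V W : (x : M) → TangentSpace (𝓡 4) x) (x : M) :
    chartField x (mlieBracket (𝓡 4) V W) (extChartAt (𝓡 4) x x) =
      lieBracket ℝ (chartField x V) (chartField x W) (extChartAt (𝓡 4) x x) := by
  have : IsManifold (𝓡 4) 1 M := IsManifold.of_le (n := ∞) (by simp)
  have hx := extChartAt_to_inv (I := 𝓡 4) x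
  have h2 : ((extChartAt (𝓡 4) x).symm ⁻¹' Set.univ ∩ Set.range (𝓡 4) : Set _) = Set.univ := by
    simp
  have h := mfderivWithin_extChartAt_symm_inverse_apply (I := 𝓡 4) (x := x)
    (mlieBracket (𝓡 4) V W x)
  have h3 : chartField x (mlieBracket (𝓡 4) V W) (extChartAt (𝓡 4) x x) =
      mlieBracket (𝓡 4) V W x := by
    refine Eq.trans ?_ h
    simp only [chartField, mpullbackWithin]
    rw [hx]
  rw [h3, ← mlieBracketWithin_univ, mlieBracketWithin_apply, h2, mfderiv_extChartAt_self]
  have hid : ∀ z : EuclideanSpace ℝ (Fin 4),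
      (ContinuousLinearMap.id ℝ (EuclideanSpace ℝ (Fin 4))).inverse z = z := by simp
  refine (hid _).trans ?_
  exact congrFun (lieBracketWithin_univ (𝕜 := ℝ) (V := chartField x V) (W := chartField x W)) _

/-- In the chart this is the symmetry of the second derivative of a smooth function. The inner
derivatives must be rewritten on a whole neighbourhood before the outer ones are taken. -/
lemma vecDeriv_mlieBracket {f : M → F} (hf : ContMDiff (𝓡 4) 𝓘(ℝ, F) ∞ f)
    {V W : (x : M) → TangentSpace (𝓡 4) x} (hV : SmoothField V) (hW : SmoothField W)
    (hfV : MDifferentiable (𝓡 4) 𝓘(ℝ, F) (vecDeriv V f))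
    (hfW : MDifferentiable (𝓡 4) 𝓘(ℝ, F) (vecDeriv W f)) (x : M) :
    vecDeriv (mlieBracket (𝓡 4) V W) f x =
      vecDeriv V (vecDeriv W f) x - vecDeriv W (vecDeriv V f) x := by
  have hmem := mem_extChartAt_target (I := 𝓡 4) x
  have hx := extChartAt_to_inv (I := 𝓡 4) x
  have hfd : MDifferentiable (𝓡 4) 𝓘(ℝ, F) f := hf.mdifferentiable (by simp)
  have hbr := vecDeriv_eq_fderiv_chart hfd x (mlieBracket (𝓡 4) V W) hmem
  have h1 := vecDeriv_eq_fderiv_chart hfW x V hmem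
  have h2 := vecDeriv_eq_fderiv_chart hfV x W hmem
  rw [hx] at hbr h1 h2
  rw [hbr, h1, h2]
  have hev : ∀ U : (x : M) → TangentSpace (𝓡 4) x,
      ((vecDeriv U f) ∘ (extChartAt (𝓡 4) x).symm) =ᶠ[nhds (extChartAt (𝓡 4) x x)]
        fun y => fderiv ℝ (f ∘ (extChartAt (𝓡 4) x).symm) y (chartField x U y) := by
    intro U
    filter_upwards [(isOpen_extChartAt_target (I := 𝓡 4) x).mem_nhds hmem] with y hy
    exact vecDeriv_eq_fderiv_chart hfd x U hy
  rw [(hev V).fderiv_eq, (hev W).fderiv_eq]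
  have hfc : ContDiffAt ℝ ∞ (f ∘ (extChartAt (𝓡 4) x).symm) (extChartAt (𝓡 4) x x) := by
    rw [← contMDiffAt_iff_contDiffAt]
    refine ContMDiffAt.comp _ hf.contMDiffAt ?_
    exact (contMDiffOn_extChartAt_symm (I := 𝓡 4) (n := ∞) x).contMDiffAt
      ((isOpen_extChartAt_target (I := 𝓡 4) x).mem_nhds hmem)
  rw [chartField_mlieBracket]
  exact fderiv_apply_lieBracket (𝕜 := ℝ) hfc (by
    rw [minSmoothness_of_isRCLikeNormedField]; exact two_le_smooth)
    (hW.differentiableAt_chartField x) (hV.differentiableAt_chartField x)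

/-- The derivative is the fibre component of the tangent map of `f` composed with the section `V`.
-/
lemma SmoothField.contMDiff_vecDeriv {V : (x : M) → TangentSpace (𝓡 4) x} (hV : SmoothField V)
    {f : M → F} (hf : ContMDiff (𝓡 4) 𝓘(ℝ, F) ∞ f) :
    ContMDiff (𝓡 4) 𝓘(ℝ, F) ∞ (vecDeriv V f) := by
  have : IsManifold (𝓡 4) 1 M := IsManifold.of_le (n := ∞) (by simp)
  have h := hf.contMDiff_tangentMap (m := ∞) (by simp)
  exact (contMDiff_snd_tangentBundle_modelSpace F 𝓘(ℝ, F)).comp (h.comp hV)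

lemma SmoothField.mlieBracket {V W : (x : M) → TangentSpace (𝓡 4) x} (hV : SmoothField V)
    (hW : SmoothField W) : SmoothField (mlieBracket (𝓡 4) V W) := by
  have : IsManifold (𝓡 4) ((⊤ : ℕ∞) + 1) M := IsManifold.of_le (n := ∞) (by simp)
  have : IsManifold (𝓡 4) (minSmoothness ℝ 2) M :=
    IsManifold.of_le (n := ∞) (by
      rw [minSmoothness_of_isRCLikeNormedField]; exact two_le_smooth)
  exact fun x => ContMDiffAt.mlieBracket_vectorField (m := ⊤) (n := ⊤) (hV x) (hW x)
    (by rw [minSmoothness_of_isRCLikeNormedField]; simp)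

/-- The components of a smooth vector field in a smooth frame are smooth. -/
lemma SmoothField.contMDiff_coeff {e : Fin 4 → (x : M) → TangentSpace (𝓡 4) x}
    (he : ∀ i, SmoothField (e i)) (hli : ∀ x, LinearIndependent ℝ (fun i => e i x))
    {V : (x : M) → TangentSpace (𝓡 4) x} (hV : SmoothField V) {a : M → Fin 4 → ℝ}
    (ha : ∀ x, V x = ∑ i, a x i • e i x) (i : Fin 4) :
    ContMDiff (𝓡 4) 𝓘(ℝ, ℝ) ∞ (fun x => a x i) := by
  intro x₀
  let tr := trivializationAt (EuclideanSpace ℝ (Fin 4)) (TangentSpace (𝓡 4) (M := M)) x₀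
  -- `A x` is the matrix of the frame in a local trivialisation. The coefficients are `A x` inverse
  -- applied to `V`, and inversion of linear maps is smooth at invertible ones.
  let A : M → (EuclideanSpace ℝ (Fin 4)) →L[ℝ] (EuclideanSpace ℝ (Fin 4)) := fun x =>
    ∑ i, (EuclideanSpace.proj i : EuclideanSpace ℝ (Fin 4) →L[ℝ] ℝ).smulRight (tr ⟨x, e i x⟩).2
  have hA : ContMDiffAt (𝓡 4) 𝓘(ℝ, EuclideanSpace ℝ (Fin 4) →L[ℝ] EuclideanSpace ℝ (Fin 4)) ∞ A x₀ := by
    refine ContMDiffAt.sum fun i _ => ?_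
    have h1 := (Bundle.contMDiffAt_section x₀).1 (he i x₀)
    have h2 : ContDiff ℝ ∞ (fun v : EuclideanSpace ℝ (Fin 4) =>
      (EuclideanSpace.proj i : EuclideanSpace ℝ (Fin 4) →L[ℝ] ℝ).smulRight v) :=
      ((ContinuousLinearMap.smulRightL ℝ (EuclideanSpace ℝ (Fin 4)) (EuclideanSpace ℝ (Fin 4)))
        (EuclideanSpace.proj i)).contDiff
    exact h2.contMDiff.contMDiffAt.comp x₀ h1
  have hx₀ : x₀ ∈ tr.baseSet := FiberBundle.mem_baseSet_trivializationAt' x₀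
  have happ : ∀ x (hx : x ∈ tr.baseSet) (v : EuclideanSpace ℝ (Fin 4)), A x v =
      tr.continuousLinearEquivAt ℝ x hx (∑ i, v i • e i x) := by
    intro x hx v
    simp only [map_sum, map_smul, A, sum_apply,
      ContinuousLinearMap.smulRight_apply]
    rfl
  have hinv : ∀ x ∈ tr.baseSet, ∃ B : EuclideanSpace ℝ (Fin 4) ≃L[ℝ] EuclideanSpace ℝ (Fin 4),
      (B : _ →L[ℝ] _) = A x := by
    intro x hx
    have hinj : Function.Injective (A x) := by
      rw [injective_iff_map_eq_zero]
      intro v hv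
      rw [happ x hx] at hv
      have h0 := (map_eq_zero_iff _ (tr.continuousLinearEquivAt ℝ x hx).injective).1 hv
      ext i
      exact Fintype.linearIndependent_iff.1 (hli x) _ h0 i
    exact ⟨(LinearEquiv.ofInjectiveEndo (A x : _ →ₗ[ℝ] _) hinj).toContinuousLinearEquiv, by
      ext; simp⟩
  have hcoef : (fun x => a x i) =ᶠ[nhds x₀] fun x =>
      EuclideanSpace.proj (𝕜 := ℝ) i ((ContinuousLinearMap.inverse (A x)) (tr ⟨x, V x⟩).2) := by
    filter_upwards [tr.open_baseSet.mem_nhds hx₀] with x hx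
    obtain ⟨B, hB⟩ := hinv x hx
    have h1 : (tr ⟨x, V x⟩).2 = A x (WithLp.toLp 2 (a x)) := by
      rw [happ x hx, ha x]
      rfl
    rw [h1, ← hB, ContinuousLinearMap.inverse_equiv]
    simp
  refine ContMDiffAt.congr_of_eventuallyEq ?_ hcoef
  have hVx := (Bundle.contMDiffAt_section x₀).1 (hV x₀)
  obtain ⟨B, hB⟩ := hinv x₀ hx₀
  have hI : ContMDiffAt (𝓡 4) 𝓘(ℝ, EuclideanSpace ℝ (Fin 4) →L[ℝ] EuclideanSpace ℝ (Fin 4)) ∞ (fun x => ContinuousLinearMap.inverse (A x)) x₀ := by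
    have h1 : ContDiffAt ℝ ∞ ContinuousLinearMap.inverse (A x₀) := by
      rw [← hB]; exact contDiffAt_map_inverse B
    exact h1.contMDiffAt.comp x₀ hA
  exact (EuclideanSpace.proj (𝕜 := ℝ) i).contDiff.contMDiff.contMDiffAt.comp x₀ (hI.clm_apply hVx)

end ChartCommutator
end

/-! ### Smooth complex functions, calculus of frame derivatives, and the Jacobi identity. -/

noncomputable section

section Smooth

variable {M : Type*} [TopologicalSpace M] [ChartedSpace (EuclideanSpace ℝ (Fin 4)) M]

/-- A smooth complex function. -/
@[fun_prop]
def Sm (f : M → ℂ) : Prop := ContMDiff (𝓡 4) 𝓘(ℝ, ℂ) ∞ f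

@[fun_prop]
lemma Sm.const (c : ℂ) : Sm (fun _ : M => c) := contMDiff_const

@[fun_prop]
lemma Sm.add {f g : M → ℂ} (hf : Sm f) (hg : Sm g) : Sm (fun x => f x + g x) :=
  ContMDiff.add hf hg

@[fun_prop]
lemma Sm.sub {f g : M → ℂ} (hf : Sm f) (hg : Sm g) : Sm (fun x => f x - g x) :=
  ContMDiff.sub hf hg

@[fun_prop]
lemma Sm.neg {f : M → ℂ} (hf : Sm f) : Sm (fun x => -f x) :=
  ContMDiff.neg hf

@[fun_prop]
lemma Sm.mul {f g : M → ℂ} (hf : Sm f) (hg : Sm g) : Sm (fun x => f x * g x) :=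
  (contDiff_mul.contMDiff (n := ∞)).comp (hf.prodMk_space hg)

@[fun_prop]
lemma Sm.sum {ι : Type*} {s : Finset ι} {f : ι → M → ℂ} (hf : ∀ i, Sm (f i)) :
    Sm (fun x => ∑ i ∈ s, f i x) :=
  ContMDiff.sum fun i _ => hf i

@[fun_prop]
lemma Sm.conj {f : M → ℂ} (hf : Sm f) : Sm (fun x => conj (f x)) :=
  (Complex.conjCLE.contDiff (n := ∞)).contMDiff.comp hf

lemma Sm.ofReal {f : M → ℝ} (hf : ContMDiff (𝓡 4) 𝓘(ℝ, ℝ) ∞ f) : Sm (fun x => (f x : ℂ)) :=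
  (Complex.ofRealCLM.contDiff (n := ∞)).contMDiff.comp hf

lemma Sm.mdiffAt {f : M → ℂ} (hf : Sm f) (x : M) : MDifferentiableAt (𝓡 4) 𝓘(ℝ, ℂ) f x :=
  hf.mdifferentiable (by simp) x

end Smooth

namespace SpinSpacetime

variable {M : Type*} [TopologicalSpace M] [ChartedSpace (EuclideanSpace ℝ (Fin 4)) M]
  [IsManifold (𝓡 4) ∞ M] (S : SpinSpacetime M)

lemma smoothField_e (i : Fin 4) : SmoothField (S.e i) := S.smooth_e i

lemma linearIndependent_e (x : M) : LinearIndependent ℝ (fun i => S.e i x) := by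
  rw [Fintype.linearIndependent_iff]
  intro a ha i
  have h := congrArg (fun v => S.g x v (S.e i x)) ha
  simp only [map_sum, map_smul, LinearMap.sum_apply, LinearMap.smul_apply, S.orthonormal,
    smul_eq_mul, minkowski, map_zero, LinearMap.zero_apply] at h
  simp only [mul_ite, mul_zero, Finset.sum_ite_eq', Finset.mem_univ, if_true] at h
  have h2 : minkowskiSign i ≠ 0 := by unfold minkowskiSign; split_ifs <;> norm_num
  exact (mul_eq_zero.1 h).resolve_right h2

/-- Four independent vectors are a basis in dimension four. Orthonormality identifies the
coefficients, with a sign because η is its own inverse. -/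
lemma frame_expansion (x : M) (v : TangentSpace (𝓡 4) x) :
    v = ∑ k, (minkowskiSign k * S.g x v (S.e k x)) • S.e k x := by
  have hfr : Module.finrank ℝ (TangentSpace (𝓡 4) x) = 4 := by
    change Module.finrank ℝ (EuclideanSpace ℝ (Fin 4)) = 4
    simp
  let b := basisOfLinearIndependentOfCardEqFinrank (S.linearIndependent_e x) (by rw [hfr]; rfl)
  have hb : ∀ i, b i = S.e i x := fun i => by simp [b]
  have hv := b.sum_repr v
  simp only [hb] at hv
  have hk : ∀ k, minkowskiSign k * S.g x v (S.e k x) = b.repr v k := by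
    intro k
    conv_lhs => rw [← hv]
    simp only [map_sum, map_smul, LinearMap.sum_apply, LinearMap.smul_apply, S.orthonormal,
      smul_eq_mul, minkowski]
    simp only [mul_ite, mul_zero, Finset.sum_ite_eq', Finset.mem_univ, if_true]
    have h2 : minkowskiSign k * minkowskiSign k = 1 := by
      unfold minkowskiSign; split_ifs <;> norm_num
    linear_combination b.repr v k * h2
  simp only [hk]
  exact hv.symm

/-- The metric is not assumed smooth. These products are, up to sign, the coefficients of a smooth
field in a smooth frame. -/
lemma contMDiff_g_e {V : (x : M) → TangentSpace (𝓡 4) x} (hV : SmoothField V) (k : Fin 4) :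
    ContMDiff (𝓡 4) 𝓘(ℝ, ℝ) ∞ (fun x => S.g x (V x) (S.e k x)) := by
  have h := SmoothField.contMDiff_coeff S.smoothField_e S.linearIndependent_e hV
    (a := fun x k => minkowskiSign k * S.g x (V x) (S.e k x))
    (fun x => S.frame_expansion x (V x)) k
  have h3 := (contMDiff_const (c := minkowskiSign k)).mul h
  refine h3.congr fun x => ?_
  have h2 : minkowskiSign k * minkowskiSign k = 1 := by
    unfold minkowskiSign; split_ifs <;> norm_num
  simp only [Pi.mul_apply]
  linear_combination -(S.g x (V x) (S.e k x)) * h2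

lemma contMDiff_structureFun (i j k : Fin 4) :
    ContMDiff (𝓡 4) 𝓘(ℝ, ℝ) ∞ (S.structureFun i j k) :=
  S.contMDiff_g_e ((S.smoothField_e i).mlieBracket (S.smoothField_e j)) k

lemma structureFun_swap (i j k : Fin 4) (x : M) :
    S.structureFun j i k x = -S.structureFun i j k x := by
  unfold structureFun
  rw [mlieBracket_swap_apply, map_neg, LinearMap.neg_apply]

/-- `c_{ij}{}^k`, as a complex function. -/
def cc (i j k : Fin 4) (x : M) : ℂ := (minkowskiSign k : ℂ) * (S.structureFun i j k x : ℂ)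

@[fun_prop]
lemma Sm_cc (i j k : Fin 4) : Sm (S.cc i j k) :=
  (Sm.const _).mul (Sm.ofReal (S.contMDiff_structureFun i j k))

/-! ### Rules for the frame derivatives -/

@[fun_prop]
lemma Sm_frameDeriv (i : Fin 4) {f : M → ℂ} (hf : Sm f) : Sm (S.frameDeriv i f) :=
  (S.smoothField_e i).contMDiff_vecDeriv hf

lemma fd_const (i : Fin 4) (c : ℂ) (x : M) : S.frameDeriv i (fun _ => c) x = 0 := by
  unfold frameDeriv
  rw [mfderiv_const]
  rfl

lemma fd_add (i : Fin 4) {f g : M → ℂ} (hf : Sm f) (hg : Sm g) (x : M) :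
    S.frameDeriv i (fun y => f y + g y) x = S.frameDeriv i f x + S.frameDeriv i g x := by
  unfold frameDeriv
  exact congrArg (fun A => A (S.e i x)) (mfderiv_add (hf.mdiffAt x) (hg.mdiffAt x))

lemma fd_neg (i : Fin 4) (f : M → ℂ) (x : M) :
    S.frameDeriv i (fun y => -f y) x = -S.frameDeriv i f x := by
  unfold frameDeriv
  have h : mfderiv (𝓡 4) 𝓘(ℝ, ℂ) (fun y => -f y) x = -mfderiv (𝓡 4) 𝓘(ℝ, ℂ) f x := mfderiv_neg
  rw [h]
  rfl

lemma fd_sub (i : Fin 4) {f g : M → ℂ} (hf : Sm f) (hg : Sm g) (x : M) :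
    S.frameDeriv i (fun y => f y - g y) x = S.frameDeriv i f x - S.frameDeriv i g x := by
  simp only [sub_eq_add_neg]
  rw [S.fd_add i hf hg.neg, S.fd_neg]

lemma fd_mul (i : Fin 4) {f g : M → ℂ} (hf : Sm f) (hg : Sm g) (x : M) :
    S.frameDeriv i (fun y => f y * g y) x =
      S.frameDeriv i f x * g x + f x * S.frameDeriv i g x := by
  unfold frameDeriv
  have h : mfderiv (𝓡 4) 𝓘(ℝ, ℂ) (fun y => f y * g y) x = _ :=
    ((hf.mdiffAt x).hasMFDerivAt.mul (hg.mdiffAt x).hasMFDerivAt).mfderiv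
  rw [h]
  change f x * S.frameDeriv i g x + g x * S.frameDeriv i f x =
    S.frameDeriv i f x * g x + f x * S.frameDeriv i g x
  ring

lemma fd_const_mul (i : Fin 4) (c : ℂ) {f : M → ℂ} (hf : Sm f) (x : M) :
    S.frameDeriv i (fun y => c * f y) x = c * S.frameDeriv i f x := by
  rw [S.fd_mul i (Sm.const c) hf, fd_const]
  ring

lemma fd_sum {ι : Type*} (i : Fin 4) (s : Finset ι) {f : ι → M → ℂ} (hf : ∀ k, Sm (f k)) (x : M) :
    S.frameDeriv i (fun y => ∑ k ∈ s, f k y) x = ∑ k ∈ s, S.frameDeriv i (f k) x := by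
  classical
  induction s using Finset.induction_on with
  | empty => simp [fd_const]
  | insert a s ha ih =>
    simp only [Finset.sum_insert ha]
    rw [S.fd_add i (hf a) (Sm.sum hf), ih]

lemma fd_comp_clm {F G : Type*} [NormedAddCommGroup F] [NormedSpace ℝ F] [NormedAddCommGroup G]
    [NormedSpace ℝ G] (i : Fin 4) (A : F →L[ℝ] G) {f : M → F} {x : M}
    (hf : MDifferentiableAt (𝓡 4) 𝓘(ℝ, F) f x) :
    S.frameDeriv i (fun y => A (f y)) x = A (S.frameDeriv i f x) := by
  unfold frameDeriv
  have h := mfderiv_comp x (A.differentiable.mdifferentiable (f x)) hf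
  rw [mfderiv_eq_fderiv, A.fderiv] at h
  exact congrArg (fun A => A (S.e i x)) h

lemma fd_conj (i : Fin 4) {f : M → ℂ} (hf : Sm f) (x : M) :
    S.frameDeriv i (fun y => conj (f y)) x = conj (S.frameDeriv i f x) :=
  S.fd_comp_clm i (Complex.conjCLE : ℂ →L[ℝ] ℂ) (hf.mdiffAt x)

lemma fd_ofReal (i : Fin 4) {f : M → ℝ} (hf : ContMDiff (𝓡 4) 𝓘(ℝ, ℝ) ∞ f) (x : M) :
    S.frameDeriv i (fun y => (f y : ℂ)) x = ((S.frameDeriv i f x : ℝ) : ℂ) :=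
  S.fd_comp_clm i Complex.ofRealCLM (hf.mdifferentiable (by simp) x)

lemma fd_congr {F : Type*} [NormedAddCommGroup F] [NormedSpace ℝ F] (i : Fin 4) {f g : M → F} {x : M}
    (h : f =ᶠ[nhds x] g) : S.frameDeriv i f x = S.frameDeriv i g x := by
  unfold frameDeriv
  rw [h.mfderiv_eq]
  rfl

/-- The commutator of two frame derivatives. -/
lemma fd_comm (i j : Fin 4) {f : M → ℂ} (hf : Sm f) (x : M) :
    S.frameDeriv i (S.frameDeriv j f) x - S.frameDeriv j (S.frameDeriv i f) x =
      ∑ k, S.cc i j k x * S.frameDeriv k f x := by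
  have h := vecDeriv_mlieBracket hf (S.smoothField_e i) (S.smoothField_e j)
    ((S.Sm_frameDeriv i hf).mdiffAt) ((S.Sm_frameDeriv j hf).mdiffAt) x
  refine h.symm.trans ?_
  unfold vecDeriv
  have h2 := S.frame_expansion x (mlieBracket (𝓡 4) (S.e i) (S.e j) x)
  have h3 := congrArg (fun v => (mfderiv (𝓡 4) 𝓘(ℝ, ℂ) f x v : ℂ)) h2
  refine h3.trans ?_
  simp only [map_sum, map_smul]
  refine Finset.sum_congr rfl fun k _ => ?_
  change ((minkowskiSign k * S.structureFun i j k x : ℝ) • S.frameDeriv k f x : ℂ) = _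
  rw [Complex.real_smul]
  push_cast
  rfl

/-- The Leibniz rule in the second argument, used to expand nested brackets of frame fields in the
frame itself. -/
lemma mlieBracket_sum_smul {V : (x : M) → TangentSpace (𝓡 4) x}
    {a : Fin 4 → M → ℝ} (ha : ∀ m, ContMDiff (𝓡 4) 𝓘(ℝ, ℝ) ∞ (a m)) (s : Finset (Fin 4)) (x : M) :
    mlieBracket (𝓡 4) V (∑ m ∈ s, a m • S.e m) x =
      ∑ m ∈ s, (vecDeriv V (a m) x • S.e m x + a m x • mlieBracket (𝓡 4) V (S.e m) x) := by
  have : IsManifold (𝓡 4) 1 M := IsManifold.of_le (n := ∞) (by simp)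
  have : IsManifold (𝓡 4) 2 M := IsManifold.of_le (n := ∞) two_le_smooth
  have hs : ∀ m, SmoothField (a m • S.e m) := fun m => (ha m).smul_section (S.smooth_e m)
  have hs2 : ∀ s : Finset (Fin 4), SmoothField (∑ m ∈ s, a m • S.e m) := by
    intro s
    induction s using Finset.induction_on with
    | empty =>
      simp only [Finset.sum_empty]
      exact Bundle.contMDiff_zeroSection ℝ (TangentSpace (𝓡 4) (M := M))
    | insert b s hb ih =>
      rw [Finset.sum_insert hb]
      exact ContMDiff.add_section (hs b) ih
  induction s using Finset.induction_on with
  | empty => simp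
  | insert b s hb ih =>
    rw [Finset.sum_insert hb, Finset.sum_insert hb,
      mlieBracket_add_right ((hs b).mdifferentiable (by simp) x)
        ((hs2 s).mdifferentiable (by simp) x), ih,
      mlieBracket_smul_right ((ha b).mdifferentiable (by simp) x)
        ((S.smooth_e b).mdifferentiable (by simp) x)]
    rfl

/-- `[e_i, [e_j, e_k]]`, in components. -/
lemma g_mlieBracket_mlieBracket (i j k n : Fin 4) (x : M) :
    (S.g x (mlieBracket (𝓡 4) (S.e i) (mlieBracket (𝓡 4) (S.e j) (S.e k)) x) (S.e n x) : ℂ) =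
      minkowskiSign n * (S.frameDeriv i (S.cc j k n) x + ∑ m, S.cc j k m x * S.cc i m n x) := by
  have hsm : ∀ m, ContMDiff (𝓡 4) 𝓘(ℝ, ℝ) ∞ (fun y => minkowskiSign m * S.structureFun j k m y) :=
    fun m => (contDiff_mul.contMDiff (n := ∞)).comp
      (contMDiff_const.prodMk_space (S.contMDiff_structureFun j k m))
  have h1 : mlieBracket (𝓡 4) (S.e j) (S.e k) =
      ∑ m, (fun y => minkowskiSign m * S.structureFun j k m y) • S.e m := by
    funext y
    rw [Finset.sum_apply]
    exact S.frame_expansion y _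
  have h2 : S.frameDeriv i (S.cc j k n) x = ((S.frameDeriv i
      (fun y => minkowskiSign n * S.structureFun j k n y) x : ℝ) : ℂ) := by
    rw [← S.fd_ofReal i (hsm n)]
    congr 1
    funext y
    simp [cc]
  rw [h1, S.mlieBracket_sum_smul hsm, h2]
  simp only [map_sum, map_add, map_smul, LinearMap.sum_apply, LinearMap.add_apply,
    LinearMap.smul_apply, S.orthonormal, smul_eq_mul, minkowski, Finset.sum_add_distrib]
  simp only [mul_ite, mul_zero, Finset.sum_ite_eq', Finset.mem_univ, if_true, cc]
  have h3 : minkowskiSign n * minkowskiSign n = 1 := by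
    unfold minkowskiSign; split_ifs <;> norm_num
  have h3' : (minkowskiSign n : ℂ) * minkowskiSign n = 1 := by exact_mod_cast h3
  push_cast
  rw [mul_add, Finset.mul_sum]
  congr 1
  · rw [mul_comm]; rfl
  · refine Finset.sum_congr rfl fun m _ => ?_
    change _ * ((S.structureFun i m n x : ℝ) : ℂ) = _
    linear_combination -((minkowskiSign m : ℂ) * S.structureFun j k m x * S.structureFun i m n x) * h3'

/-- The Jacobi identity for the structure functions. -/
lemma jacobi (i j k n : Fin 4) (x : M) :
    (S.frameDeriv i (S.cc j k n) x + ∑ m, S.cc j k m x * S.cc i m n x) +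
    (S.frameDeriv j (S.cc k i n) x + ∑ m, S.cc k i m x * S.cc j m n x) +
    (S.frameDeriv k (S.cc i j n) x + ∑ m, S.cc i j m x * S.cc k m n x) = 0 := by
  have : IsManifold (𝓡 4) (minSmoothness ℝ 3) M :=
    IsManifold.of_le (n := ∞) (by
      rw [minSmoothness_of_isRCLikeNormedField]; exact WithTop.coe_le_coe.2 le_top)
  have hle : minSmoothness ℝ 2 ≤ ∞ := by
    rw [minSmoothness_of_isRCLikeNormedField]; exact two_le_smooth
  have hJ := leibniz_identity_mlieBracket_apply (I := 𝓡 4) (x := x)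
    ((S.smooth_e i x).of_le hle) ((S.smooth_e j x).of_le hle) ((S.smooth_e k x).of_le hle)
  -- The Leibniz form `[U,[V,W]] = [[U,V],W] + [V,[U,W]]` becomes the cyclic sum by antisymmetry.
  have e1 : mlieBracket (𝓡 4) (mlieBracket (𝓡 4) (S.e i) (S.e j)) (S.e k) x =
      -mlieBracket (𝓡 4) (S.e k) (mlieBracket (𝓡 4) (S.e i) (S.e j)) x := mlieBracket_swap_apply
  have e2 : mlieBracket (𝓡 4) (S.e j) (mlieBracket (𝓡 4) (S.e i) (S.e k)) x =
      -mlieBracket (𝓡 4) (S.e j) (mlieBracket (𝓡 4) (S.e k) (S.e i)) x := by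
    rw [mlieBracket_swap (V := S.e i), ← neg_one_smul ℝ, mlieBracket_const_smul_right]
    · simp
    · exact ((S.smoothField_e k).mlieBracket (S.smoothField_e i)).mdifferentiable (by simp) x
  rw [e1, e2] at hJ
  have hg := congrArg (fun v => ((S.g x v (S.e n x) : ℝ) : ℂ)) hJ
  simp only [map_add, map_neg, LinearMap.add_apply, LinearMap.neg_apply, Complex.ofReal_add,
    Complex.ofReal_neg, g_mlieBracket_mlieBracket] at hg
  have h3 : (minkowskiSign n : ℂ) ≠ 0 := by
    unfold minkowskiSign; split_ifs <;> norm_num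
  apply mul_left_cancel₀ h3
  linear_combination hg

end SpinSpacetime
end

noncomputable section

/-! ### Tables of the constant symbols -/

/-- `1 / √2` as a complex number. -/
def invSqrtTwo : ℂ := ((1 / Real.sqrt 2 : ℝ) : ℂ)

lemma invSqrtTwo_sq : invSqrtTwo ^ 2 = 1 / 2 := by
  unfold invSqrtTwo
  rw [← Complex.ofReal_pow, div_pow, Real.sq_sqrt (by norm_num)]
  norm_num

lemma minkowskiSign_table : minkowskiSign 0 = 1 ∧ minkowskiSign 1 = -1 ∧ minkowskiSign 2 = -1 ∧
    minkowskiSign 3 = -1 := by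
  simp [minkowskiSign]

lemma spinEps_table : spinEps 0 0 = 0 ∧ spinEps 0 1 = 1 ∧ spinEps 1 0 = -1 ∧ spinEps 1 1 = 0 := by
  simp [spinEps]

lemma infeld_table :
    (infeld 0 0 0 = invSqrtTwo ∧ infeld 0 0 1 = 0 ∧ infeld 0 1 0 = 0 ∧ infeld 0 1 1 = invSqrtTwo) ∧
    (infeld 1 0 0 = 0 ∧ infeld 1 0 1 = invSqrtTwo ∧ infeld 1 1 0 = invSqrtTwo ∧ infeld 1 1 1 = 0) ∧
    (infeld 2 0 0 = 0 ∧ infeld 2 0 1 = invSqrtTwo * Complex.I ∧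
      infeld 2 1 0 = -(invSqrtTwo * Complex.I) ∧ infeld 2 1 1 = 0) ∧
    (infeld 3 0 0 = invSqrtTwo ∧ infeld 3 0 1 = 0 ∧ infeld 3 1 0 = 0 ∧
      infeld 3 1 1 = -invSqrtTwo) := by
  simp [infeld, invSqrtTwo]

lemma infeldInv_table :
    (infeldInv 0 0 0 = invSqrtTwo ∧ infeldInv 0 0 1 = 0 ∧ infeldInv 0 1 0 = 0 ∧
      infeldInv 0 1 1 = invSqrtTwo) ∧
    (infeldInv 1 0 0 = 0 ∧ infeldInv 1 0 1 = invSqrtTwo ∧ infeldInv 1 1 0 = invSqrtTwo ∧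
      infeldInv 1 1 1 = 0) ∧
    (infeldInv 2 0 0 = 0 ∧ infeldInv 2 0 1 = -(invSqrtTwo * Complex.I) ∧
      infeldInv 2 1 0 = invSqrtTwo * Complex.I ∧ infeldInv 2 1 1 = 0) ∧
    (infeldInv 3 0 0 = invSqrtTwo ∧ infeldInv 3 0 1 = 0 ∧ infeldInv 3 1 0 = 0 ∧
      infeldInv 3 1 1 = -invSqrtTwo) := by
  simp [infeldInv, infeld_table, spinEps_table, minkowskiSign_table, Fin.sum_univ_two]

/-- The antisymmetric (with respect to the Minkowski metric) endomorphisms `a_j{}^k`. -/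
def IsLorentzAlg (a : Fin 4 → Fin 4 → ℝ) : Prop :=
  ∀ j k, minkowskiSign k * a j k = -(minkowskiSign j * a k j)

/-- Six entries remain free, three boosts and three rotations. Used as rewriting rules, these reduce
identities in the Lorentz algebra to polynomial identities. -/
lemma IsLorentzAlg.eqs {a : Fin 4 → Fin 4 → ℝ} (h : IsLorentzAlg a) :
    (a 0 0 = 0 ∧ a 1 1 = 0 ∧ a 2 2 = 0 ∧ a 3 3 = 0) ∧
    (a 1 0 = a 0 1 ∧ a 2 0 = a 0 2 ∧ a 3 0 = a 0 3) ∧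
    (a 2 1 = -a 1 2 ∧ a 3 1 = -a 1 3 ∧ a 3 2 = -a 2 3) := by
  obtain ⟨h0, h1, h2, h3⟩ := minkowskiSign_table
  refine ⟨⟨?_, ?_, ?_, ?_⟩, ⟨?_, ?_, ?_⟩, ?_, ?_, ?_⟩
  · have := h 0 0; rw [h0] at this; linarith
  · have := h 1 1; rw [h1] at this; linarith
  · have := h 2 2; rw [h2] at this; linarith
  · have := h 3 3; rw [h3] at this; linarith
  · have := h 1 0; rw [h0, h1] at this; linarith
  · have := h 2 0; rw [h0, h2] at this; linarith
  · have := h 3 0; rw [h0, h3] at this; linarith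
  · have := h 2 1; rw [h1, h2] at this; linarith
  · have := h 3 1; rw [h1, h3] at this; linarith
  · have := h 3 2; rw [h2, h3] at this; linarith

/-- The image in `sl(2,ℂ)` of an element of the Lorentz algebra. -/
def spinOf (a : Fin 4 → Fin 4 → ℝ) (C B : Fin 2) : ℂ :=
  1 / 2 * ∑ j, ∑ k, ∑ A', infeldInv j C A' * (a j k : ℂ) * infeld k B A'

lemma spinOf_table {a : Fin 4 → Fin 4 → ℝ} (h : IsLorentzAlg a) :
    spinOf a 0 0 = 1 / 2 * (a 0 3 + a 1 2 * Complex.I) ∧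
    spinOf a 0 1 = 1 / 2 * (a 0 1 - a 0 2 * Complex.I + a 2 3 * Complex.I - a 1 3) ∧
    spinOf a 1 0 = 1 / 2 * (a 0 1 + a 0 2 * Complex.I + a 2 3 * Complex.I + a 1 3) ∧
    spinOf a 1 1 = -(1 / 2 * (a 0 3 + a 1 2 * Complex.I)) := by
  refine ⟨?_, ?_, ?_, ?_⟩ <;>
  · simp only [spinOf, Fin.sum_univ_four, Fin.sum_univ_two, infeld_table, infeldInv_table, h.eqs]
    push_cast
    ring_nf
    simp only [invSqrtTwo_sq]
    ring

lemma spinOf_trace {a : Fin 4 → Fin 4 → ℝ} (h : IsLorentzAlg a) : spinOf a 1 1 = -spinOf a 0 0 := by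
  simp only [spinOf_table h]

/-- Two applications of antisymmetry, one to each factor, exchange the products term by term in the
summed index. -/
lemma IsLorentzAlg.commutator {a b : Fin 4 → Fin 4 → ℝ} (ha : IsLorentzAlg a)
    (hb : IsLorentzAlg b) : IsLorentzAlg (fun k l => ∑ m, (b k m * a m l - a k m * b m l)) := by
  intro j k
  rw [Finset.mul_sum, Finset.mul_sum, ← Finset.sum_neg_distrib]
  refine Finset.sum_congr rfl fun m _ => ?_
  have e1 := ha j m
  have e3 := hb j m
  have f1 := ha m k
  have f2 := hb m k
  linear_combination b j m * f1 - a j m * f2 - a k m * e3 + b k m * e1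

/-- The commutator in the Lorentz algebra goes over into the one in `sl(2,ℂ)`. -/
lemma spinOf_commutator {a b : Fin 4 → Fin 4 → ℝ} (ha : IsLorentzAlg a) (hb : IsLorentzAlg b)
    (C B : Fin 2) :
    spinOf (fun k l => ∑ m, (b k m * a m l - a k m * b m l)) C B =
      ∑ D, (spinOf b C D * spinOf a D B - spinOf a C D * spinOf b D B) := by
  have hab := ha.commutator hb
  -- The commutator is made opaque, so that its spinor table applies first and its entries are
  -- expanded only afterwards.
  obtain ⟨c, hc⟩ : ∃ c : Fin 4 → Fin 4 → ℝ, c = fun k l => ∑ m, (b k m * a m l - a k m * b m l) :=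
    ⟨_, rfl⟩
  have hc' : ∀ k l, c k l = ∑ m, (b k m * a m l - a k m * b m l) := fun k l => by rw [hc]
  rw [← hc] at hab ⊢
  fin_cases C <;> fin_cases B <;>
  · simp only [Fin.zero_eta, Fin.mk_one, Fin.isValue, spinOf_table hab, spinOf_table ha,
      spinOf_table hb, Fin.sum_univ_two, hc', Fin.sum_univ_four, ha.eqs, hb.eqs]
    push_cast
    ring_nf
    simp only [Complex.I_sq]
    ring

/-- The symbols `σ_j^{AA'}` are invariant. -/
lemma infeld_invariant {a : Fin 4 → Fin 4 → ℝ} (ha : IsLorentzAlg a) (k : Fin 4) (A A' : Fin 2) :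
    ∑ j, (a k j : ℂ) * infeld j A A' =
      ∑ C, spinOf a C A * infeld k C A' + ∑ C', conj (spinOf a C' A') * infeld k A C' := by
  fin_cases k <;> fin_cases A <;> fin_cases A' <;>
  · simp only [Fin.zero_eta, Fin.mk_one, Fin.isValue, Fin.reduceFinMk, spinOf_table ha,
      Fin.sum_univ_two, Fin.sum_univ_four, ha.eqs, infeld_table, map_mul, map_add, map_sub, map_neg,
      map_one, map_div₀, map_ofNat, Complex.conj_ofReal, Complex.conj_I]
    push_cast
    ring_nf
    try simp only [Complex.I_sq]
    try ring

lemma infeldInv_infeld (A A' B B' : Fin 2) :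
    ∑ i, infeldInv i A A' * infeld i B B' = if A = B ∧ A' = B' then 1 else 0 := by
  fin_cases A <;> fin_cases A' <;> fin_cases B <;> fin_cases B' <;>
  · simp only [Fin.zero_eta, Fin.mk_one, Fin.isValue, Fin.sum_univ_four, infeld_table, 
      infeldInv_table]
    ring_nf
    try simp only [Complex.I_sq, invSqrtTwo_sq]
    norm_num

lemma infeld_infeldInv (i j : Fin 4) :
    ∑ A, ∑ A', infeldInv i A A' * infeld j A A' = if i = j then 1 else 0 := by
  fin_cases i <;> fin_cases j <;>
  · simp only [Fin.zero_eta, Fin.mk_one, Fin.isValue, Fin.sum_univ_two, infeld_table, Fin.reduceFinMk,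
      infeldInv_table]
    ring_nf
    try simp only [Complex.I_sq, invSqrtTwo_sq]
    norm_num
    try decide

/-- `∑ v^i σ_i^{AA'}` for the null vector `v = κ ξ̄`. -/
lemma sum_nullVec_infeld (κ ξ : Spinor) (A A' : Fin 2) :
    ∑ i, nullVec κ ξ i * infeld i A A' = κ A * conj (ξ A') := by
  have : ∑ i, nullVec κ ξ i * infeld i A A' =
      ∑ B, ∑ B', κ B * conj (ξ B') * ∑ i, infeldInv i B B' * infeld i A A' := by
    simp only [nullVec, Finset.sum_mul, Finset.mul_sum]
    rw [Finset.sum_comm]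
    refine Finset.sum_congr rfl fun B _ => ?_
    rw [Finset.sum_comm]
    exact Finset.sum_congr rfl fun B' _ => Finset.sum_congr rfl fun i _ => by ring
  rw [this]
  simp only [infeldInv_infeld]
  fin_cases A <;> fin_cases A' <;> simp [Fin.sum_univ_two]

/-- By completeness of the symbols a vector is recovered from its spinor components, so vector
identities may be checked on these. -/
lemma eq_of_sum_infeld {u v : Fin 4 → ℂ}
    (h : ∀ A A', ∑ i, u i * infeld i A A' = ∑ i, v i * infeld i A A') : u = v := by
  funext i
  have key : ∀ w : Fin 4 → ℂ, w i = ∑ A, ∑ A', infeldInv i A A' * ∑ j, w j * infeld j A A' := by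
    intro w
    have : ∑ A, ∑ A', infeldInv i A A' * ∑ j, w j * infeld j A A' =
        ∑ j, w j * ∑ A, ∑ A', infeldInv i A A' * infeld j A A' := by
      simp only [Finset.mul_sum]
      rw [Finset.sum_comm' (t' := Finset.univ) (s' := fun _ => Finset.univ) (by simp)]
      simp only [Fin.sum_univ_two, Fin.sum_univ_four]
      ring
    rw [this]
    simp only [infeld_infeldInv, mul_ite, mul_one, mul_zero, Finset.sum_ite_eq, Finset.mem_univ,
      if_true]
  rw [key u, key v]
  simp only [h]

/-- The action of the Lorentz algebra on a null vector. -/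
lemma nullVec_action {a : Fin 4 → Fin 4 → ℝ} (ha : IsLorentzAlg a) (κ ξ : Spinor) (j : Fin 4) :
    ∑ k, (a k j : ℂ) * nullVec κ ξ k =
      nullVec (fun B => ∑ C, spinOf a C B * κ C) ξ j +
      nullVec κ (fun B => ∑ C, spinOf a C B * ξ C) j := by
  have : (fun j => ∑ k, (a k j : ℂ) * nullVec κ ξ k) = fun j =>
      nullVec (fun B => ∑ C, spinOf a C B * κ C) ξ j +
      nullVec κ (fun B => ∑ C, spinOf a C B * ξ C) j := by
    apply eq_of_sum_infeld
    intro A A'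
    have h1 : ∑ i, (∑ k, (a k i : ℂ) * nullVec κ ξ k) * infeld i A A' =
        ∑ k, nullVec κ ξ k * ∑ i, (a k i : ℂ) * infeld i A A' := by
      simp only [Finset.sum_mul, Finset.mul_sum]
      rw [Finset.sum_comm]
      exact Finset.sum_congr rfl fun B' _ => Finset.sum_congr rfl fun i _ => by ring
    rw [h1]
    simp only [infeld_invariant ha, add_mul, Finset.sum_add_distrib, sum_nullVec_infeld, mul_add,
      map_sum, map_mul]
    congr 1
    · have : ∀ k, nullVec κ ξ k * ∑ C, spinOf a C A * infeld k C A' =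
          ∑ C, spinOf a C A * (nullVec κ ξ k * infeld k C A') := by
        intro k; rw [Finset.mul_sum]; exact Finset.sum_congr rfl fun _ _ => by ring
      simp only [this]
      rw [Finset.sum_comm]
      simp only [← Finset.mul_sum, sum_nullVec_infeld, Finset.sum_mul]
      exact Finset.sum_congr rfl fun _ _ => by ring
    · have : ∀ k, nullVec κ ξ k * ∑ C, conj (spinOf a C A') * infeld k A C =
          ∑ C, conj (spinOf a C A') * (nullVec κ ξ k * infeld k A C) := by
        intro k; rw [Finset.mul_sum]; exact Finset.sum_congr rfl fun _ _ => by ring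
      simp only [this]
      rw [Finset.sum_comm]
      simp only [← Finset.mul_sum, sum_nullVec_infeld]
      rw [Finset.mul_sum]
      exact Finset.sum_congr rfl fun _ _ => by ring
  exact congrFun this j
end

/-! ### The spin connection, its curvature, and the Bianchi and Ricci identities. -/

noncomputable section

lemma spinOf_add (a b : Fin 4 → Fin 4 → ℝ) (C B : Fin 2) :
    spinOf (fun j k => a j k + b j k) C B = spinOf a C B + spinOf b C B := by
  simp only [spinOf, Complex.ofReal_add, mul_add, add_mul, Finset.sum_add_distrib]

lemma spinOf_sub (a b : Fin 4 → Fin 4 → ℝ) (C B : Fin 2) :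
    spinOf (fun j k => a j k - b j k) C B = spinOf a C B - spinOf b C B := by
  simp only [spinOf, Complex.ofReal_sub, mul_sub, sub_mul, Finset.sum_sub_distrib]

lemma spinOf_smul (r : ℝ) (a : Fin 4 → Fin 4 → ℝ) (C B : Fin 2) :
    spinOf (fun j k => r * a j k) C B = r * spinOf a C B := by
  simp only [spinOf, Finset.mul_sum, Complex.ofReal_mul]
  exact Finset.sum_congr rfl fun _ _ => Finset.sum_congr rfl fun _ _ =>
    Finset.sum_congr rfl fun _ _ => by ring

lemma spinOf_sum (a : Fin 4 → Fin 4 → Fin 4 → ℝ) (C B : Fin 2) :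
    spinOf (fun j k => ∑ m, a m j k) C B = ∑ m, spinOf (a m) C B := by
  simp only [Fin.sum_univ_four, spinOf_add]

namespace SpinSpacetime

variable {M : Type*} [TopologicalSpace M] [ChartedSpace (EuclideanSpace ℝ (Fin 4)) M]
  [IsManifold (𝓡 4) ∞ M] (S : SpinSpacetime M)

lemma contMDiff_christoffel (i j k : Fin 4) :
    ContMDiff (𝓡 4) 𝓘(ℝ, ℝ) ∞ (S.christoffel i j k) := by
  have hm : ∀ {f g : M → ℝ}, ContMDiff (𝓡 4) 𝓘(ℝ, ℝ) ∞ f → ContMDiff (𝓡 4) 𝓘(ℝ, ℝ) ∞ g →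
      ContMDiff (𝓡 4) 𝓘(ℝ, ℝ) ∞ (fun x => f x * g x) := fun hf hg =>
    (contDiff_mul.contMDiff (n := ∞)).comp (hf.prodMk_space hg)
  exact hm contMDiff_const (hm (((S.contMDiff_structureFun i j k).sub
    (S.contMDiff_structureFun j k i)).add (S.contMDiff_structureFun k i j)) contMDiff_const)

@[fun_prop]
lemma Sm_christoffel (i j k : Fin 4) : Sm (fun x => (S.christoffel i j k x : ℂ)) :=
  Sm.ofReal (S.contMDiff_christoffel i j k)

lemma minkowskiSign_sq (k : Fin 4) : minkowskiSign k * minkowskiSign k = 1 := by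
  unfold minkowskiSign; split_ifs <;> norm_num

/-- Metric compatibility: with the last index lowered, the Koszul expression is antisymmetric in its
last two indices, because `structureFun` is antisymmetric in its first two. -/
lemma isLorentzAlg_christoffel (i : Fin 4) (x : M) :
    IsLorentzAlg (fun j k => S.christoffel i j k x) := by
  intro j k
  simp only [christoffel, ← mul_assoc, minkowskiSign_sq, one_mul]
  rw [S.structureFun_swap j i k, S.structureFun_swap k j i, S.structureFun_swap i k j]
  ring

/-- The connection is torsion-free. This later trades structure functions for Christoffel symbols.
-/
lemma christoffel_torsion (i j k : Fin 4) (x : M) :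
    S.christoffel i j k x - S.christoffel j i k x = minkowskiSign k * S.structureFun i j k x := by
  simp only [christoffel]
  rw [S.structureFun_swap i j k, S.structureFun_swap k j i, S.structureFun_swap i k j]
  ring

lemma cc_eq (i j k : Fin 4) (x : M) :
    S.cc i j k x = S.christoffel i j k x - S.christoffel j i k x := by
  rw [cc, ← Complex.ofReal_mul, ← S.christoffel_torsion, Complex.ofReal_sub]

lemma spinConn_eq (i : Fin 4) (C B : Fin 2) (x : M) :
    S.spinConn i C B x = spinOf (fun j k => S.christoffel i j k x) C B := rfl

lemma spinConn_trace (i : Fin 4) (x : M) : S.spinConn i 1 1 x = -S.spinConn i 0 0 x :=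
  spinOf_trace (S.isLorentzAlg_christoffel i x)

@[fun_prop]
lemma Sm_spinConn (i : Fin 4) (C B : Fin 2) : Sm (S.spinConn i C B) := by
  unfold spinConn
  fun_prop

/-- The curvature of the spin connection. -/
def spinCurv (i j : Fin 4) (C B : Fin 2) (x : M) : ℂ :=
  S.frameDeriv i (S.spinConn j C B) x - S.frameDeriv j (S.spinConn i C B) x
    + ∑ D, (S.spinConn j C D x * S.spinConn i D B x - S.spinConn i C D x * S.spinConn j D B x)
    - ∑ m, S.cc i j m x * S.spinConn m C B x

lemma fd_spinConn (i j : Fin 4) (C B : Fin 2) (x : M) :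
    S.frameDeriv i (S.spinConn j C B) x =
      spinOf (fun k l => S.frameDeriv i (S.christoffel j k l) x) C B := by
  unfold spinConn spinOf
  rw [S.fd_const_mul i _ (by fun_prop), S.fd_sum i _ (by intro k; fun_prop)]
  congr 1
  refine Finset.sum_congr rfl fun k _ => ?_
  rw [S.fd_sum i _ (by intro k; fun_prop)]
  refine Finset.sum_congr rfl fun l _ => ?_
  rw [S.fd_sum i _ (by intro k; fun_prop)]
  refine Finset.sum_congr rfl fun A' _ => ?_
  rw [S.fd_mul i (by fun_prop) (by fun_prop), S.fd_const_mul i _ (by fun_prop), S.fd_const,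
    S.fd_ofReal i (S.contMDiff_christoffel j k l)]
  ring

/-- The spin curvature is the image of the Riemann tensor. -/
lemma spinCurv_eq (i j : Fin 4) (C B : Fin 2) (x : M) :
    S.spinCurv i j C B x = spinOf (fun k l => S.riemann i j k l x) C B := by
  unfold riemann
  rw [spinOf_sub, spinOf_add, spinOf_sub,
    spinOf_commutator (S.isLorentzAlg_christoffel i x) (S.isLorentzAlg_christoffel j x),
    spinOf_sum]
  simp only [spinOf_smul, spinCurv, fd_spinConn, spinConn_eq, cc]
  push_cast
  rfl

/-- The second Bianchi identity of the spin curvature. -/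
lemma spinCurv_bianchi (i j k : Fin 4) (C B : Fin 2) (x : M) :
    (S.frameDeriv i (S.spinCurv j k C B) x + ∑ D, (S.spinCurv j k C D x * S.spinConn i D B x
      - S.spinConn i C D x * S.spinCurv j k D B x) + ∑ m, S.cc j k m x * S.spinCurv i m C B x) +
    (S.frameDeriv j (S.spinCurv k i C B) x + ∑ D, (S.spinCurv k i C D x * S.spinConn j D B x
      - S.spinConn j C D x * S.spinCurv k i D B x) + ∑ m, S.cc k i m x * S.spinCurv j m C B x) +
    (S.frameDeriv k (S.spinCurv i j C B) x + ∑ D, (S.spinCurv i j C D x * S.spinConn k D B x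
      - S.spinConn k C D x * S.spinCurv i j D B x) + ∑ m, S.cc i j m x * S.spinCurv k m C B x)
      = 0 := by
  have hd : ∀ i j k, S.frameDeriv i (S.spinCurv j k C B) x =
      S.frameDeriv i (S.frameDeriv j (S.spinConn k C B)) x
      - S.frameDeriv i (S.frameDeriv k (S.spinConn j C B)) x
      + ∑ D, ((S.frameDeriv i (S.spinConn k C D) x * S.spinConn j D B x +
          S.spinConn k C D x * S.frameDeriv i (S.spinConn j D B) x) -
        (S.frameDeriv i (S.spinConn j C D) x * S.spinConn k D B x +
          S.spinConn j C D x * S.frameDeriv i (S.spinConn k D B) x))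
      - ∑ m, (S.frameDeriv i (S.cc j k m) x * S.spinConn m C B x +
          S.cc j k m x * S.frameDeriv i (S.spinConn m C B) x) := by
    intro i j k
    unfold spinCurv
    rw [S.fd_sub i (by fun_prop) (by fun_prop), S.fd_add i (by fun_prop) (by fun_prop),
      S.fd_sub i (by fun_prop) (by fun_prop), S.fd_sum i _ (by intro k; fun_prop),
      S.fd_sum i _ (by intro k; fun_prop)]
    congr 1
    · congr 1
      refine Finset.sum_congr rfl fun D _ => ?_
      rw [S.fd_sub i (by fun_prop) (by fun_prop), S.fd_mul i (by fun_prop) (by fun_prop),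
        S.fd_mul i (by fun_prop) (by fun_prop)]
    · refine Finset.sum_congr rfl fun D _ => ?_
      rw [S.fd_mul i (by fun_prop) (by fun_prop)]
  have hc := fun i j k => S.fd_comm i j (S.Sm_spinConn k C B) x
  have h1 := hc i j k
  have h2 := hc j k i
  have h3 := hc k i j
  have hJ := fun n => S.jacobi i j k n x
  rw [hd, hd, hd]
  simp only [spinCurv]
  simp only [Fin.sum_univ_two, Fin.sum_univ_four] at h1 h2 h3 hJ ⊢
  -- Second derivatives of the connection cancel up to frame commutators, and derivatives of the
  -- structure functions cancel by Jacobi. The remaining terms cancel algebraically.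
  linear_combination h1 + h2 + h3 - S.spinConn 0 C B x * hJ 0 - S.spinConn 1 C B x * hJ 1 -
    S.spinConn 2 C B x * hJ 2 - S.spinConn 3 C B x * hJ 3

/-- The Ricci identity for spinor fields. -/
lemma nablaSpin_comm {κ : M → Spinor} (hκ : ∀ B, Sm (fun y => κ y B)) (i j : Fin 4) (B : Fin 2)
    (x : M) :
    S.nablaSpin (fun y => S.nablaSpin κ y j) x i B - S.nablaSpin (fun y => S.nablaSpin κ y i) x j B =
      ∑ C, S.spinCurv i j C B x * κ x C + ∑ m, S.cc i j m x * S.nablaSpin κ x m B := by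
  -- The frame index `j` is only a label here and is not differentiated covariantly. This is why a
  -- term with `S.cc` stays on the right-hand side.
  have hd : ∀ i j, S.frameDeriv i (fun y => S.nablaSpin κ y j B) x =
      S.frameDeriv i (S.frameDeriv j (fun y => κ y B)) x +
      ∑ C, (S.frameDeriv i (S.spinConn j C B) x * κ x C +
        S.spinConn j C B x * S.frameDeriv i (fun y => κ y C) x) := by
    intro i j
    unfold nablaSpin
    rw [S.fd_add i (by fun_prop) (by fun_prop), S.fd_sum i _ (by intro k; fun_prop)]
    congr 1
    refine Finset.sum_congr rfl fun C _ => ?_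
    rw [S.fd_mul i (by fun_prop) (by fun_prop)]
  have hc := S.fd_comm i j (hκ B) x
  have hn : ∀ (κ : M → Spinor) i B, S.nablaSpin κ x i B =
    S.frameDeriv i (fun y => κ y B) x + ∑ C, S.spinConn i C B x * κ x C := fun _ _ _ => rfl
  rw [hn, hn (fun y => S.nablaSpin κ y i), hd, hd]
  simp only [hn, spinCurv]
  simp only [Fin.sum_univ_two, Fin.sum_univ_four] at hc ⊢
  linear_combination hc

end SpinSpacetime
end

/-! ### Algebra of 2-forms and Weyl tensors in spinor form, and the symmetries of the curvature. -/

noncomputable section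

/-- The symmetric spinor `w_{CC'DD'} ε^{C'D'}` of a 2-form. -/
def bivec (w : Fin 4 → Fin 4 → ℝ) (C D : Fin 2) : ℂ :=
  ∑ k, ∑ l, (w k l : ℂ) * (∑ C', ∑ D', infeldInv k C C' * infeldInv l D D' * spinEps C' D')

lemma bivec_table {w : Fin 4 → Fin 4 → ℝ} (hw : ∀ k l, w k l = -w l k) :
    bivec w 0 0 = w 0 1 - w 0 2 * Complex.I - w 1 3 + w 2 3 * Complex.I ∧
    bivec w 0 1 = -w 0 3 - w 1 2 * Complex.I ∧
    bivec w 1 0 = -w 0 3 - w 1 2 * Complex.I ∧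
    bivec w 1 1 = -(w 0 1 + w 0 2 * Complex.I) - w 1 3 - w 2 3 * Complex.I := by
  have h0 : w 0 0 = 0 := by linarith [hw 0 0]
  have h1 : w 1 1 = 0 := by linarith [hw 1 1]
  have h2 : w 2 2 = 0 := by linarith [hw 2 2]
  have h3 : w 3 3 = 0 := by linarith [hw 3 3]
  refine ⟨?_, ?_, ?_, ?_⟩ <;>
  · simp only [bivec, Fin.sum_univ_four, Fin.sum_univ_two, infeldInv_table, spinEps_table, h0, h1, h2,
      h3, hw 1 0, hw 2 0, hw 3 0, hw 2 1, hw 3 1, hw 3 2]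
    push_cast
    ring_nf
    simp only [invSqrtTwo_sq]
    ring_nf

lemma bivec_symm {w : Fin 4 → Fin 4 → ℝ} (hw : ∀ k l, w k l = -w l k) (C D : Fin 2) :
    bivec w C D = bivec w D C := by
  fin_cases C <;> fin_cases D <;> simp [bivec_table hw]

lemma bivec_add (v w : Fin 4 → Fin 4 → ℝ) (C D : Fin 2) :
    bivec (fun k l => v k l + w k l) C D = bivec v C D + bivec w C D := by
  simp only [bivec, Complex.ofReal_add, add_mul, Finset.sum_add_distrib]

lemma bivec_smul (r : ℝ) (w : Fin 4 → Fin 4 → ℝ) (C D : Fin 2) :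
    bivec (fun k l => r * w k l) C D = r * bivec w C D := by
  simp only [bivec, Complex.ofReal_mul, Finset.mul_sum, mul_assoc]

/-- A trace-free 2×2 matrix and a symmetric spinor differ by one contraction with ε. This relates
the spin curvature to the 2-form of the Riemann tensor. -/
lemma spinOf_eq_bivec {a : Fin 4 → Fin 4 → ℝ} (ha : IsLorentzAlg a) (C : Fin 2) :
    spinOf a C 0 = 1 / 2 * bivec (fun k l => minkowskiSign l * a k l) C 1 ∧
    spinOf a C 1 = -(1 / 2 * bivec (fun k l => minkowskiSign l * a k l) C 0) := by
  have hw : ∀ k l, (fun k l => minkowskiSign l * a k l) k l =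
      -(fun k l => minkowskiSign l * a k l) l k := fun k l => ha k l
  fin_cases C <;>
  · simp only [Fin.zero_eta, Fin.mk_one, Fin.isValue, bivec_table hw, spinOf_table ha,
      minkowskiSign_table]
    push_cast
    constructor <;> ring

/-- The algebraic symmetries of a Weyl tensor. -/
structure IsWeylTensor (W : Fin 4 → Fin 4 → Fin 4 → Fin 4 → ℝ) : Prop where
  swap_left : ∀ i j k l, W i j k l = -W j i k l
  swap_right : ∀ i j k l, W i j k l = -W i j l k
  cyclic : ∀ i j k l, W i j k l + W j k i l + W k i j l = 0
  trace : ∀ i j, ∑ k, minkowskiSign k * W i k j k = 0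

namespace IsWeylTensor

variable {W : Fin 4 → Fin 4 → Fin 4 → Fin 4 → ℝ}

/-- The classical octahedron argument: a linear combination of four cyclic identities and the two
antisymmetries. -/
lemma pair_symm (hW : IsWeylTensor W) (i j k l : Fin 4) : W i j k l = W k l i j := by
  linarith [hW.cyclic i j k l, hW.cyclic j k l i, hW.cyclic k l i j, hW.cyclic l i j k,
    hW.swap_left i j k l, hW.swap_left j k i l, hW.swap_left k i j l, hW.swap_left j k l i,
    hW.swap_left k l j i, hW.swap_left l j k i, hW.swap_left k l i j, hW.swap_left l i k j,
    hW.swap_left i k l j, hW.swap_left l i j k, hW.swap_left i j l k, hW.swap_left j l i k,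
    hW.swap_right i j k l, hW.swap_right j k i l, hW.swap_right k i j l, hW.swap_right j k l i,
    hW.swap_right k l j i, hW.swap_right l j k i, hW.swap_right k l i j, hW.swap_right l i k j,
    hW.swap_right i k l j, hW.swap_right l i j k, hW.swap_right i j l k, hW.swap_right j l i k]

set_option linter.unusedSimpArgs false in
/-- The entries of a Weyl tensor in terms of ten independent ones. -/
lemma eqs (hW : IsWeylTensor W) :
    (W 0 3 0 3 = -W 0 1 0 1 - W 0 2 0 2 ∧ W 2 3 2 3 = -W 0 1 0 1 ∧ W 1 3 1 3 = -W 0 2 0 2 ∧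
      W 1 2 1 2 = W 0 1 0 1 + W 0 2 0 2) ∧
    (W 0 3 1 3 = -W 0 2 1 2 ∧ W 0 3 2 3 = W 0 1 1 2 ∧ W 0 2 2 3 = -W 0 1 1 3 ∧
      W 1 3 2 3 = W 0 1 0 2 ∧ W 1 2 2 3 = -W 0 1 0 3 ∧ W 1 2 1 3 = W 0 2 0 3) ∧
    W 0 3 1 2 = W 0 2 1 3 - W 0 1 2 3 := by
  obtain ⟨h0, h1, h2, h3⟩ := minkowskiSign_table
  have t := hW.trace
  simp only [Fin.sum_univ_four, h0, h1, h2, h3] at t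
  have sl := hW.swap_left
  have sr := hW.swap_right
  have ps := hW.pair_symm
  have d : ∀ i k l, W i i k l = 0 := fun i k l => by linarith [sl i i k l]
  have d' : ∀ i k l, W k l i i = 0 := fun i k l => by linarith [sr k l i i]
  have t00 := t 0 0
  have t11 := t 1 1
  have t22 := t 2 2
  have t33 := t 3 3
  have t01 := t 0 1
  have t02 := t 0 2
  have t03 := t 0 3
  have t12 := t 1 2
  have t13 := t 1 3
  have t23 := t 2 3
  have hc := hW.cyclic 0 1 2 3
  simp only [d, d', sl 1 0, sl 2 0, sl 3 0, sl 2 1, sl 3 1, sl 3 2, sr _ _ 1 0, sr _ _ 2 0,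
    sr _ _ 3 0, sr _ _ 2 1, sr _ _ 3 1, sr _ _ 3 2, ps 0 2 0 1, ps 0 3 0 1, ps 0 3 0 2, ps 1 2 0 1,
    ps 1 2 0 2, ps 1 2 0 3, ps 1 3 0 1, ps 1 3 0 2, ps 1 3 0 3, ps 2 3 0 1, ps 2 3 0 2,
    ps 2 3 0 3, ps 1 3 1 2, ps 2 3 1 2, ps 2 3 1 3]
    at t00 t11 t22 t33 t01 t02 t03 t12 t13 t23 hc
  refine ⟨⟨?_, ?_, ?_, ?_⟩, ⟨?_, ?_, ?_, ?_, ?_, ?_⟩, ?_⟩ <;> linarith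

/-- The Weyl spinor of a Weyl tensor. -/
def spinor (W : Fin 4 → Fin 4 → Fin 4 → Fin 4 → ℝ) (A B C D : Fin 2) : ℂ :=
  1 / 4 * ∑ i, ∑ j, ∑ k, ∑ l, (W i j k l : ℂ) *
    (∑ A', ∑ B', infeldInv i A A' * infeldInv j B B' * spinEps A' B') *
    (∑ C', ∑ D', infeldInv k C C' * infeldInv l D D' * spinEps C' D')

lemma spinor_eq_sum (W : Fin 4 → Fin 4 → Fin 4 → Fin 4 → ℝ) (A B C D : Fin 2) :
    spinor W A B C D = 1 / 4 * ∑ i, ∑ j,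
      (∑ A', ∑ B', infeldInv i A A' * infeldInv j B B' * spinEps A' B') * bivec (W i j) C D := by
  simp only [spinor, bivec]
  refine congrArg (fun z : ℂ => 1 / 4 * z) ?_
  refine Finset.sum_congr rfl fun i _ => Finset.sum_congr rfl fun j _ => ?_
  rw [Finset.mul_sum]
  refine Finset.sum_congr rfl fun k _ => ?_
  rw [Finset.mul_sum]
  exact Finset.sum_congr rfl fun l _ => by ring

lemma spinor_swap_right (hW : IsWeylTensor W) (A B C D : Fin 2) :
    spinor W A B C D = spinor W A B D C := by
  simp only [spinor_eq_sum]
  refine congrArg (fun z : ℂ => 1 / 4 * z) ?_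
  refine Finset.sum_congr rfl fun i _ => Finset.sum_congr rfl fun j _ => ?_
  rw [bivec_symm (hW.swap_right i j)]

lemma spinor_pair_symm (hW : IsWeylTensor W) (A B C D : Fin 2) :
    spinor W A B C D = spinor W C D A B := by
  unfold spinor
  refine congrArg (fun z : ℂ => 1 / 4 * z) ?_
  have h : ∀ f : Fin 4 → Fin 4 → Fin 4 → Fin 4 → ℂ,
      ∑ i, ∑ j, ∑ k, ∑ l, f i j k l = ∑ i, ∑ j, ∑ k, ∑ l, f k l i j := by
    intro f
    simp only [Fin.sum_univ_four]
    ring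
  rw [h]
  refine Finset.sum_congr rfl fun i _ => Finset.sum_congr rfl fun j _ => 
    Finset.sum_congr rfl fun k _ => Finset.sum_congr rfl fun l _ => ?_
  rw [hW.pair_symm k l i j]
  ring

/-- The symmetries within each pair and the pair exchange leave this as the only relation missing
for total symmetry. It depends on the trace and cyclic identities through `eqs`. -/
lemma spinor_trace (hW : IsWeylTensor W) : spinor W 0 0 1 1 = spinor W 0 1 0 1 := by
  have sl := hW.swap_left
  have d : ∀ i k l, W i i k l = 0 := fun i k l => by linarith [sl i i k l]
  have hb := fun i j => bivec_table (hW.swap_right i j)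
  have he := hW.eqs
  have ps := hW.pair_symm
  rw [spinor_eq_sum, spinor_eq_sum]
  simp only [hb, Fin.sum_univ_four, Fin.sum_univ_two, infeldInv_table, spinEps_table, mul_zero,
    zero_mul, add_zero, zero_add, d, sl 1 0, sl 2 0, sl 3 0, sl 2 1, sl 3 1, sl 3 2, ps 1 2 0 3,
    ps 1 2 0 1, ps 1 2 0 2, ps 1 3 0 2, ps 2 3 0 3, ps 2 3 0 2, ps 2 3 0 1, ps 1 3 0 3, ps 1 3 0 1,
    ps 0 2 0 1, ps 0 3 0 1, ps 0 3 0 2, ps 1 3 1 2, ps 2 3 1 2, ps 2 3 1 3, he]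
  push_cast
  ring_nf

lemma spinor_swap_mid (hW : IsWeylTensor W) (A B C D : Fin 2) :
    spinor W A B C D = spinor W A C B D := by
  have r := hW.spinor_swap_right
  have p := hW.spinor_pair_symm
  have t := hW.spinor_trace
  have q : ∀ A B C D, spinor W A B C D = spinor W B A C D := fun A B C D =>
    (p A B C D).trans ((r C D A B).trans (p C D B A))
  have h0 : spinor W 0 0 1 0 = spinor W 0 1 0 0 := (p 0 0 1 0).trans (q 1 0 0 0)
  have h1 : spinor W 1 0 1 0 = spinor W 1 1 0 0 :=
    ((q 1 0 1 0).trans (r 0 1 1 0)).trans (t.symm.trans (p 0 0 1 1))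
  have h2 : spinor W 1 0 1 1 = spinor W 1 1 0 1 := (p 1 0 1 1).trans (r 1 1 1 0)
  match A, B, C, D with
  | 0, 0, 0, _ => rfl
  | 1, 0, 0, _ => rfl
  | 0, 1, 1, _ => rfl
  | 1, 1, 1, _ => rfl
  | 0, 0, 1, 0 => exact h0
  | 0, 0, 1, 1 => exact t
  | 1, 0, 1, 0 => exact h1
  | 1, 0, 1, 1 => exact h2
  | 0, 1, 0, 0 => exact h0.symm
  | 0, 1, 0, 1 => exact t.symm
  | 1, 1, 0, 0 => exact h1.symm
  | 1, 1, 0, 1 => exact h2.symm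

-- For a trace-free tensor, projecting one index pair to a symmetric unprimed spinor leaves only the
-- matching part in the other pair: there is no mixed part with primed indices. The proof is a
-- finite check with `eqs`.
set_option maxHeartbeats 1000000 in
lemma bivec_selfDual (hW : IsWeylTensor W) (A A' B B' C D : Fin 2) :
    ∑ i, ∑ j, infeldInv i A A' * infeldInv j B B' * bivec (W i j) C D =
      2 * spinor W A B C D * spinEps A' B' := by
  have sl := hW.swap_left
  have ps := hW.pair_symm
  have d : ∀ i k l, W i i k l = 0 := fun i k l => by linarith [sl i i k l]
  have hb := fun i j => bivec_table (hW.swap_right i j)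
  have he := hW.eqs
  rw [spinor_eq_sum]
  fin_cases C <;> fin_cases D <;> fin_cases A <;> fin_cases B <;> fin_cases A' <;> fin_cases B' <;>
  · simp only [Fin.zero_eta, Fin.mk_one, Fin.isValue, hb, Fin.sum_univ_four, Fin.sum_univ_two,
      infeldInv_table, spinEps_table, mul_zero, zero_mul, add_zero, zero_add,
      d, sl 1 0, sl 2 0, sl 3 0, sl 2 1, sl 3 1, sl 3 2, ps 0 2 0 1, ps 0 3 0 1, ps 0 3 0 2, ps 1 2 0 1,
      ps 1 2 0 2, ps 1 2 0 3, ps 1 3 0 1, ps 1 3 0 2, ps 1 3 0 3, ps 2 3 0 1, ps 2 3 0 2,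
      ps 2 3 0 3, ps 1 3 1 2, ps 2 3 1 2, ps 2 3 1 3, he]
    push_cast
    ring_nf
    try simp only [invSqrtTwo_sq, Complex.I_sq]
    try ring_nf

end IsWeylTensor

namespace SpinSpacetime

variable {M : Type*} [TopologicalSpace M] [ChartedSpace (EuclideanSpace ℝ (Fin 4)) M]
  [IsManifold (𝓡 4) ∞ M] (S : SpinSpacetime M)

lemma fd_smul_real (i : Fin 4) (r : ℝ) {f : M → ℝ} (hf : ContMDiff (𝓡 4) 𝓘(ℝ, ℝ) ∞ f) (x : M) :
    S.frameDeriv i (fun y => r * f y) x = r * S.frameDeriv i f x :=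
  S.fd_comp_clm i (r • ContinuousLinearMap.id ℝ ℝ) (hf.mdifferentiable (by simp) x)

/-- Every term of the curvature lies in the Lorentz algebra: derivatives and linear combinations of
connection matrices, and their commutator. -/
lemma isLorentzAlg_riemann (i j : Fin 4) (x : M) :
    IsLorentzAlg (fun k l => S.riemann i j k l x) := by
  have hd : ∀ i j, IsLorentzAlg (fun k l => S.frameDeriv i (S.christoffel j k l) x) := by
    intro i j k l
    rw [← S.fd_smul_real i _ (S.contMDiff_christoffel j k l), ← neg_mul,
      ← S.fd_smul_real i _ (S.contMDiff_christoffel j l k)]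
    congr 1
    funext y
    simpa using S.isLorentzAlg_christoffel j y k l
  have hc := (S.isLorentzAlg_christoffel i x).commutator (S.isLorentzAlg_christoffel j x)
  intro k l
  have h1 := hd i j k l
  have h2 := hd j i k l
  have h3 := hc k l
  have h4 : minkowskiSign l * ∑ m, minkowskiSign m * S.structureFun i j m x * S.christoffel m k l x =
      -(minkowskiSign k * ∑ m, minkowskiSign m * S.structureFun i j m x * S.christoffel m l k x) := by
    rw [Finset.mul_sum, Finset.mul_sum, ← Finset.sum_neg_distrib]
    refine Finset.sum_congr rfl fun m _ => ?_
    have := S.isLorentzAlg_christoffel m x k l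
    linear_combination minkowskiSign m * S.structureFun i j m x * this
  unfold riemann
  linear_combination h1 - h2 + h3 - h4

lemma riemann_swap_left (i j k l : Fin 4) (x : M) :
    S.riemann i j k l x = -S.riemann j i k l x := by
  unfold riemann
  simp only [S.structureFun_swap i j, mul_neg, neg_mul, Finset.sum_neg_distrib,
    Finset.sum_sub_distrib]
  ring

/-- The first Bianchi identity. -/
lemma riemann_cyclic (i j k l : Fin 4) (x : M) :
    S.riemann i j k l x + S.riemann j k i l x + S.riemann k i j l x = 0 := by
  have hcc : ∀ i j k l, S.frameDeriv i (S.cc j k l) x =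
      S.frameDeriv i (S.christoffel j k l) x - S.frameDeriv i (S.christoffel k j l) x := by
    intro i j k l
    rw [← S.fd_ofReal i (S.contMDiff_christoffel j k l),
      ← S.fd_ofReal i (S.contMDiff_christoffel k j l), ← S.fd_sub i (by fun_prop) (by fun_prop)]
    congr 1
    funext y
    exact S.cc_eq j k l y
  have hJ := S.jacobi i j k l x
  simp only [hcc, S.cc_eq] at hJ
  have hr : ∀ i j k, (S.riemann i j k l x : ℂ) = S.frameDeriv i (S.christoffel j k l) x
      - S.frameDeriv j (S.christoffel i k l) x + ∑ m, ((S.christoffel j k m x : ℂ) *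
        S.christoffel i m l x - S.christoffel i k m x * S.christoffel j m l x)
      - ∑ m, ((S.christoffel i j m x : ℂ) - S.christoffel j i m x) * S.christoffel m k l x := by
    intro i j k
    unfold riemann
    simp only [← S.christoffel_torsion]
    push_cast
    rfl
  have : ((S.riemann i j k l x + S.riemann j k i l x + S.riemann k i j l x : ℝ) : ℂ) = 0 := by
    push_cast
    rw [hr, hr, hr]
    simp only [Fin.sum_univ_four] at hJ ⊢
    linear_combination hJ
  exact_mod_cast this

variable {S}

/-- The scalar curvature is 4λ, so the Ricci terms contribute λ and the scalar term -2λ/3 to the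
constant-curvature part, leaving λ/3. -/
lemma weyl_eq_of_einstein {lam : ℝ} (hE : ∀ x i j, S.ricci i j x = lam * minkowski i j)
    (i j k l : Fin 4) (x : M) :
    S.riemannLow i j k l x = S.weyl i j k l x + lam / 3 *
      (minkowski i k * minkowski j l - minkowski i l * minkowski j k) := by
  have hs : S.scalar x = 4 * lam := by
    simp only [scalar, hE, Fin.sum_univ_four, minkowski, minkowskiSign_table, if_true]
    ring
  rw [weyl, hs]
  simp only [hE]
  ring

/-- The first three symmetries hold for the Riemann tensor and the constant-curvature part
separately. In the trace, λ cancels against (λ/3)(4 - 1). -/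
lemma isWeylTensor_weyl {lam : ℝ} (hE : ∀ x i j, S.ricci i j x = lam * minkowski i j) (x : M) :
    IsWeylTensor (fun i j k l => S.weyl i j k l x) := by
  have hw : ∀ i j k l, S.weyl i j k l x = S.riemannLow i j k l x - lam / 3 *
      (minkowski i k * minkowski j l - minkowski i l * minkowski j k) := fun i j k l => by
    rw [weyl_eq_of_einstein hE]; ring
  have hsym : ∀ i j, minkowski i j = minkowski j i := by
    intro i j
    unfold minkowski
    by_cases h : i = j
    · rw [h]
    · rw [if_neg h, if_neg (Ne.symm h)]
  refine ⟨fun i j k l => ?_, fun i j k l => ?_, fun i j k l => ?_, fun i j => ?_⟩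
  · simp only [hw, riemannLow, S.riemann_swap_left i j]
    ring
  · simp only [hw]
    have := S.isLorentzAlg_riemann i j x k l
    simp only at this
    unfold riemannLow
    linear_combination this
  · simp only [hw, riemannLow]
    rw [hsym i k, hsym j k, hsym i j]
    linear_combination minkowskiSign l * S.riemann_cyclic i j k l x
  · simp only [hw]
    have h := hE x i j
    rw [ricci] at h
    have h2 : ∀ k, minkowskiSign k * (S.riemannLow i k j k x - lam / 3 *
        (minkowski i j * minkowski k k - minkowski i k * minkowski k j)) = S.riemann i k j k x -
        lam / 3 * (minkowski i j - minkowskiSign k * minkowski i k * minkowski k j) := by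
      intro k
      have := minkowskiSign_sq k
      simp only [riemannLow, minkowski, if_true]
      linear_combination (S.riemann i k j k x - lam / 3 *
        (if i = j then minkowskiSign i else 0)) * this
    rw [Finset.sum_congr rfl fun k _ => h2 k, Finset.sum_sub_distrib, h, ← Finset.mul_sum,
      Finset.sum_sub_distrib]
    have h3 : ∑ k, minkowskiSign k * minkowski i k * minkowski k j = minkowski i j := by
      unfold minkowski
      rw [Finset.sum_eq_single i]
      · rw [if_pos rfl, minkowskiSign_sq, one_mul]
      · intro b _ hb
        rw [if_neg (Ne.symm hb)]
        ring
      · simp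
    rw [h3]
    simp only [Finset.sum_const, Finset.card_univ, Fintype.card_fin]
    ring

end SpinSpacetime

end

/-! ### The curvature spinor of an Einstein spacetime. -/

noncomputable section

/-- The anti-self-dual basis `σ_i^{AA'} σ_j^{BB'} ε_{A'B'}` of the 2-forms. -/
def sdForm (i j : Fin 4) (A B : Fin 2) : ℂ :=
  infeld i A 0 * infeld j B 1 - infeld i A 1 * infeld j B 0

lemma sum_infeld_infeldInv (b : Fin 4 → Fin 4 → ℂ) (i j : Fin 4) :
    b i j = ∑ A, ∑ A', ∑ B, ∑ B', infeld i A A' * infeld j B B' *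
      ∑ k, ∑ l, infeldInv k A A' * infeldInv l B B' * b k l := by
  have h : ∑ A, ∑ A', ∑ B, ∑ B', infeld i A A' * infeld j B B' *
      ∑ k, ∑ l, infeldInv k A A' * infeldInv l B B' * b k l =
      ∑ k, ∑ l, (∑ A, ∑ A', infeldInv k A A' * infeld i A A') *
        (∑ B, ∑ B', infeldInv l B B' * infeld j B B') * b k l := by
    simp only [Fin.sum_univ_two, Fin.sum_univ_four]
    ring
  rw [h]
  simp only [infeld_infeldInv, ite_mul, mul_ite, one_mul, mul_one, mul_zero, zero_mul]
  simp

set_option maxHeartbeats 800000 in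
lemma bivec_minkowski (A A' B B' C D : Fin 2) :
    ∑ i, ∑ j, infeldInv i A A' * infeldInv j B B' *
      bivec (fun k l => minkowski i k * minkowski j l - minkowski i l * minkowski j k) C D =
      spinEps A' B' * (spinEps A C * spinEps B D + spinEps A D * spinEps B C) := by
  have hb := fun i j => bivec_table
    (w := fun k l => minkowski i k * minkowski j l - minkowski i l * minkowski j k)
    (fun k l => by ring)
  have hm : ∀ i j : Fin 4, minkowski i j = if i = j then minkowskiSign i else 0 := fun _ _ => rfl
  fin_cases C <;> fin_cases D <;> fin_cases A <;> fin_cases B <;> fin_cases A' <;> fin_cases B' <;>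
  · simp only [Fin.zero_eta, Fin.mk_one, Fin.isValue, hb, Fin.sum_univ_four,
      infeldInv_table, spinEps_table, mul_zero, zero_mul, add_zero, zero_add]
    simp [hm, minkowskiSign_table]
    try ring_nf
    try simp only [invSqrtTwo_sq, Complex.I_sq]
    try norm_num

namespace SpinSpacetime

variable {M : Type*} [TopologicalSpace M] [ChartedSpace (EuclideanSpace ℝ (Fin 4)) M]
  [IsManifold (𝓡 4) ∞ M] {S : SpinSpacetime M}

lemma weylSpinor_eq (A B C D : Fin 2) (x : M) :
    S.weylSpinor A B C D x = IsWeylTensor.spinor (fun i j k l => S.weyl i j k l x) A B C D := rfl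

/-- The curvature spinor of an Einstein spacetime. -/
def phi (S : SpinSpacetime M) (lam : ℝ) (A B C D : Fin 2) (x : M) : ℂ :=
  S.weylSpinor A B C D x +
    lam / 6 * (spinEps A C * spinEps B D + spinEps A D * spinEps B C)

/-- The Weyl part and the constant-curvature part are both proportional to `ε_{A'B'}`, so for
Einstein metrics no mixed curvature spinor appears. The λ/3 becomes λ/6 because of the factor 2 on
the right. -/
lemma bivec_riemannLow {lam : ℝ} (hE : ∀ x i j, S.ricci i j x = lam * minkowski i j)
    (A A' B B' C D : Fin 2) (x : M) :
    ∑ i, ∑ j, infeldInv i A A' * infeldInv j B B' *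
      bivec (fun k l => S.riemannLow i j k l x) C D = 2 * S.phi lam A B C D x * spinEps A' B' := by
  have h1 := (isWeylTensor_weyl hE x).bivec_selfDual A A' B B' C D
  have h2 := bivec_minkowski A A' B B' C D
  have h3 : ∀ i j, bivec (fun k l => S.riemannLow i j k l x) C D =
      bivec (fun k l => S.weyl i j k l x) C D + ((lam / 3 : ℝ) : ℂ) * 
      bivec (fun k l => minkowski i k * minkowski j l - minkowski i l * minkowski j k) C D := by
    intro i j
    rw [← bivec_smul, ← bivec_add]
    congr 1
    funext k l
    exact weyl_eq_of_einstein hE i j k l x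
  have h4 : ∑ i, ∑ j, infeldInv i A A' * infeldInv j B B' *
      bivec (fun k l => S.riemannLow i j k l x) C D =
      ∑ i, ∑ j, infeldInv i A A' * infeldInv j B B' * bivec (fun k l => S.weyl i j k l x) C D +
      ((lam / 3 : ℝ) : ℂ) * ∑ i, ∑ j, infeldInv i A A' * infeldInv j B B' *
      bivec (fun k l => minkowski i k * minkowski j l - minkowski i l * minkowski j k) C D := by
    simp only [h3, Finset.mul_sum, mul_add, Finset.sum_add_distrib]
    congr 1
    exact Finset.sum_congr rfl fun i _ => Finset.sum_congr rfl fun j _ => by ring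
  rw [h4, h1, h2, phi, weylSpinor_eq]
  push_cast
  ring

lemma bivec_riemannLow_eq {lam : ℝ} (hE : ∀ x i j, S.ricci i j x = lam * minkowski i j)
    (i j : Fin 4) (C D : Fin 2) (x : M) :
    bivec (fun k l => S.riemannLow i j k l x) C D =
      2 * ∑ A, ∑ B, sdForm i j A B * S.phi lam A B C D x := by
  rw [sum_infeld_infeldInv (fun i j => bivec (fun k l => S.riemannLow i j k l x) C D) i j]
  simp only [bivec_riemannLow hE, Fin.sum_univ_two, spinEps_table, sdForm]
  ring

lemma spinCurv_eq_phi {lam : ℝ} (hE : ∀ x i j, S.ricci i j x = lam * minkowski i j)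
    (i j : Fin 4) (C B : Fin 2) (x : M) :
    S.spinCurv i j C B x = ∑ D, spinEps B D * ∑ E, ∑ F, sdForm i j E F * S.phi lam E F C D x := by
  have h := spinOf_eq_bivec (S.isLorentzAlg_riemann i j x) C
  have h' : ∀ D, bivec (fun k l => minkowskiSign l * S.riemann i j k l x) C D =
      2 * ∑ A, ∑ B, sdForm i j A B * S.phi lam A B C D x := fun D =>
    bivec_riemannLow_eq hE i j C D x
  simp only [h'] at h
  rw [S.spinCurv_eq]
  match B with
  | 0 =>
    rw [h.1]
    simp only [Fin.sum_univ_two, spinEps_table]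
    ring
  | 1 =>
    rw [h.2]
    simp only [Fin.sum_univ_two, spinEps_table]
    ring

/-- Invariance of the two symbols σ yields an unprimed action and a primed one. The latter acts on ε
by the trace of the conjugate matrix, which is zero. -/
lemma sdForm_invariant {a : Fin 4 → Fin 4 → ℝ} (ha : IsLorentzAlg a) (j k : Fin 4) (A B : Fin 2) :
    ∑ m, ((a j m : ℂ) * sdForm m k A B + (a k m : ℂ) * sdForm j m A B) =
      ∑ C, (spinOf a C A * sdForm j k C B + spinOf a C B * sdForm j k A C) := by
  have h := infeld_invariant ha
  have h1 := h j A 0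
  have h2 := h j A 1
  have h3 := h k B 0
  have h4 := h k B 1
  have ht : conj (spinOf a 1 1) = -conj (spinOf a 0 0) := by rw [spinOf_trace ha, map_neg]
  simp only [Fin.sum_univ_two, Fin.sum_univ_four, sdForm] at h1 h2 h3 h4 ⊢
  linear_combination infeld k B 1 * h1 - infeld k B 0 * h2 + infeld j A 0 * h4 - infeld j A 1 * h3 +
    (infeld j A 0 * infeld k B 1 - infeld j A 1 * infeld k B 0) * ht

end SpinSpacetime
end

/-! ### The covariant derivative of the Weyl spinor and the second Bianchi identity. -/

noncomputable section

namespace SpinSpacetime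

variable {M : Type*} [TopologicalSpace M] [ChartedSpace (EuclideanSpace ℝ (Fin 4)) M]
  [IsManifold (𝓡 4) ∞ M] {S : SpinSpacetime M}

lemma contMDiff_real_mul {f g : M → ℝ} (hf : ContMDiff (𝓡 4) 𝓘(ℝ, ℝ) ∞ f)
    (hg : ContMDiff (𝓡 4) 𝓘(ℝ, ℝ) ∞ g) : ContMDiff (𝓡 4) 𝓘(ℝ, ℝ) ∞ (fun x => f x * g x) :=
  (contDiff_mul.contMDiff (n := ∞)).comp (hf.prodMk_space hg)

lemma contMDiff_riemann (i j k l : Fin 4) : ContMDiff (𝓡 4) 𝓘(ℝ, ℝ) ∞ (S.riemann i j k l) := by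
  have hd : ∀ i j k l, ContMDiff (𝓡 4) 𝓘(ℝ, ℝ) ∞ (S.frameDeriv i (S.christoffel j k l)) :=
    fun i j k l => (S.smoothField_e i).contMDiff_vecDeriv (S.contMDiff_christoffel j k l)
  have hc := S.contMDiff_christoffel
  unfold riemann
  refine ((ContMDiff.sub (hd _ _ _ _) (hd _ _ _ _)).add ?_).sub ?_
  · exact ContMDiff.sum fun m _ =>
      (contMDiff_real_mul (hc _ _ _) (hc _ _ _)).sub (contMDiff_real_mul (hc _ _ _) (hc _ _ _))
  · exact ContMDiff.sum fun m _ => contMDiff_real_mul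
      (contMDiff_real_mul contMDiff_const (S.contMDiff_structureFun _ _ _)) (hc _ _ _)

lemma contMDiff_ricci (i j : Fin 4) : ContMDiff (𝓡 4) 𝓘(ℝ, ℝ) ∞ (S.ricci i j) :=
  ContMDiff.sum fun _ _ => contMDiff_riemann _ _ _ _

lemma contMDiff_weyl (i j k l : Fin 4) : ContMDiff (𝓡 4) 𝓘(ℝ, ℝ) ∞ (S.weyl i j k l) := by
  have hr := contMDiff_ricci (S := S)
  have hm : ∀ c : ℝ, ∀ i j, ContMDiff (𝓡 4) 𝓘(ℝ, ℝ) ∞ (fun x => c * S.ricci i j x) :=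
    fun c i j => contMDiff_real_mul contMDiff_const (hr i j)
  have hs : ContMDiff (𝓡 4) 𝓘(ℝ, ℝ) ∞ S.scalar := ContMDiff.sum fun _ _ => hm _ _ _
  have hd : ∀ {f : M → ℝ} (c : ℝ), ContMDiff (𝓡 4) 𝓘(ℝ, ℝ) ∞ f →
      ContMDiff (𝓡 4) 𝓘(ℝ, ℝ) ∞ (fun x => f x / c) := fun c hf => by
    simp only [div_eq_mul_inv]
    exact contMDiff_real_mul hf contMDiff_const
  exact ((contMDiff_real_mul contMDiff_const (contMDiff_riemann _ _ _ _)).sub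
    (hd 2 ((((hm _ _ _).sub (hm _ _ _)).sub (hm _ _ _)).add (hm _ _ _)))).add
    (contMDiff_real_mul (hd 6 hs) contMDiff_const)

@[fun_prop]
lemma Sm_weylSpinor (A B C D : Fin 2) : Sm (S.weylSpinor A B C D) := by
  have : ∀ i j k l, Sm (fun x => (S.weyl i j k l x : ℂ)) := fun i j k l =>
    Sm.ofReal (contMDiff_weyl i j k l)
  unfold weylSpinor
  fun_prop

/-- The covariant derivative of the Weyl spinor. -/
def nablaWeyl (S : SpinSpacetime M) (x : M) (i : Fin 4) (A B C D : Fin 2) : ℂ :=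
  S.frameDeriv i (S.weylSpinor A B C D) x - ∑ E, (S.spinConn i A E x * S.weylSpinor E B C D x +
    S.spinConn i B E x * S.weylSpinor A E C D x + S.spinConn i C E x * S.weylSpinor A B E D x +
    S.spinConn i D E x * S.weylSpinor A B C E x)

/-- Since λ is constant and the symbols are too, only the Weyl spinor is differentiated. -/
lemma fd_spinCurv {lam : ℝ} (hE : ∀ x i j, S.ricci i j x = lam * minkowski i j)
    (i j k : Fin 4) (C B : Fin 2) (x : M) :
    S.frameDeriv i (S.spinCurv j k C B) x = ∑ D, spinEps B D * ∑ E, ∑ F, sdForm j k E F *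
      S.frameDeriv i (S.weylSpinor E F C D) x := by
  have h : S.spinCurv j k C B = fun x => ∑ D, spinEps B D * ∑ E, ∑ F, sdForm j k E F *
      (S.weylSpinor E F C D x + lam / 6 * (spinEps E C * spinEps F D + spinEps E D * spinEps F C)) :=
    funext fun x => spinCurv_eq_phi hE j k C B x
  rw [h, S.fd_sum i _ (by intro k; fun_prop)]
  refine Finset.sum_congr rfl fun D _ => ?_
  rw [S.fd_const_mul i _ (by fun_prop), S.fd_sum i _ (by intro k; fun_prop)]
  refine congrArg _ (Finset.sum_congr rfl fun E _ => ?_)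
  rw [S.fd_sum i _ (by intro k; fun_prop)]
  refine Finset.sum_congr rfl fun F _ => ?_
  rw [S.fd_const_mul i _ (by fun_prop), S.fd_add i (by fun_prop) (by fun_prop), S.fd_const, add_zero]

lemma phi_symm {lam : ℝ} (hE : ∀ x i j, S.ricci i j x = lam * minkowski i j) (x : M)
    (A B C D : Fin 2) : S.phi lam B A C D x = S.phi lam A B C D x ∧
      S.phi lam A B D C x = S.phi lam A B C D x := by
  have hW := isWeylTensor_weyl hE x
  have h1 : S.weylSpinor B A C D x = S.weylSpinor A B C D x :=
    (hW.spinor_pair_symm B A C D).trans ((hW.spinor_swap_right C D B A).trans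
      (hW.spinor_pair_symm C D A B))
  have h2 : S.weylSpinor A B D C x = S.weylSpinor A B C D x := hW.spinor_swap_right A B D C
  constructor
  · rw [phi, phi, h1]; ring
  · rw [phi, phi, h2]; ring

/-- The extra term of `phi` is built from ε, which the trace-free spin connection annihilates. -/
lemma nablaWeyl_eq_phi (lam : ℝ) (x : M) (i : Fin 4) (A B C D : Fin 2) :
    S.nablaWeyl x i A B C D = S.frameDeriv i (S.weylSpinor A B C D) x -
      ∑ E, (S.spinConn i A E x * S.phi lam E B C D x +
      S.spinConn i B E x * S.phi lam A E C D x + S.spinConn i C E x * S.phi lam A B E D x +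
      S.spinConn i D E x * S.phi lam A B C E x) := by
  rw [nablaWeyl]
  congr 1
  simp only [phi, Fin.sum_univ_two]
  have t := S.spinConn_trace i x
  fin_cases A <;> fin_cases B <;> fin_cases C <;> fin_cases D <;>
    simp only [Fin.zero_eta, Fin.mk_one, spinEps_table, t] <;> ring

/-- The self-dual part of the curvature, with lowered spinor indices. -/
def curvForm (S : SpinSpacetime M) (lam : ℝ) (x : M) (j k : Fin 4) (C D : Fin 2) : ℂ :=
  ∑ E, ∑ F, sdForm j k E F * S.phi lam E F C D x

lemma curvForm_swap {lam : ℝ} (hE : ∀ x i j, S.ricci i j x = lam * minkowski i j) (x : M)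
    (j k : Fin 4) (C D : Fin 2) : S.curvForm lam x k j C D = -S.curvForm lam x j k C D := by
  have h := fun A B => (phi_symm hE x A B C D).1
  simp only [curvForm, sdForm, Fin.sum_univ_two, h 0 1]
  ring

lemma curvForm_symm {lam : ℝ} (hE : ∀ x i j, S.ricci i j x = lam * minkowski i j) (x : M)
    (j k : Fin 4) (C D : Fin 2) : S.curvForm lam x j k D C = S.curvForm lam x j k C D := by
  simp only [curvForm, (phi_symm hE x _ _ C D).2]

/-- By `sdForm_invariant`, the connection terms on the first two spinor indices can be moved to the
frame indices `j`, `k`. -/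
lemma sum_sdForm_nablaWeyl (lam : ℝ) (i j k : Fin 4) (C D : Fin 2) (x : M) :
    ∑ A, ∑ B, sdForm j k A B * S.nablaWeyl x i A B C D =
      (∑ A, ∑ B, sdForm j k A B * S.frameDeriv i (S.weylSpinor A B C D) x) -
      (∑ m, ((S.christoffel i j m x : ℂ) * S.curvForm lam x m k C D +
        (S.christoffel i k m x : ℂ) * S.curvForm lam x j m C D)) -
      ∑ E, (S.spinConn i C E x * S.curvForm lam x j k E D +
        S.spinConn i D E x * S.curvForm lam x j k C E) := by
  have hT : ∀ A B, ∑ m, ((S.christoffel i j m x : ℂ) * sdForm m k A B +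
      (S.christoffel i k m x : ℂ) * sdForm j m A B) =
      ∑ C, (S.spinConn i C A x * sdForm j k C B + S.spinConn i C B x * sdForm j k A C) :=
    fun A B => sdForm_invariant (S.isLorentzAlg_christoffel i x) j k A B
  have h1 : ∑ m, ((S.christoffel i j m x : ℂ) * S.curvForm lam x m k C D +
      (S.christoffel i k m x : ℂ) * S.curvForm lam x j m C D) =
      ∑ A, ∑ B, (∑ m, ((S.christoffel i j m x : ℂ) * sdForm m k A B +
      (S.christoffel i k m x : ℂ) * sdForm j m A B)) * S.phi lam A B C D x := by
    simp only [curvForm, Fin.sum_univ_two, Fin.sum_univ_four]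
    ring
  rw [h1]
  simp only [hT, nablaWeyl_eq_phi lam, curvForm, Fin.sum_univ_two]
  ring

-- This is `spinCurv_bianchi` rewritten for Ψ. Torsion-freeness converts its structure functions
-- into exactly the Christoffel terms of the covariant derivatives.
set_option maxHeartbeats 1000000 in
lemma nablaWeyl_cyclic {lam : ℝ} (hE : ∀ x i j, S.ricci i j x = lam * minkowski i j)
    (i j k : Fin 4) (C D : Fin 2) (x : M) :
    (∑ A, ∑ B, sdForm j k A B * S.nablaWeyl x i A B C D) +
    (∑ A, ∑ B, sdForm k i A B * S.nablaWeyl x j A B C D) +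
    (∑ A, ∑ B, sdForm i j A B * S.nablaWeyl x k A B C D) = 0 := by
  have hb := fun C B => S.spinCurv_bianchi i j k C B x
  have hF : ∀ j k C B, S.spinCurv j k C B x = ∑ D, spinEps B D * S.curvForm lam x j k C D :=
    fun j k C B => spinCurv_eq_phi hE j k C B x
  simp only [fd_spinCurv hE, hF, S.cc_eq] at hb
  have t := fun i => S.spinConn_trace i x
  have w1 := curvForm_swap hE x
  have w2 := curvForm_symm hE x
  rw [sum_sdForm_nablaWeyl lam, sum_sdForm_nablaWeyl lam, sum_sdForm_nablaWeyl lam]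
  generalize S.curvForm lam x = G at hb w1 w2 ⊢
  have e : ∀ i j k C D, ∑ m, ((S.christoffel i j m x : ℂ) * G m k C D +
      (S.christoffel i k m x : ℂ) * G j m C D) = ∑ m, ((S.christoffel i k m x : ℂ) * G j m C D -
      (S.christoffel i j m x : ℂ) * G k m C D) := fun i j k C D =>
    Finset.sum_congr rfl fun m _ => by rw [w1 k m]; ring
  have e2 : ∀ i j k C D, ∑ m, ((S.christoffel j k m x : ℂ) - S.christoffel k j m x) * G i m C D =
      ∑ m, (S.christoffel j k m x : ℂ) * G i m C D - ∑ m, (S.christoffel k j m x : ℂ) * G i m C D :=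
    fun i j k C D => by rw [← Finset.sum_sub_distrib]; simp only [sub_mul]
  simp only [e, Finset.sum_sub_distrib]
  simp only [Fin.sum_univ_two (f := fun D => spinEps _ D * _), spinEps_table] at hb
  -- Lowering the upper index `B` by ε exchanges the values 0 and 1, with a sign in the first case.
  match D with
  | 0 =>
    have hb1 := hb C 1
    simp only [spinEps_table, zero_mul, add_zero, mul_neg, neg_mul, one_mul, e2,
      Finset.sum_neg_distrib] at hb1
    simp only [Fin.sum_univ_two (f := fun D => (_ : ℂ) * _ - _), Fin.sum_univ_two (f := fun D => (_ : ℂ) * _ + _), spinEps_table, t] at hb1 ⊢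
    simp only [zero_mul, one_mul, zero_add, neg_mul, mul_neg] at hb1
    linear_combination -hb1 
  | 1 =>
    have hb1 := hb C 0
    simp only [spinEps_table, zero_mul, zero_add, one_mul, e2] at hb1
    simp only [Fin.sum_univ_two (f := fun D => (_ : ℂ) * _ - _), Fin.sum_univ_two (f := fun D => (_ : ℂ) * _ + _), spinEps_table, t] at hb1 ⊢
    simp only [zero_mul, one_mul, zero_add, neg_mul, mul_neg] at hb1
    linear_combination hb1 

end SpinSpacetime
end

/-! ### The spinor form of the Bianchi identity and the Leibniz rule for Ψ. -/

noncomputable section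

namespace SpinSpacetime

variable {M : Type*} [TopologicalSpace M] [ChartedSpace (EuclideanSpace ℝ (Fin 4)) M]
  [IsManifold (𝓡 4) ∞ M] {S : SpinSpacetime M}

lemma weylSpinor_swap {lam : ℝ} (hE : ∀ x i j, S.ricci i j x = lam * minkowski i j)
    (A B C D : Fin 2) (x : M) : S.weylSpinor B A C D x = S.weylSpinor A B C D x ∧
      S.weylSpinor A C B D x = S.weylSpinor A B C D x ∧
      S.weylSpinor A B D C x = S.weylSpinor A B C D x := by
  have hW := isWeylTensor_weyl hE x
  refine ⟨?_, ?_, ?_⟩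
  · exact (hW.spinor_pair_symm B A C D).trans ((hW.spinor_swap_right C D B A).trans
      (hW.spinor_pair_symm C D A B))
  · exact hW.spinor_swap_mid A C B D
  · exact hW.spinor_swap_right A B D C

lemma nablaWeyl_symm {lam : ℝ} (hE : ∀ x i j, S.ricci i j x = lam * minkowski i j) (x : M)
    (i : Fin 4) (A B C D : Fin 2) : S.nablaWeyl x i B A C D = S.nablaWeyl x i A B C D := by
  have h1 := fun A B C D x => (weylSpinor_swap hE A B C D x).1
  have h2 : S.weylSpinor B A C D = S.weylSpinor A B C D := funext (h1 A B C D)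
  have h3 : ∀ E, S.spinConn i B E x * S.weylSpinor E A C D x =
      S.spinConn i B E x * S.weylSpinor A E C D x := fun E => by rw [h1 A E C D x]
  have h4 : ∀ E, S.spinConn i A E x * S.weylSpinor B E C D x =
      S.spinConn i A E x * S.weylSpinor E B C D x := fun E => by rw [h1 E B C D x]
  have h5 : ∀ E, S.spinConn i C E x * S.weylSpinor B A E D x =
      S.spinConn i C E x * S.weylSpinor A B E D x := fun E => by rw [h1 A B E D x]
  have h6 : ∀ E, S.spinConn i D E x * S.weylSpinor B A C E x =
      S.spinConn i D E x * S.weylSpinor A B C E x := fun E => by rw [h1 A B C E x]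
  rw [nablaWeyl, nablaWeyl, h2]
  simp only [h3, h4, h5, h6]
  exact congrArg _ (Finset.sum_congr rfl fun E _ => by ring)

/-- The Bianchi identity `∇_{E'}{}^A Ψ_{ABCD} = 0`. -/
lemma nablaWeyl_bianchi {lam : ℝ} (hE : ∀ x i j, S.ricci i j x = lam * minkowski i j)
    (E' B C D : Fin 2) (x : M) :
    ∑ i, infeldInv i 0 E' * S.nablaWeyl x i 1 B C D =
      ∑ i, infeldInv i 1 E' * S.nablaWeyl x i 0 B C D := by
  have s1 := fun i => nablaWeyl_symm hE x i 0 1 C D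
  have hs : invSqrtTwo * invSqrtTwo = 1 / 2 := by rw [← sq, invSqrtTwo_sq]
  have h013 := nablaWeyl_cyclic hE 0 1 3 C D x
  have h023 := nablaWeyl_cyclic hE 0 2 3 C D x
  have h012 := nablaWeyl_cyclic hE 0 1 2 C D x
  have h123 := nablaWeyl_cyclic hE 1 2 3 C D x
  have hI := Complex.I_mul_I
  simp only [Fin.sum_univ_two, sdForm, infeld_table, s1] at h013 h023 h012 h123
  simp only [Fin.sum_univ_four]
  have hn : ∀ z : ℂ, invSqrtTwo * invSqrtTwo * z = 0 → z = 0 := fun z hz => by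
    rw [hs] at hz; linear_combination 2 * hz
  have hc : ∀ A B, ∃ n : Fin 4 → ℂ, ∀ i, S.nablaWeyl x i A B C D = n i :=
    fun A B => ⟨_, fun i => rfl⟩
  obtain ⟨n, hn0⟩ := hc 0 0
  obtain ⟨p, hp⟩ := hc 0 1
  obtain ⟨q, hq⟩ := hc 1 1
  simp only [hn0, hp, hq] at h013 h023 h012 h123 s1
  -- For fixed `C`, `D` the four triples of frame indices give four equations for the derivatives
  -- `n`, `p`, `q` of the components 00, 01, 11. The four choices of `E'`, `B` are combinations of
  -- them.
  have g013 := hn (-n 0 - q 0 + 2 * p 1 + n 3 - q 3) (by linear_combination h013)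
  have g023 := hn (-Complex.I * n 0 + Complex.I * q 0 + 2 * p 2 + Complex.I * n 3 +
    Complex.I * q 3) (by linear_combination h023)
  have g012 := hn (2 * Complex.I * p 0 - Complex.I * n 1 - Complex.I * q 1 + n 2 - q 2)
    (by linear_combination h012)
  have g123 := hn (-Complex.I * n 1 + Complex.I * q 1 + n 2 + q 2 + 2 * Complex.I * p 3)
    (by linear_combination h123)
  clear h013 h023 h012 h123
  match E', B with
  | 0, 0 =>
    simp only [infeldInv_table, s1, hn0]
    linear_combination invSqrtTwo * ((-Complex.I / 2) * (g012 + g123) + (p 0 + p 3 - n 1) * hI)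
  | 0, 1 =>
    simp only [infeldInv_table, hp, hq]
    linear_combination invSqrtTwo * ((-1 / 2) * (g013 + Complex.I * g023) +
      1 / 2 * (-n 0 + q 0 + n 3 + q 3) * hI)
  | 1, 0 =>
    simp only [infeldInv_table, s1, hn0]
    linear_combination invSqrtTwo * ((1 / 2) * (g013 - Complex.I * g023) +
      1 / 2 * (-n 0 + q 0 + n 3 + q 3) * hI)
  | 1, 1 =>
    simp only [infeldInv_table, hp, hq]
    linear_combination invSqrtTwo * ((-Complex.I / 2) * (g123 - g012) + (q 1 - p 0 + p 3) * hI)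

/-- The Weyl spinor as a quadrilinear form. -/
def psiForm (S : SpinSpacetime M) (x : M) (a b c d : Spinor) : ℂ :=
  ∑ A, ∑ B, ∑ C, ∑ D, S.weylSpinor A B C D x * a A * b B * c C * d D

/-- The covariant derivative of the Weyl spinor as a quadrilinear form. -/
def nablaPsi (S : SpinSpacetime M) (x : M) (i : Fin 4) (a b c d : Spinor) : ℂ :=
  ∑ A, ∑ B, ∑ C, ∑ D, S.nablaWeyl x i A B C D * a A * b B * c C * d D

lemma psiForm_swap {lam : ℝ} (hE : ∀ x i j, S.ricci i j x = lam * minkowski i j)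
    (x : M) (a b c d : Spinor) : S.psiForm x b a c d = S.psiForm x a b c d ∧
      S.psiForm x a c b d = S.psiForm x a b c d ∧ S.psiForm x a b d c = S.psiForm x a b c d := by
  have h1 := fun A B C D => (weylSpinor_swap hE A B C D x).1
  have h2 := fun A B C D => (weylSpinor_swap hE A B C D x).2.1
  have h3 := fun A B C D => (weylSpinor_swap hE A B C D x).2.2
  simp only [psiForm, Fin.sum_univ_two, h1 0 1, h2 _ 0 1, h3 _ _ 0 1]
  refine ⟨?_, ?_, ?_⟩ <;> ring

/-- The Bianchi identity says that `∇_{EE'} Ψ_{ABCD}` is symmetric in `E` and `A`, so the spinors in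
these two places may be exchanged. -/
lemma nablaPsi_bianchi {lam : ℝ} (hE : ∀ x i j, S.ricci i j x = lam * minkowski i j)
    (x : M) (κ η ξ b c d : Spinor) :
    ∑ i, nullVec κ ξ i * S.nablaPsi x i η b c d =
      ∑ i, nullVec η ξ i * S.nablaPsi x i κ b c d := by
  have h := fun E' B C D => nablaWeyl_bianchi hE E' B C D x
  have key : ∀ κ η : Spinor, ∑ i, nullVec κ ξ i * S.nablaPsi x i η b c d =
      ∑ A, ∑ B, ∑ C, ∑ D, ∑ E, ∑ E', κ E * conj (ξ E') * η A * b B * c C * d D *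
        ∑ i, infeldInv i E E' * S.nablaWeyl x i A B C D := by
    intro κ η
    simp only [nullVec, nablaPsi, Finset.sum_mul, Finset.mul_sum]
    rw [Finset.sum_comm]
    refine Finset.sum_congr rfl fun A _ => ?_
    rw [Finset.sum_comm]
    refine Finset.sum_congr rfl fun B _ => ?_
    rw [Finset.sum_comm]
    refine Finset.sum_congr rfl fun C _ => ?_
    rw [Finset.sum_comm]
    refine Finset.sum_congr rfl fun D _ => ?_
    rw [Finset.sum_comm]
    refine Finset.sum_congr rfl fun E _ => ?_
    rw [Finset.sum_comm]
    refine Finset.sum_congr rfl fun E' _ => ?_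
    exact Finset.sum_congr rfl fun i _ => by ring
  rw [key, key]
  generalize hN : (fun E E' A B C D => ∑ i, infeldInv i E E' * S.nablaWeyl x i A B C D) = N
  have h' : ∀ E' B C D, N 0 E' 1 B C D = N 1 E' 0 B C D := fun E' B C D => by
    rw [← hN]; exact h E' B C D
  have hN' : ∀ E E' A B C D, ∑ i, infeldInv i E E' * S.nablaWeyl x i A B C D = N E E' A B C D :=
    fun E E' A B C D => by rw [← hN]
  simp only [hN', Fin.sum_univ_two, h']
  ring

/-- The Leibniz rule for the Weyl scalars. -/
lemma fd_psiForm {a b c d : M → Spinor} (ha : ∀ B, Sm (fun y => a y B))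
    (hb : ∀ B, Sm (fun y => b y B)) (hc : ∀ B, Sm (fun y => c y B)) (hd : ∀ B, Sm (fun y => d y B))
    (i : Fin 4) (x : M) :
    S.frameDeriv i (fun y => S.psiForm y (a y) (b y) (c y) (d y)) x =
      S.nablaPsi x i (a x) (b x) (c x) (d x) + S.psiForm x (S.nablaSpin a x i) (b x) (c x) (d x) +
      S.psiForm x (a x) (S.nablaSpin b x i) (c x) (d x) +
      S.psiForm x (a x) (b x) (S.nablaSpin c x i) (d x) +
      S.psiForm x (a x) (b x) (c x) (S.nablaSpin d x i) := by
  have h : ∀ A B C D, S.frameDeriv i (fun y => S.weylSpinor A B C D y * a y A * b y B * c y C *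
      d y D) x = S.frameDeriv i (S.weylSpinor A B C D) x * a x A * b x B * c x C * d x D +
      S.weylSpinor A B C D x * (S.frameDeriv i (fun y => a y A) x * b x B * c x C * d x D +
      a x A * S.frameDeriv i (fun y => b y B) x * c x C * d x D +
      a x A * b x B * S.frameDeriv i (fun y => c y C) x * d x D +
      a x A * b x B * c x C * S.frameDeriv i (fun y => d y D) x) := by
    intro A B C D
    rw [S.fd_mul i (by fun_prop) (hd D), S.fd_mul i (by fun_prop) (hc C),
      S.fd_mul i (by fun_prop) (hb B), S.fd_mul i (by fun_prop) (ha A)]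
    ring
  have h0 : S.frameDeriv i (fun y => S.psiForm y (a y) (b y) (c y) (d y)) x =
      ∑ A, ∑ B, ∑ C, ∑ D, S.frameDeriv i (fun y => S.weylSpinor A B C D y * a y A * b y B * c y C *
      d y D) x := by
    simp only [psiForm]
    rw [S.fd_sum i _ (by intro A; fun_prop)]
    refine Finset.sum_congr rfl fun A _ => ?_
    rw [S.fd_sum i _ (by intro A; fun_prop)]
    refine Finset.sum_congr rfl fun B _ => ?_
    rw [S.fd_sum i _ (by intro A; fun_prop)]
    refine Finset.sum_congr rfl fun C _ => ?_
    rw [S.fd_sum i _ (by intro A; fun_prop)]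
  rw [h0]
  simp only [h, nablaPsi, psiForm, nablaWeyl, nablaSpin, Fin.sum_univ_two]
  ring

end SpinSpacetime
end

/-! ### Contractions with null vectors and the Cartan formula. -/

noncomputable section

lemma nullVec_left (a b : ℂ) (κ η ξ : Spinor) (j : Fin 4) :
    nullVec (fun B => a * κ B + b * η B) ξ j = a * nullVec κ ξ j + b * nullVec η ξ j := by
  simp only [nullVec, Fin.sum_univ_two]
  ring

lemma nullVec_right (a b : ℂ) (κ η ξ : Spinor) (j : Fin 4) :
    nullVec ξ (fun B => a * κ B + b * η B) j =
      conj a * nullVec ξ κ j + conj b * nullVec ξ η j := by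
  simp only [nullVec, Fin.sum_univ_two, map_add, map_mul]
  ring

namespace SpinSpacetime

variable {M : Type*} [TopologicalSpace M] [ChartedSpace (EuclideanSpace ℝ (Fin 4)) M]
  [IsManifold (𝓡 4) ∞ M] {S : SpinSpacetime M}

/-- The curvature contracted with two null vectors. -/
lemma sum_curvForm {lam : ℝ} (x : M) (κ₁ ξ₁ κ₂ ξ₂ : Spinor) (C D : Fin 2) :
    ∑ i, ∑ j, nullVec κ₁ ξ₁ i * nullVec κ₂ ξ₂ j * S.curvForm lam x i j C D =
      conj (spinProd ξ₁ ξ₂) * ∑ A, ∑ B, κ₁ A * κ₂ B * S.phi lam A B C D x := by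
  have h1 := sum_nullVec_infeld κ₁ ξ₁
  have h2 := sum_nullVec_infeld κ₂ ξ₂
  have h : ∑ i, ∑ j, nullVec κ₁ ξ₁ i * nullVec κ₂ ξ₂ j * S.curvForm lam x i j C D =
      ∑ A, ∑ B, ((∑ i, nullVec κ₁ ξ₁ i * infeld i A 0) * (∑ j, nullVec κ₂ ξ₂ j * infeld j B 1) -
      (∑ i, nullVec κ₁ ξ₁ i * infeld i A 1) * (∑ j, nullVec κ₂ ξ₂ j * infeld j B 0)) *
      S.phi lam A B C D x := by
    simp only [curvForm, sdForm, Fin.sum_univ_two, Fin.sum_univ_four]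
    ring
  rw [h]
  simp only [h1, h2, spinProd, Fin.sum_univ_two, spinEps_table, map_add, map_mul, map_zero, map_one,
    map_neg]
  ring

lemma spinProd_spinCurv {lam : ℝ} (hE : ∀ x i j, S.ricci i j x = lam * minkowski i j)
    (x : M) (i j : Fin 4) (κ ξ : Spinor) :
    spinProd (fun B => ∑ C, S.spinCurv i j C B x * κ C) ξ =
      ∑ C, ∑ D, S.curvForm lam x i j C D * κ C * ξ D := by
  have hF : ∀ C B, S.spinCurv i j C B x = ∑ D, spinEps B D * S.curvForm lam x i j C D :=
    fun C B => spinCurv_eq_phi hE i j C B x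
  simp only [hF, spinProd, Fin.sum_univ_two, spinEps_table]
  ring

/-- Every Weyl scalar in the structure equations comes from here. The λ-term vanishes in the
evaluations where the spinor products do. -/
lemma sum_spinProd_spinCurv {lam : ℝ} (hE : ∀ x i j, S.ricci i j x = lam * minkowski i j)
    (x : M) (κ₁ ξ₁ κ₂ ξ₂ κ ξ : Spinor) :
    ∑ i, ∑ j, nullVec κ₁ ξ₁ i * nullVec κ₂ ξ₂ j *
      spinProd (fun B => ∑ C, S.spinCurv i j C B x * κ C) ξ =
      conj (spinProd ξ₁ ξ₂) * (S.psiForm x κ₁ κ₂ κ ξ + lam / 6 *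
        (spinProd κ₁ κ * spinProd κ₂ ξ + spinProd κ₁ ξ * spinProd κ₂ κ)) := by
  have h := fun C D => sum_curvForm (S := S) (lam := lam) x κ₁ ξ₁ κ₂ ξ₂ C D
  have h' : ∑ i, ∑ j, nullVec κ₁ ξ₁ i * nullVec κ₂ ξ₂ j *
      spinProd (fun B => ∑ C, S.spinCurv i j C B x * κ C) ξ =
      ∑ C, ∑ D, κ C * ξ D *
        ∑ i, ∑ j, nullVec κ₁ ξ₁ i * nullVec κ₂ ξ₂ j * S.curvForm lam x i j C D := by
    simp only [spinProd_spinCurv hE]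
    simp only [Fin.sum_univ_two, Fin.sum_univ_four]
    ring
  rw [h']
  simp only [h, phi, psiForm, spinProd, Fin.sum_univ_two, spinEps_table]
  ring

/-- The contraction of a 1-form with the null vector `κ ξ̄`. -/
def pair (θ : Fin 4 → M → ℂ) (κ ξ : M → Spinor) (x : M) : ℂ :=
  ∑ i, nullVec (κ x) (ξ x) i * θ i x

/-- The derivative along the null vector `κ ξ̄`. -/
def along (S : SpinSpacetime M) (κ ξ : M → Spinor) (f : M → ℂ) (x : M) : ℂ :=
  ∑ i, nullVec (κ x) (ξ x) i * S.frameDeriv i f x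

@[fun_prop]
lemma Sm_nullVec {κ ξ : M → Spinor} (hκ : ∀ B, Sm (fun y => κ y B)) (hξ : ∀ B, Sm (fun y => ξ y B))
    (j : Fin 4) : Sm (fun y => nullVec (κ y) (ξ y) j) := by
  unfold nullVec
  fun_prop

lemma Sm_pair {θ : Fin 4 → M → ℂ} (hθ : ∀ i, Sm (θ i)) {κ ξ : M → Spinor}
    (hκ : ∀ B, Sm (fun y => κ y B)) (hξ : ∀ B, Sm (fun y => ξ y B)) : Sm (pair θ κ ξ) := by
  unfold pair
  fun_prop

/-- The symbols σ are covariantly constant, so the Levi-Civita derivative of `κ ξ̄` obeys the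
Leibniz rule with spinor derivatives. -/
lemma fd_nullVec {κ ξ : M → Spinor} (hκ : ∀ B, Sm (fun y => κ y B)) (hξ : ∀ B, Sm (fun y => ξ y B))
    (i j : Fin 4) (x : M) :
    S.frameDeriv i (fun y => nullVec (κ y) (ξ y) j) x =
      nullVec (S.nablaSpin κ x i) (ξ x) j + nullVec (κ x) (S.nablaSpin ξ x i) j -
        ∑ k, (S.christoffel i k j x : ℂ) * nullVec (κ x) (ξ x) k := by
  have h := nullVec_action (S.isLorentzAlg_christoffel i x) (κ x) (ξ x) j
  rw [h]
  have hd : S.frameDeriv i (fun y => nullVec (κ y) (ξ y) j) x =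
      ∑ A, ∑ A', (infeldInv j A A' * S.frameDeriv i (fun y => κ y A) x * conj (ξ x A') +
        infeldInv j A A' * κ x A * conj (S.frameDeriv i (fun y => ξ y A') x)) := by
    unfold nullVec
    rw [S.fd_sum i _ (by intro A; fun_prop)]
    refine Finset.sum_congr rfl fun A _ => ?_
    rw [S.fd_sum i _ (by intro A; fun_prop)]
    refine Finset.sum_congr rfl fun A' _ => ?_
    rw [S.fd_mul i (by fun_prop) (hξ A').conj, S.fd_const_mul i _ (hκ A), S.fd_conj i (hξ A')]
  rw [hd]
  simp only [nullVec, nablaSpin, S.spinConn_eq, Fin.sum_univ_two, map_add, map_mul]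
  ring

/-- Cartan's formula for a 1-form evaluated on two null vector fields. -/
lemma along_pair_comm {θ : Fin 4 → M → ℂ} (hθ : ∀ i, Sm (θ i)) {κ₁ ξ₁ κ₂ ξ₂ : M → Spinor}
    (hκ₁ : ∀ B, Sm (fun y => κ₁ y B)) (hξ₁ : ∀ B, Sm (fun y => ξ₁ y B))
    (hκ₂ : ∀ B, Sm (fun y => κ₂ y B)) (hξ₂ : ∀ B, Sm (fun y => ξ₂ y B)) (x : M) :
    S.along κ₁ ξ₁ (pair θ κ₂ ξ₂) x - S.along κ₂ ξ₂ (pair θ κ₁ ξ₁) x =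
      (∑ i, ∑ j, nullVec (κ₁ x) (ξ₁ x) i * nullVec (κ₂ x) (ξ₂ x) j *
        (S.frameDeriv i (θ j) x - S.frameDeriv j (θ i) x - ∑ m, S.cc i j m x * θ m x)) +
      (∑ i, nullVec (κ₁ x) (ξ₁ x) i * ∑ j, (nullVec (S.nablaSpin κ₂ x i) (ξ₂ x) j +
        nullVec (κ₂ x) (S.nablaSpin ξ₂ x i) j) * θ j x) -
      (∑ i, nullVec (κ₂ x) (ξ₂ x) i * ∑ j, (nullVec (S.nablaSpin κ₁ x i) (ξ₁ x) j +
        nullVec (κ₁ x) (S.nablaSpin ξ₁ x i) j) * θ j x) := by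
  have key : ∀ {κ₁ ξ₁ κ₂ ξ₂ : M → Spinor}, (∀ B, Sm (fun y => κ₂ y B)) →
      (∀ B, Sm (fun y => ξ₂ y B)) → S.along κ₁ ξ₁ (pair θ κ₂ ξ₂) x =
      (∑ i, ∑ j, nullVec (κ₁ x) (ξ₁ x) i * nullVec (κ₂ x) (ξ₂ x) j * S.frameDeriv i (θ j) x) +
      (∑ i, nullVec (κ₁ x) (ξ₁ x) i * ∑ j, (nullVec (S.nablaSpin κ₂ x i) (ξ₂ x) j +
        nullVec (κ₂ x) (S.nablaSpin ξ₂ x i) j) * θ j x) -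
      ∑ i, ∑ j, nullVec (κ₁ x) (ξ₁ x) i * nullVec (κ₂ x) (ξ₂ x) j *
        ∑ m, (S.christoffel i j m x : ℂ) * θ m x := by
    intro κ₁ ξ₁ κ₂ ξ₂ hκ₂ hξ₂
    unfold along pair
    rw [← Finset.sum_add_distrib, ← Finset.sum_sub_distrib]
    refine Finset.sum_congr rfl fun i _ => ?_
    rw [S.fd_sum i _ (by intro k; fun_prop)]
    have : ∀ j, S.frameDeriv i (fun y => nullVec (κ₂ y) (ξ₂ y) j * θ j y) x = _ := fun j =>
      S.fd_mul i (Sm_nullVec hκ₂ hξ₂ j) (hθ j) x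
    simp only [this, fd_nullVec hκ₂ hξ₂]
    simp only [Fin.sum_univ_four]
    ring
  rw [key hκ₂ hξ₂, key hκ₁ hξ₁, Finset.sum_comm (f := fun i j => nullVec (κ₂ x) (ξ₂ x) i *
    nullVec (κ₁ x) (ξ₁ x) j * S.frameDeriv i (θ j) x), Finset.sum_comm (f := fun i j =>
    nullVec (κ₂ x) (ξ₂ x) i * nullVec (κ₁ x) (ξ₁ x) j * ∑ m, (S.christoffel i j m x : ℂ) * θ m x)]
  have e : ∀ i j, ∑ m, S.cc i j m x * θ m x = ∑ m, (S.christoffel i j m x : ℂ) * θ m x -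
      ∑ m, (S.christoffel j i m x : ℂ) * θ m x := fun i j => by
    simp only [S.cc_eq, sub_mul, Finset.sum_sub_distrib]
  simp only [e, mul_sub, Finset.sum_sub_distrib]
  have e2 : ∀ G : Fin 4 → Fin 4 → ℂ, ∑ i, ∑ j, nullVec (κ₂ x) (ξ₂ x) j * nullVec (κ₁ x) (ξ₁ x) i *
    G j i = ∑ i, ∑ j, nullVec (κ₁ x) (ξ₁ x) i * nullVec (κ₂ x) (ξ₂ x) j * G j i := fun G =>
      Finset.sum_congr rfl fun i _ => Finset.sum_congr rfl fun j _ => by ring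
  rw [e2 (fun i j => S.frameDeriv i (θ j) x),
    e2 (fun i j => ∑ m, (S.christoffel i j m x : ℂ) * θ m x)]
  ring

/-- Apply the Cartan formula to the exact form `df`, whose exterior derivative vanishes by
`fd_comm`. -/
lemma along_comm {f : M → ℂ} (hf : Sm f) {κ₁ ξ₁ κ₂ ξ₂ : M → Spinor}
    (hκ₁ : ∀ B, Sm (fun y => κ₁ y B)) (hξ₁ : ∀ B, Sm (fun y => ξ₁ y B))
    (hκ₂ : ∀ B, Sm (fun y => κ₂ y B)) (hξ₂ : ∀ B, Sm (fun y => ξ₂ y B)) (x : M) :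
    S.along κ₁ ξ₁ (S.along κ₂ ξ₂ f) x - S.along κ₂ ξ₂ (S.along κ₁ ξ₁ f) x =
      (∑ i, nullVec (κ₁ x) (ξ₁ x) i * ∑ j, (nullVec (S.nablaSpin κ₂ x i) (ξ₂ x) j +
        nullVec (κ₂ x) (S.nablaSpin ξ₂ x i) j) * S.frameDeriv j f x) -
      (∑ i, nullVec (κ₂ x) (ξ₂ x) i * ∑ j, (nullVec (S.nablaSpin κ₁ x i) (ξ₁ x) j +
        nullVec (κ₁ x) (S.nablaSpin ξ₁ x i) j) * S.frameDeriv j f x) := by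
  have h := along_pair_comm (S := S) (θ := fun i => S.frameDeriv i f)
    (fun i => S.Sm_frameDeriv i hf) hκ₁ hξ₁ hκ₂ hξ₂ x
  refine h.trans ?_
  simp only [S.fd_comm _ _ hf, sub_self, mul_zero, Finset.sum_const_zero, zero_add]

end SpinSpacetime
end

/-! ### Structure equations, Weyl scalars and Bianchi identities in a dyad. -/

noncomputable section

lemma spinProd_self (κ : Spinor) : spinProd κ κ = 0 := by
  simp only [spinProd, Fin.sum_univ_two, spinEps_table]
  ring

lemma spinProd_swap (κ ξ : Spinor) : spinProd ξ κ = -spinProd κ ξ := by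
  simp only [spinProd, Fin.sum_univ_two, spinEps_table]
  ring

/-- The expansion of a spinor in a normalised basis. -/
lemma spinor_expansion {o ι : Spinor} (h : spinProd o ι = 1) (κ : Spinor) (B : Fin 2) :
    κ B = spinProd κ ι * o B + spinProd o κ * ι B := by
  simp only [spinProd, Fin.sum_univ_two, spinEps_table] at h ⊢
  match B with
  | 0 => linear_combination -κ 0 * h
  | 1 => linear_combination -κ 1 * h

namespace SpinSpacetime

variable {M : Type*} [TopologicalSpace M] [ChartedSpace (EuclideanSpace ℝ (Fin 4)) M]
  [IsManifold (𝓡 4) ∞ M] {S : SpinSpacetime M}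

lemma psiForm_comb_left (x : M) (r s : ℂ) (κ η b c d : Spinor) :
    S.psiForm x (fun B => r * κ B + s * η B) b c d = r * S.psiForm x κ b c d +
      s * S.psiForm x η b c d := by
  simp only [psiForm, Fin.sum_univ_two]
  ring

/-- The component `-∇o` along `o`. -/
def dyadA (S : SpinSpacetime M) (o ι : M → Spinor) (i : Fin 4) (x : M) : ℂ :=
  spinProd (S.nablaSpin o x i) (ι x)

/-- The component of `∇o` along `ι`. -/
def dyadB (S : SpinSpacetime M) (o : M → Spinor) (i : Fin 4) (x : M) : ℂ :=
  spinProd (o x) (S.nablaSpin o x i)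

/-- The component of `∇ι` along `o`. -/
def dyadC (S : SpinSpacetime M) (ι : M → Spinor) (i : Fin 4) (x : M) : ℂ :=
  spinProd (S.nablaSpin ι x i) (ι x)

lemma sm_component {o : M → Spinor} (ho : ContMDiff (𝓡 4) 𝓘(ℝ, Spinor) ∞ o) (B : Fin 2) :
    Sm (fun y => o y B) :=
  contMDiff_pi_space.1 ho B

@[fun_prop]
lemma Sm_nablaSpin {κ : M → Spinor} (hκ : ∀ B, Sm (fun y => κ y B)) (i : Fin 4) (B : Fin 2) :
    Sm (fun y => S.nablaSpin κ y i B) := by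
  have := S.Sm_frameDeriv i (hκ B)
  have h2 : Sm (fun x => S.frameDeriv i (fun y => κ y B) x) := this
  unfold nablaSpin
  fun_prop

lemma Sm_spinProd {κ ξ : M → Spinor} (hκ : ∀ B, Sm (fun y => κ y B)) (hξ : ∀ B, Sm (fun y => ξ y B)) :
    Sm (fun y => spinProd (κ y) (ξ y)) := by
  unfold spinProd
  fun_prop

lemma Sm_psiForm {a b c d : M → Spinor} (ha : ∀ B, Sm (fun y => a y B))
    (hb : ∀ B, Sm (fun y => b y B)) (hc : ∀ B, Sm (fun y => c y B)) (hd : ∀ B, Sm (fun y => d y B)) :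
    Sm (fun y => S.psiForm y (a y) (b y) (c y) (d y)) := by
  unfold psiForm
  fun_prop

/-- No connection term is left over because ε is parallel, the spin connection being trace-free. -/
lemma fd_spinProd {κ ξ : M → Spinor} (hκ : ∀ B, Sm (fun y => κ y B)) (hξ : ∀ B, Sm (fun y => ξ y B))
    (i : Fin 4) (x : M) : S.frameDeriv i (fun y => spinProd (κ y) (ξ y)) x =
      spinProd (S.nablaSpin κ x i) (ξ x) + spinProd (κ x) (S.nablaSpin ξ x i) := by
  have hd : S.frameDeriv i (fun y => spinProd (κ y) (ξ y)) x =
      ∑ A, ∑ B, (spinEps A B * S.frameDeriv i (fun y => κ y A) x * ξ x B +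
        spinEps A B * κ x A * S.frameDeriv i (fun y => ξ y B) x) := by
    unfold spinProd
    rw [S.fd_sum i _ (by intro A; fun_prop)]
    refine Finset.sum_congr rfl fun A _ => ?_
    rw [S.fd_sum i _ (by intro A; fun_prop)]
    refine Finset.sum_congr rfl fun B _ => ?_
    rw [S.fd_mul i (by fun_prop) (hξ B), S.fd_const_mul i _ (hκ A)]
  rw [hd]
  simp only [spinProd, nablaSpin, Fin.sum_univ_two, spinEps_table, S.spinConn_trace]
  ring

variable {o ι : M → Spinor}

lemma Sm_dyadA (hd : IsSpinDyad o ι) (i : Fin 4) : Sm (S.dyadA o ι i) :=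
  Sm_spinProd (Sm_nablaSpin (sm_component hd.smooth_o) i) (sm_component hd.smooth_ι)

lemma Sm_dyadB (hd : IsSpinDyad o ι) (i : Fin 4) : Sm (S.dyadB o i) :=
  Sm_spinProd (sm_component hd.smooth_o) (Sm_nablaSpin (sm_component hd.smooth_o) i)

lemma Sm_dyadC (hd : IsSpinDyad o ι) (i : Fin 4) : Sm (S.dyadC ι i) :=
  Sm_spinProd (Sm_nablaSpin (sm_component hd.smooth_ι) i) (sm_component hd.smooth_ι)

lemma nablaSpin_o (hd : IsSpinDyad o ι) (x : M) (i : Fin 4) :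
    S.nablaSpin o x i = fun B => S.dyadA o ι i x * o x B + S.dyadB o i x * ι x B :=
  funext fun B => spinor_expansion (hd.normalized x) _ B

/-- Differentiating `o_A ι^A = 1` forces the coefficient of `ι` to be minus that of `o` in `∇o`. -/
lemma nablaSpin_ι (hd : IsSpinDyad o ι) (x : M) (i : Fin 4) :
    S.nablaSpin ι x i = fun B => S.dyadC ι i x * o x B + -S.dyadA o ι i x * ι x B := by
  funext B
  have h := fd_spinProd (S := S) (sm_component hd.smooth_o) (sm_component hd.smooth_ι) i x
  have h1 : (fun y => spinProd (o y) (ι y)) = fun _ => (1 : ℂ) := funext hd.normalized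
  rw [h1, S.fd_const] at h
  have h2 : spinProd (o x) (S.nablaSpin ι x i) = -S.dyadA o ι i x := by
    rw [dyadA]; linear_combination -h
  rw [← h2]
  exact spinor_expansion (hd.normalized x) _ B

lemma spinProd_dyad (hd : IsSpinDyad o ι) (x : M) (a b c d : ℂ) :
    spinProd (fun B => a * o x B + b * ι x B) (fun B => c * o x B + d * ι x B) = a * d - b * c := by
  have h := hd.normalized x
  simp only [spinProd, Fin.sum_univ_two, spinEps_table] at h ⊢
  linear_combination (a * d - b * c) * h

lemma spinProd_nablaSpin_comm (hd : IsSpinDyad o ι) (i j : Fin 4) (x : M) (η : Spinor) :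
    spinProd (S.nablaSpin (fun y => S.nablaSpin o y j) x i) η -
      spinProd (S.nablaSpin (fun y => S.nablaSpin o y i) x j) η =
      spinProd (fun B => ∑ C, S.spinCurv i j C B x * o x C) η +
        ∑ m, S.cc i j m x * spinProd (S.nablaSpin o x m) η := by
  have h := fun B => nablaSpin_comm S (sm_component hd.smooth_o) i j B x
  have h0 := h 0
  have h1 := h 1
  simp only [Fin.sum_univ_four] at h0 h1
  simp only [spinProd, Fin.sum_univ_two, spinEps_table, Fin.sum_univ_four] at h0 h1 ⊢
  linear_combination h0 * η 1 - h1 * η 0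

/-- The Cartan structure equation for `A`: the `ι` contraction of the Ricci identity for `o`. -/
lemma ext_dyadA (hd : IsSpinDyad o ι) (i j : Fin 4) (x : M) :
    S.frameDeriv i (S.dyadA o ι j) x - S.frameDeriv j (S.dyadA o ι i) x -
      ∑ m, S.cc i j m x * S.dyadA o ι m x =
      spinProd (fun B => ∑ C, S.spinCurv i j C B x * o x C) (ι x) -
        S.dyadB o j x * S.dyadC ι i x + S.dyadB o i x * S.dyadC ι j x := by
  have e : ∀ i j, S.frameDeriv i (S.dyadA o ι j) x =
      spinProd (S.nablaSpin (fun y => S.nablaSpin o y j) x i) (ι x) +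
        (S.dyadA o ι j x * -S.dyadA o ι i x - S.dyadB o j x * S.dyadC ι i x) := fun i j => by
    rw [← spinProd_dyad hd, ← nablaSpin_o hd, ← nablaSpin_ι hd]
    exact fd_spinProd (Sm_nablaSpin (sm_component hd.smooth_o) j) (sm_component hd.smooth_ι) i x
  have h := spinProd_nablaSpin_comm (S := S) hd i j x (ι x)
  rw [e, e]
  have h' : ∑ m, S.cc i j m x * S.dyadA o ι m x =
    ∑ m, S.cc i j m x * spinProd (S.nablaSpin o x m) (ι x) := rfl
  rw [h']
  linear_combination h

/-- The Cartan structure equation for `B`, from the `o` contraction of the same Ricci identity. It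
contains no `C`, which makes it closed on geodesic shear-free directions. -/
lemma ext_dyadB (hd : IsSpinDyad o ι) (i j : Fin 4) (x : M) :
    S.frameDeriv i (S.dyadB o j) x - S.frameDeriv j (S.dyadB o i) x -
      ∑ m, S.cc i j m x * S.dyadB o m x =
      -spinProd (fun B => ∑ C, S.spinCurv i j C B x * o x C) (o x) -
        2 * (S.dyadA o ι j x * S.dyadB o i x - S.dyadA o ι i x * S.dyadB o j x) := by
  have e : ∀ i j, S.frameDeriv i (S.dyadB o j) x =
      (S.dyadA o ι i x * S.dyadB o j x - S.dyadB o i x * S.dyadA o ι j x) -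
      spinProd (S.nablaSpin (fun y => S.nablaSpin o y j) x i) (o x) := fun i j => by
    rw [← spinProd_dyad hd, ← nablaSpin_o hd, ← nablaSpin_o hd, sub_eq_add_neg, ← spinProd_swap]
    exact fd_spinProd (sm_component hd.smooth_o) (Sm_nablaSpin (sm_component hd.smooth_o) j) i x
  have h := spinProd_nablaSpin_comm (S := S) hd i j x (o x)
  rw [e, e]
  have h' : ∑ m, S.cc i j m x * S.dyadB o m x =
      -∑ m, S.cc i j m x * spinProd (S.nablaSpin o x m) (o x) := by
    rw [← Finset.sum_neg_distrib]
    exact Finset.sum_congr rfl fun m _ => by rw [dyadB, spinProd_swap]; ring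
  rw [h']
  linear_combination -h

lemma sum_ext_dyadA {lam : ℝ} (hE : ∀ x i j, S.ricci i j x = lam * minkowski i j)
    (hd : IsSpinDyad o ι) (κ₁ ξ₁ κ₂ ξ₂ : M → Spinor) (x : M) :
    ∑ i, ∑ j, nullVec (κ₁ x) (ξ₁ x) i * nullVec (κ₂ x) (ξ₂ x) j *
      (S.frameDeriv i (S.dyadA o ι j) x - S.frameDeriv j (S.dyadA o ι i) x -
      ∑ m, S.cc i j m x * S.dyadA o ι m x) =
      conj (spinProd (ξ₁ x) (ξ₂ x)) * (S.psiForm x (κ₁ x) (κ₂ x) (o x) (ι x) + lam / 6 *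
        (spinProd (κ₁ x) (o x) * spinProd (κ₂ x) (ι x) +
          spinProd (κ₁ x) (ι x) * spinProd (κ₂ x) (o x))) -
      pair (S.dyadB o) κ₂ ξ₂ x * pair (S.dyadC ι) κ₁ ξ₁ x +
      pair (S.dyadB o) κ₁ ξ₁ x * pair (S.dyadC ι) κ₂ ξ₂ x := by
  rw [← sum_spinProd_spinCurv hE]
  simp only [ext_dyadA hd, pair]
  generalize (fun i j => spinProd (fun B => ∑ C, S.spinCurv i j C B x * o x C) (ι x)) = F
  simp only [Fin.sum_univ_four]
  ring

lemma sum_ext_dyadB {lam : ℝ} (hE : ∀ x i j, S.ricci i j x = lam * minkowski i j)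
    (hd : IsSpinDyad o ι) (κ₁ ξ₁ κ₂ ξ₂ : M → Spinor) (x : M) :
    ∑ i, ∑ j, nullVec (κ₁ x) (ξ₁ x) i * nullVec (κ₂ x) (ξ₂ x) j *
      (S.frameDeriv i (S.dyadB o j) x - S.frameDeriv j (S.dyadB o i) x -
      ∑ m, S.cc i j m x * S.dyadB o m x) =
      -(conj (spinProd (ξ₁ x) (ξ₂ x)) * (S.psiForm x (κ₁ x) (κ₂ x) (o x) (o x) + lam / 6 *
        (spinProd (κ₁ x) (o x) * spinProd (κ₂ x) (o x) +
          spinProd (κ₁ x) (o x) * spinProd (κ₂ x) (o x)))) -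
      2 * (pair (S.dyadA o ι) κ₂ ξ₂ x * pair (S.dyadB o) κ₁ ξ₁ x -
      pair (S.dyadA o ι) κ₁ ξ₁ x * pair (S.dyadB o) κ₂ ξ₂ x) := by
  rw [← sum_spinProd_spinCurv hE]
  simp only [ext_dyadB hd, pair]
  generalize (fun i j => spinProd (fun B => ∑ C, S.spinCurv i j C B x * o x C) (ι x)) = F
  simp only [Fin.sum_univ_four]
  ring

/-- The Weyl scalars `Ψ₀, …, Ψ₄` of a dyad. -/
def psi (S : SpinSpacetime M) (o ι : M → Spinor) (k : Fin 5) (x : M) : ℂ :=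
  ![S.psiForm x (o x) (o x) (o x) (o x), S.psiForm x (o x) (o x) (o x) (ι x),
    S.psiForm x (o x) (o x) (ι x) (ι x), S.psiForm x (o x) (ι x) (ι x) (ι x),
    S.psiForm x (ι x) (ι x) (ι x) (ι x)] k

lemma Sm_psi (hd : IsSpinDyad o ι) (k : Fin 5) : Sm (S.psi o ι k) := by
  have h1 := sm_component hd.smooth_o
  have h2 := sm_component hd.smooth_ι
  fin_cases k
  · exact Sm_psiForm h1 h1 h1 h1
  · exact Sm_psiForm h1 h1 h1 h2
  · exact Sm_psiForm h1 h1 h2 h2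
  · exact Sm_psiForm h1 h2 h2 h2
  · exact Sm_psiForm h2 h2 h2 h2

/-- All components of the Weyl spinor with respect to a dyad are given by the Weyl scalars. -/
lemma psiForm_dyad {lam : ℝ} (hE : ∀ x i j, S.ricci i j x = lam * minkowski i j) (x : M)
    (a b c d e f g h : ℂ) :
    S.psiForm x (fun B => a * o x B + b * ι x B) (fun B => c * o x B + d * ι x B)
      (fun B => e * o x B + f * ι x B) (fun B => g * o x B + h * ι x B) =
    a * c * e * g * S.psi o ι 0 x +
    (b * c * e * g + a * d * e * g + a * c * f * g + a * c * e * h) * S.psi o ι 1 x +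
    (b * d * e * g + b * c * f * g + b * c * e * h + a * d * f * g + a * d * e * h +
      a * c * f * h) * S.psi o ι 2 x +
    (b * d * f * g + b * d * e * h + b * c * f * h + a * d * f * h) * S.psi o ι 3 x +
    b * d * f * h * S.psi o ι 4 x := by
  have h1 := fun A B C D => (weylSpinor_swap hE A B C D x).1
  have h2 := fun A B C D => (weylSpinor_swap hE A B C D x).2.1
  have h3 := fun A B C D => (weylSpinor_swap hE A B C D x).2.2
  simp only [psi, psiForm, Fin.sum_univ_two, h1 0 1, h2 _ 0 1, h3 _ _ 0 1, Matrix.cons_val]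
  ring

/-- The components of the covariant derivative of the Weyl spinor in a dyad. -/
def dpsi (S : SpinSpacetime M) (o ι : M → Spinor) (k : Fin 5) (i : Fin 4) (x : M) : ℂ :=
  S.frameDeriv i (S.psi o ι k) x -
  ![4 * (S.dyadA o ι i x * S.psi o ι 0 x + S.dyadB o i x * S.psi o ι 1 x),
    3 * (S.dyadA o ι i x * S.psi o ι 1 x + S.dyadB o i x * S.psi o ι 2 x) +
      (S.dyadC ι i x * S.psi o ι 0 x - S.dyadA o ι i x * S.psi o ι 1 x),
    2 * (S.dyadA o ι i x * S.psi o ι 2 x + S.dyadB o i x * S.psi o ι 3 x) +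
      2 * (S.dyadC ι i x * S.psi o ι 1 x - S.dyadA o ι i x * S.psi o ι 2 x),
    (S.dyadA o ι i x * S.psi o ι 3 x + S.dyadB o i x * S.psi o ι 4 x) +
      3 * (S.dyadC ι i x * S.psi o ι 2 x - S.dyadA o ι i x * S.psi o ι 3 x),
    4 * (S.dyadC ι i x * S.psi o ι 3 x - S.dyadA o ι i x * S.psi o ι 4 x)] k

lemma sm_comb (hd : IsSpinDyad o ι) (a b : ℂ) (B : Fin 2) :
    Sm (fun y => a * o y B + b * ι y B) :=
  (((Sm.const a).mul (sm_component hd.smooth_o B))).add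
    ((Sm.const b).mul (sm_component hd.smooth_ι B))

lemma nablaSpin_comb (hd : IsSpinDyad o ι) (a b : ℂ) (i : Fin 4) (x : M) :
    S.nablaSpin (fun y B => a * o y B + b * ι y B) x i = fun B =>
      (a * S.dyadA o ι i x + b * S.dyadC ι i x) * o x B +
      (a * S.dyadB o i x - b * S.dyadA o ι i x) * ι x B := by
  have ho := congrFun (nablaSpin_o (S := S) hd x i)
  have hi := congrFun (nablaSpin_ι (S := S) hd x i)
  funext B
  have ho := ho B
  have hi := hi B
  simp only [nablaSpin] at ho hi ⊢
  rw [S.fd_add i ((Sm.const a).mul (sm_component hd.smooth_o B))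
    ((Sm.const b).mul (sm_component hd.smooth_ι B)), S.fd_const_mul i a (sm_component hd.smooth_o B),
    S.fd_const_mul i b (sm_component hd.smooth_ι B)]
  simp only [Fin.sum_univ_two] at ho hi ⊢
  linear_combination a * ho + b * hi

-- For constant combinations of the dyad, expand both sides of the Leibniz rule multilinearly. By
-- total symmetry the sixteen component choices collapse to five.
set_option maxHeartbeats 800000 in
lemma nablaPsi_dyad {lam : ℝ} (hE : ∀ x i j, S.ricci i j x = lam * minkowski i j)
    (hd : IsSpinDyad o ι) (x : M) (i : Fin 4) (a b c d e f g h : ℂ) :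
    S.nablaPsi x i (fun B => a * o x B + b * ι x B) (fun B => c * o x B + d * ι x B)
      (fun B => e * o x B + f * ι x B) (fun B => g * o x B + h * ι x B) =
    a * c * e * g * S.dpsi o ι 0 i x +
    (b * c * e * g + a * d * e * g + a * c * f * g + a * c * e * h) * S.dpsi o ι 1 i x +
    (b * d * e * g + b * c * f * g + b * c * e * h + a * d * f * g + a * d * e * h +
      a * c * f * h) * S.dpsi o ι 2 i x +
    (b * d * f * g + b * d * e * h + b * c * f * h + a * d * f * h) * S.dpsi o ι 3 i x +
    b * d * f * h * S.dpsi o ι 4 i x := by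
  have h1 := fd_psiForm (S := S) (sm_comb hd a b) (sm_comb hd c d) (sm_comb hd e f)
    (sm_comb hd g h) i x
  have h2 := fun y => psiForm_dyad (o := o) (ι := ι) hE y a b c d e f g h
  have hs := fun k => Sm_psi (S := S) hd k
  have hm := fun (z : ℂ) k => (Sm.const z).mul (hs k)
  rw [funext h2, S.fd_add i ((((hm _ _).add (hm _ _)).add (hm _ _)).add (hm _ _)) (hm _ _),
    S.fd_add i (((hm _ _).add (hm _ _)).add (hm _ _)) (hm _ _),
    S.fd_add i ((hm _ _).add (hm _ _)) (hm _ _), S.fd_add i (hm _ _) (hm _ _),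
    S.fd_const_mul i _ (hs _), S.fd_const_mul i _ (hs _), S.fd_const_mul i _ (hs _),
    S.fd_const_mul i _ (hs _), S.fd_const_mul i _ (hs _)] at h1
  simp only [nablaSpin_comb hd, psiForm_dyad hE] at h1
  simp only [dpsi, Matrix.cons_val]
  linear_combination -h1

/-- The Bianchi identities in a dyad. -/
lemma bianchi_dyad {lam : ℝ} (hE : ∀ x i j, S.ricci i j x = lam * minkowski i j)
    (hd : IsSpinDyad o ι) (ξ : M → Spinor) (x : M) :
    pair (S.dpsi o ι 1) o ξ x = pair (S.dpsi o ι 0) ι ξ x ∧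
    pair (S.dpsi o ι 2) o ξ x = pair (S.dpsi o ι 1) ι ξ x ∧
    pair (S.dpsi o ι 3) o ξ x = pair (S.dpsi o ι 2) ι ξ x ∧
    pair (S.dpsi o ι 4) o ξ x = pair (S.dpsi o ι 3) ι ξ x := by
  have hf : o x = (fun B => 1 * o x B + 0 * ι x B) ∧ ι x = fun B => 0 * o x B + 1 * ι x B :=
    ⟨funext fun B => by ring, funext fun B => by ring⟩
  have key : ∀ c d e f g h : ℂ, _ := fun c d e f g h => nablaPsi_bianchi hE x (o x) (ι x) (ξ x)
    (fun B => c * o x B + d * ι x B) (fun B => e * o x B + f * ι x B)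
    (fun B => g * o x B + h * ι x B)
  have e0 := nablaPsi_dyad hE hd x (a := 1) (b := 0)
  have e1 := nablaPsi_dyad hE hd x (a := 0) (b := 1)
  rw [← hf.1] at e0
  rw [← hf.2] at e1
  simp only [e0, e1] at key
  refine ⟨?_, ?_, ?_, ?_⟩
  -- The three inert slots run through `ooo`, `ιoo`, `ιιo`, `ιιι`.
  · simpa [pair] using key 1 0 1 0 1 0
  · simpa [pair] using key 0 1 1 0 1 0
  · simpa [pair] using key 0 1 0 1 1 0
  · simpa [pair] using key 0 1 0 1 0 1

end SpinSpacetime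
end

/-! ### Geodesic and shear-free implies algebraically special. -/

noncomputable section

namespace SpinSpacetime

variable {M : Type*} [TopologicalSpace M] [ChartedSpace (EuclideanSpace ℝ (Fin 4)) M]
  [IsManifold (𝓡 4) ∞ M] {S : SpinSpacetime M} {o ι : M → Spinor}

/-- The contraction of the conjugate of a 1-form with the null vector `κ ξ̄`. -/
def pairConj (θ : Fin 4 → M → ℂ) (κ ξ : M → Spinor) (x : M) : ℂ :=
  ∑ i, nullVec (κ x) (ξ x) i * conj (θ i x)

lemma along_zero (κ ξ : M → Spinor) (x : M) : S.along κ ξ (fun _ => 0) x = 0 := by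
  simp only [along, S.fd_const, mul_zero, Finset.sum_const_zero]

lemma along_mul {f g : M → ℂ} (hf : Sm f) (hg : Sm g) (κ ξ : M → Spinor) (x : M) :
    S.along κ ξ (fun y => f y * g y) x = S.along κ ξ f x * g x + f x * S.along κ ξ g x := by
  simp only [along, S.fd_mul _ hf hg, Fin.sum_univ_four]
  ring

lemma sum_nullVec_comb (X : Fin 4 → ℂ) (p q r s : Fin 4 → ℂ) (κ ξ η ζ : Spinor) (θ : Fin 4 → ℂ) :
    ∑ i, X i * ∑ j, (nullVec (fun B => p i * κ B + q i * ξ B) ζ j +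
      nullVec η (fun B => r i * κ B + s i * ξ B) j) * θ j =
    (∑ i, X i * p i) * (∑ j, nullVec κ ζ j * θ j) + (∑ i, X i * q i) * (∑ j, nullVec ξ ζ j * θ j) +
    (∑ i, X i * conj (r i)) * (∑ j, nullVec η κ j * θ j) +
    (∑ i, X i * conj (s i)) * (∑ j, nullVec η ξ j * θ j) := by
  simp only [nullVec_left, nullVec_right, Fin.sum_univ_four]
  ring

/-- `∑ X^i ∇_i Y^j θ_j` for `Y` the null vectors `ℓ`, `m`, `m̄`, `n` of a dyad. -/
lemma sum_cov_dyad (hd : IsSpinDyad o ι) (κ ξ : M → Spinor) (x : M) (θ : Fin 4 → M → ℂ) :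
    (∑ i, nullVec (κ x) (ξ x) i * ∑ j, (nullVec (S.nablaSpin o x i) (o x) j +
        nullVec (o x) (S.nablaSpin o x i) j) * θ j x =
      (pair (S.dyadA o ι) κ ξ x + pairConj (S.dyadA o ι) κ ξ x) * pair θ o o x +
      pair (S.dyadB o) κ ξ x * pair θ ι o x + pairConj (S.dyadB o) κ ξ x * pair θ o ι x) ∧
    (∑ i, nullVec (κ x) (ξ x) i * ∑ j, (nullVec (S.nablaSpin o x i) (ι x) j +
        nullVec (o x) (S.nablaSpin ι x i) j) * θ j x =
      (pair (S.dyadA o ι) κ ξ x - pairConj (S.dyadA o ι) κ ξ x) * pair θ o ι x +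
      pair (S.dyadB o) κ ξ x * pair θ ι ι x + pairConj (S.dyadC ι) κ ξ x * pair θ o o x) ∧
    (∑ i, nullVec (κ x) (ξ x) i * ∑ j, (nullVec (S.nablaSpin ι x i) (o x) j +
        nullVec (ι x) (S.nablaSpin o x i) j) * θ j x =
      (pairConj (S.dyadA o ι) κ ξ x - pair (S.dyadA o ι) κ ξ x) * pair θ ι o x +
      pairConj (S.dyadB o) κ ξ x * pair θ ι ι x + pair (S.dyadC ι) κ ξ x * pair θ o o x) ∧
    (∑ i, nullVec (κ x) (ξ x) i * ∑ j, (nullVec (S.nablaSpin ι x i) (ι x) j +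
        nullVec (ι x) (S.nablaSpin ι x i) j) * θ j x =
      -(pair (S.dyadA o ι) κ ξ x + pairConj (S.dyadA o ι) κ ξ x) * pair θ ι ι x +
      pair (S.dyadC ι) κ ξ x * pair θ o ι x + pairConj (S.dyadC ι) κ ξ x * pair θ ι o x) := by
  simp only [nablaSpin_o hd, nablaSpin_ι hd, sum_nullVec_comb, mul_neg, map_neg,
    Finset.sum_neg_distrib, pair, pairConj]
  refine ⟨?_, ?_, ?_, ?_⟩ <;> ring

lemma pair_dpsi (κ ξ : M → Spinor) (x : M) :
    pair (S.dpsi o ι 0) κ ξ x = S.along κ ξ (S.psi o ι 0) x -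
      4 * (pair (S.dyadA o ι) κ ξ x * S.psi o ι 0 x + pair (S.dyadB o) κ ξ x * S.psi o ι 1 x) ∧
    pair (S.dpsi o ι 1) κ ξ x = S.along κ ξ (S.psi o ι 1) x -
      3 * (pair (S.dyadA o ι) κ ξ x * S.psi o ι 1 x + pair (S.dyadB o) κ ξ x * S.psi o ι 2 x) -
      (pair (S.dyadC ι) κ ξ x * S.psi o ι 0 x - pair (S.dyadA o ι) κ ξ x * S.psi o ι 1 x) ∧
    pair (S.dpsi o ι 2) κ ξ x = S.along κ ξ (S.psi o ι 2) x -
      2 * (pair (S.dyadA o ι) κ ξ x * S.psi o ι 2 x + pair (S.dyadB o) κ ξ x * S.psi o ι 3 x) -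
      2 * (pair (S.dyadC ι) κ ξ x * S.psi o ι 1 x - pair (S.dyadA o ι) κ ξ x * S.psi o ι 2 x) ∧
    pair (S.dpsi o ι 3) κ ξ x = S.along κ ξ (S.psi o ι 3) x -
      (pair (S.dyadA o ι) κ ξ x * S.psi o ι 3 x + pair (S.dyadB o) κ ξ x * S.psi o ι 4 x) -
      3 * (pair (S.dyadC ι) κ ξ x * S.psi o ι 2 x - pair (S.dyadA o ι) κ ξ x * S.psi o ι 3 x) ∧
    pair (S.dpsi o ι 4) κ ξ x = S.along κ ξ (S.psi o ι 4) x -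
      4 * (pair (S.dyadC ι) κ ξ x * S.psi o ι 3 x - pair (S.dyadA o ι) κ ξ x * S.psi o ι 4 x) := by
  simp only [pair, along, dpsi, Matrix.cons_val, Fin.sum_univ_four]
  refine ⟨?_, ?_, ?_, ?_, ?_⟩ <;> ring

/-- The Goldberg–Sachs theorem: a geodesic and shear-free spinor is a repeated principal one. -/
lemma psi_eq_zero_of_geodesic_shearfree {lam : ℝ}
    (hE : ∀ x i j, S.ricci i j x = lam * minkowski i j) (hd : IsSpinDyad o ι)
    (hl : ∀ x, pair (S.dyadB o) o o x = 0) (hm : ∀ x, pair (S.dyadB o) o ι x = 0) (x : M) :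
    S.psi o ι 0 x = 0 ∧ S.psi o ι 1 x = 0 := by
  have so := sm_component hd.smooth_o
  have si := sm_component hd.smooth_ι
  have n1 := hd.normalized
  have n2 : ∀ x, spinProd (ι x) (o x) = -1 := fun x => by rw [spinProd_swap, n1]
  have hl' : pair (S.dyadB o) o o = fun _ => 0 := funext hl
  have hm' : pair (S.dyadB o) o ι = fun _ => 0 := funext hm
  -- In the structure equation for `B` on ℓ and m, every term contains `B(ℓ)` or `B(m)` except the
  -- curvature term Ψ₀.
  have h0 : ∀ x, S.psi o ι 0 x = 0 := fun x => by
    have h := along_pair_comm (S := S) (Sm_dyadB (S := S) hd) so so so si x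
    rw [sum_ext_dyadB hE hd, (sum_cov_dyad hd o o x _).2.1, (sum_cov_dyad hd o ι x _).1, hl', hm',
      along_zero, along_zero] at h
    simp only [spinProd_self, n1, map_one] at h
    change (0 : ℂ) - 0 = -(1 * (S.psi o ι 0 x + _)) - _ + _ - _ at h
    linear_combination h
  have h0' : S.psi o ι 0 = fun _ => 0 := funext h0
  refine ⟨h0 x, ?_⟩
  -- With Ψ₀ = 0 the first Bianchi identity is a linear equation for Ψ₁ along `o ξ̄`; the Ψ₂ term
  -- carries a factor κ or σ.
  have b1 : ∀ ξ : M → Spinor, (∀ x, pair (S.dyadB o) o ξ x = 0) → ∀ x,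
      S.along o ξ (S.psi o ι 1) x =
      (2 * pair (S.dyadA o ι) o ξ x - 4 * pair (S.dyadB o) ι ξ x) * S.psi o ι 1 x := by
    intro ξ hξ x
    have h := (bianchi_dyad hE hd ξ x).1
    rw [(pair_dpsi o ξ x).2.1, (pair_dpsi ι ξ x).1, h0', along_zero, hξ] at h
    linear_combination h
  have bl := b1 o hl
  have bm := b1 ι hm
  have sB := Sm_dyadB (S := S) hd
  have sA := Sm_dyadA (S := S) hd
  have s1 := Sm_psi (S := S) hd 1
  have p1 : ∀ {κ ξ : M → Spinor}, (∀ B, Sm (fun y => κ y B)) → (∀ B, Sm (fun y => ξ y B)) →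
      Sm (pair (S.dyadA o ι) κ ξ) := fun h1 h2 => Sm_pair sA h1 h2
  have p2 : ∀ {κ ξ : M → Spinor}, (∀ B, Sm (fun y => κ y B)) → (∀ B, Sm (fun y => ξ y B)) →
      Sm (pair (S.dyadB o) κ ξ) := fun h1 h2 => Sm_pair sB h1 h2
  -- The commutator of ℓ and m on Ψ₁ is computed twice: by the general formula, and by iterating the
  -- linear equations.
  have hc := along_comm (S := S) s1 so so so si x
  rw [(sum_cov_dyad hd o o x (fun j => S.frameDeriv j (S.psi o ι 1))).2.1,
    (sum_cov_dyad hd o ι x (fun j => S.frameDeriv j (S.psi o ι 1))).1, hl, hm] at hc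
  have hal : ∀ κ ξ : M → Spinor, pair (fun j => S.frameDeriv j (S.psi o ι 1)) κ ξ x =
    S.along κ ξ (S.psi o ι 1) x := fun _ _ => rfl
  simp only [hal] at hc
  have e1 : ∀ ξ : M → Spinor, (∀ B, Sm (fun y => ξ y B)) → ∀ κ η : M → Spinor,
      S.along κ η (fun x => (2 * pair (S.dyadA o ι) o ξ x - 4 * pair (S.dyadB o) ι ξ x) *
        S.psi o ι 1 x) x = (2 * S.along κ η (pair (S.dyadA o ι) o ξ) x -
          4 * S.along κ η (pair (S.dyadB o) ι ξ) x) * S.psi o ι 1 x +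
        (2 * pair (S.dyadA o ι) o ξ x - 4 * pair (S.dyadB o) ι ξ x) *
          S.along κ η (S.psi o ι 1) x := by
    intro ξ hξ κ η
    have h1 := p1 so hξ
    have h2 := p2 si hξ
    rw [along_mul (((Sm.const 2).mul h1).sub ((Sm.const 4).mul h2)) s1]
    congr 2
    simp only [along]
    simp only [S.fd_sub _ ((Sm.const 2).mul h1) ((Sm.const 4).mul h2),
      S.fd_const_mul _ _ h1, S.fd_const_mul _ _ h2, Fin.sum_univ_four]
    ring
  rw [funext bl, funext bm, e1 ι si, e1 o so, bl, bm] at hc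
  -- The coefficients' derivatives come from the structure equations: `A` on (ℓ, m), and `B` on (ℓ,
  -- n) and (m, m̄).
  have q1 := along_pair_comm (S := S) sA so so so si x
  rw [sum_ext_dyadA hE hd, (sum_cov_dyad hd o o x _).2.1, (sum_cov_dyad hd o ι x _).1, hl, hm] at q1
  have q2 := along_pair_comm (S := S) sB so so si si x
  rw [sum_ext_dyadB hE hd, (sum_cov_dyad hd o o x _).2.2.2, (sum_cov_dyad hd ι ι x _).1, hl', hm',
    along_zero] at q2
  have q3 := along_pair_comm (S := S) sB so si si so x
  rw [sum_ext_dyadB hE hd, (sum_cov_dyad hd o ι x _).2.2.1, (sum_cov_dyad hd ι o x _).2.1, hl', hm',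
    along_zero] at q3
  simp only [spinProd_self, n1, n2, map_one, map_neg] at q1 q2 q3
  have w1 : S.psiForm x (o x) (o x) (o x) (ι x) = S.psi o ι 1 x := rfl
  have w2 : S.psiForm x (o x) (ι x) (o x) (o x) = S.psi o ι 1 x := by
    rw [(psiForm_swap hE x _ _ _ _).2.1, (psiForm_swap hE x _ _ _ _).2.2]; rfl
  rw [w1] at q1
  rw [w2] at q2 q3
  -- The curvature term of `q1` gives 2 Ψ₁², those of `q2` and `q3` give 4 Ψ₁² each, and all
  -- products of connection coefficients cancel.
  have hfin : 10 * (S.psi o ι 1 x * S.psi o ι 1 x) = 0 := by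
    linear_combination hc - 2 * S.psi o ι 1 x * q1 + 4 * S.psi o ι 1 x * (q2 - q3)
  simpa using hfin

end SpinSpacetime
end

/-! ### Local uniqueness for linear first-order systems. -/

noncomputable section

section ChartODE

variable {M : Type*} [TopologicalSpace M] [ChartedSpace (EuclideanSpace ℝ (Fin 4)) M]
  [IsManifold (𝓡 4) ∞ M]

open Filter Topology in
/-- A function on a normed space whose derivative is bounded by its value vanishes near a zero. -/
lemma eventually_eq_zero_of_norm_fderiv_le {E : Type*} [NormedAddCommGroup E] [NormedSpace ℝ E]
    [ProperSpace E] {F : E → ℂ} {y₀ : E} {K : ℝ}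
    (hF : ∀ᶠ y in 𝓝 y₀, DifferentiableAt ℝ F y ∧ ‖fderiv ℝ F y‖ ≤ K * ‖F y‖) (h0 : F y₀ = 0) :
    ∀ᶠ y in 𝓝 y₀, F y = 0 := by
  obtain ⟨r, hr, hball⟩ := Metric.eventually_nhds_iff_ball.1 hF
  set K₀ : ℝ := |K| + 1 with hK₀
  have hK₀pos : 0 < K₀ := by positivity
  -- The radius is small enough that `K₀ s ≤ 1/2`. By the mean value inequality the maximum of the
  -- norm on the ball is at most half of itself, hence zero.
  set s : ℝ := min (r / 2) (1 / (2 * K₀)) with hs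
  have hspos : 0 < s := by positivity
  have hsr : s < r := (min_le_left _ _).trans_lt (by linarith)
  have hsK : K₀ * s ≤ 1 / 2 := by
    have h1 : s ≤ 1 / (2 * K₀) := min_le_right _ _
    calc K₀ * s ≤ K₀ * (1 / (2 * K₀)) := by gcongr
      _ = 1 / 2 := by field_simp
  have hsub : ∀ y ∈ Metric.closedBall y₀ s, DifferentiableAt ℝ F y ∧ ‖fderiv ℝ F y‖ ≤ K₀ * ‖F y‖ := by
    intro y hy
    have h1 := hball y (Metric.closedBall_subset_ball hsr hy)
    refine ⟨h1.1, h1.2.trans ?_⟩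
    gcongr
    rw [hK₀]
    linarith [le_abs_self K]
  obtain ⟨z, hz, hmax⟩ := (isCompact_closedBall y₀ s).exists_isMaxOn
    ⟨y₀, Metric.mem_closedBall_self hspos.le⟩
    (f := fun y => ‖F y‖) (fun y hy => (hsub y hy).1.continuousAt.norm.continuousWithinAt)
  have hmv := (convex_closedBall y₀ s).norm_image_sub_le_of_norm_fderiv_le (𝕜 := ℝ)
    (fun y hy => (hsub y hy).1) (C := K₀ * ‖F z‖)
    (fun y hy => (hsub y hy).2.trans (by gcongr; exact hmax hy))
    (Metric.mem_closedBall_self hspos.le) hz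
  rw [h0, sub_zero] at hmv
  have hzs : ‖z - y₀‖ ≤ s := by rwa [← dist_eq_norm]
  have h2 : ‖F z‖ ≤ 1 / 2 * ‖F z‖ := by
    calc ‖F z‖ ≤ K₀ * ‖F z‖ * ‖z - y₀‖ := hmv
      _ ≤ K₀ * ‖F z‖ * s := by gcongr
      _ = (K₀ * s) * ‖F z‖ := by ring
      _ ≤ 1 / 2 * ‖F z‖ := by gcongr
  have h3 : ‖F z‖ ≤ 0 := by linarith
  filter_upwards [Metric.closedBall_mem_nhds y₀ hspos] with y hy
  exact norm_le_zero_iff.1 ((hmax hy).trans h3)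

end ChartODE

namespace SpinSpacetime

variable {M : Type*} [TopologicalSpace M] [ChartedSpace (EuclideanSpace ℝ (Fin 4)) M]
  [IsManifold (𝓡 4) ∞ M] {S : SpinSpacetime M} {o ι : M → Spinor}

lemma chartField_linearIndependent (x : M) : LinearIndependent ℝ
    (fun i => chartField x (S.e i) (extChartAt (𝓡 4) x x)) := by
  have : IsManifold (𝓡 4) 1 M := IsManifold.of_le (n := ∞) (by simp)
  have hinv := isInvertible_mfderivWithin_extChartAt_symm (I := 𝓡 4) (x := x)
    (mem_extChartAt_target x)
  obtain ⟨A, hA⟩ := hinv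
  have h := S.linearIndependent_e ((extChartAt (𝓡 4) x).symm (extChartAt (𝓡 4) x x))
  have h3 : (fun i => chartField x (S.e i) (extChartAt (𝓡 4) x x)) =
      fun i => A.symm (S.e i ((extChartAt (𝓡 4) x).symm (extChartAt (𝓡 4) x x))) := by
    funext i
    rw [chartField, mpullbackWithin, ← hA, ContinuousLinearMap.inverse_equiv]
    rfl
  refine Fintype.linearIndependent_iff.2 fun a ha => ?_
  have h4 := fun i => congrFun h3 i
  simp only [h4] at ha
  refine Fintype.linearIndependent_iff.1 h a (A.symm.injective ?_)
  rw [map_sum, map_zero]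
  simp only [map_smul]
  exact ha

open Filter Topology in
/-- A solution of a linear system `E_i f = h_i f` vanishes near every zero. -/
lemma eventually_eq_zero_of_frameDeriv {f : M → ℂ} {h : Fin 4 → M → ℂ} (hf : Sm f)
    (hh : ∀ i, Sm (h i)) (H : ∀ i x, S.frameDeriv i f x = h i x * f x) {x₀ : M} (h0 : f x₀ = 0) :
    ∀ᶠ x in 𝓝 x₀, f x = 0 := by
  set φ := extChartAt (𝓡 4) x₀ with hφ
  set y₀ := φ x₀ with hy₀
  have hx₀ : φ.symm y₀ = x₀ := extChartAt_to_inv x₀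
  set F : EuclideanSpace ℝ (Fin 4) → ℂ := f ∘ φ.symm with hFdef
  have htar : ∀ᶠ y in 𝓝 y₀, y ∈ φ.target :=
    (isOpen_extChartAt_target (I := 𝓡 4) x₀).mem_nhds (mem_extChartAt_target x₀)
  have hsymm : ContinuousAt φ.symm y₀ := continuousAt_extChartAt_symm x₀
  let A : EuclideanSpace ℝ (Fin 4) → (EuclideanSpace ℝ (Fin 4)) →L[ℝ] (EuclideanSpace ℝ (Fin 4)) :=
    fun y => ∑ i, (EuclideanSpace.proj i : EuclideanSpace ℝ (Fin 4) →L[ℝ] ℝ).smulRight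
      (chartField x₀ (S.e i) y)
  have happ : ∀ y v, A y v = ∑ i, v i • chartField x₀ (S.e i) y := by
    intro y v
    simp only [A, sum_apply, ContinuousLinearMap.smulRight_apply]
    rfl
  have hAc : ContinuousAt A y₀ := by
    refine tendsto_finsetSum _ fun i _ => ?_
    have h1 : ContinuousAt (chartField x₀ (S.e i)) y₀ :=
      ((S.smoothField_e i).differentiableAt_chartField x₀).continuousAt
    exact (((ContinuousLinearMap.smulRightL ℝ (EuclideanSpace ℝ (Fin 4))
      (EuclideanSpace ℝ (Fin 4))) (EuclideanSpace.proj i)).continuous.continuousAt).comp h1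
  obtain ⟨B, hB⟩ : ∃ B : EuclideanSpace ℝ (Fin 4) ≃L[ℝ] EuclideanSpace ℝ (Fin 4),
      (B : _ →L[ℝ] _) = A y₀ := by
    have hinj : Function.Injective (A y₀) := by
      rw [injective_iff_map_eq_zero]
      intro v hv
      rw [happ] at hv
      ext i
      exact Fintype.linearIndependent_iff.1 (chartField_linearIndependent x₀) _ hv i
    exact ⟨(LinearEquiv.ofInjectiveEndo (A y₀ : _ →ₗ[ℝ] _) hinj).toContinuousLinearEquiv, by
      ext; simp⟩
  have hinvc : ContinuousAt (fun y => ContinuousLinearMap.inverse (A y)) y₀ := by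
    have h1 : ContinuousAt ContinuousLinearMap.inverse (A y₀) := by
      rw [← hB]; exact (contDiffAt_map_inverse (n := 0) B).continuousAt
    exact ContinuousAt.comp (f := A) (g := ContinuousLinearMap.inverse) h1 hAc
  have hinvb : ∀ᶠ y in 𝓝 y₀, ∃ B : EuclideanSpace ℝ (Fin 4) ≃L[ℝ] EuclideanSpace ℝ (Fin 4),
      (B : _ →L[ℝ] _) = A y := by
    have := hAc.eventually (hB ▸ B.nhds)
    exact this
  -- The system controls the derivative only on the frame vectors. Composing with the inverse frame
  -- matrix bounds the full derivative by `K y ‖F y‖`, and `K` is locally bounded by continuity.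
  let K : EuclideanSpace ℝ (Fin 4) → ℝ := fun y =>
    (∑ i, ‖h i (φ.symm y)‖) * ‖ContinuousLinearMap.inverse (A y)‖
  have hKc : ContinuousAt K y₀ := by
    refine ContinuousAt.mul (tendsto_finsetSum _ fun i _ => ?_) hinvc.norm
    exact (ContinuousAt.comp (f := φ.symm) (g := h i)
      ((hh i).continuous.continuousAt) hsymm).norm
  have hKb : ∀ᶠ y in 𝓝 y₀, K y < K y₀ + 1 := hKc.eventually_lt_const (by linarith)
  have hFd : ∀ᶠ y in 𝓝 y₀, DifferentiableAt ℝ F y ∧ ‖fderiv ℝ F y‖ ≤ (K y₀ + 1) * ‖F y‖ := by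
    filter_upwards [htar, hinvb, hKb] with y hy hBy hKy
    obtain ⟨By, hBy⟩ := hBy
    constructor
    · have h1 : ContMDiffAt 𝓘(ℝ, EuclideanSpace ℝ (Fin 4)) (𝓡 4) ∞ φ.symm y :=
        (contMDiffOn_extChartAt_symm (I := 𝓡 4) (n := ∞) x₀).contMDiffAt
          ((isOpen_extChartAt_target (I := 𝓡 4) x₀).mem_nhds hy)
      have h2 : ContMDiffAt 𝓘(ℝ, EuclideanSpace ℝ (Fin 4)) 𝓘(ℝ, ℂ) ∞ F y :=
        (hf (φ.symm y)).comp y h1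
      exact (h2.contDiffAt).differentiableAt (by simp)
    · have hder : ∀ i, fderiv ℝ F y (chartField x₀ (S.e i) y) = h i (φ.symm y) * F y := fun i => by
        rw [← vecDeriv_eq_fderiv_chart (hf.mdifferentiable (by simp)) x₀ (S.e i) hy]
        exact H i _
      have hcomp : ‖(fderiv ℝ F y).comp (A y)‖ ≤ (∑ i, ‖h i (φ.symm y)‖) * ‖F y‖ := by
        refine ContinuousLinearMap.opNorm_le_bound _ (by positivity) fun v => ?_
        rw [ContinuousLinearMap.comp_apply, happ, map_sum]
        refine (norm_sum_le _ _).trans ?_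
        rw [Finset.sum_mul, Finset.sum_mul]
        refine Finset.sum_le_sum fun i _ => ?_
        rw [map_smul, hder, norm_smul, norm_mul]
        have hvi : ‖v i‖ ≤ ‖v‖ := PiLp.norm_apply_le v i
        calc ‖v i‖ * (‖h i (φ.symm y)‖ * ‖F y‖) ≤ ‖v‖ * (‖h i (φ.symm y)‖ * ‖F y‖) := by gcongr
          _ = _ := by ring
      have hfd : fderiv ℝ F y = ((fderiv ℝ F y).comp (A y)).comp (ContinuousLinearMap.inverse (A y)) := by
        rw [← hBy, ContinuousLinearMap.inverse_equiv]
        ext v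
        simp
      calc ‖fderiv ℝ F y‖ ≤ ‖(fderiv ℝ F y).comp (A y)‖ * ‖ContinuousLinearMap.inverse (A y)‖ := by
            conv_lhs => rw [hfd]
            exact ContinuousLinearMap.opNorm_comp_le _ _
        _ ≤ ((∑ i, ‖h i (φ.symm y)‖) * ‖F y‖) * ‖ContinuousLinearMap.inverse (A y)‖ := by gcongr
        _ = K y * ‖F y‖ := by simp only [K]; ring
        _ ≤ (K y₀ + 1) * ‖F y‖ := by gcongr
  have hz := eventually_eq_zero_of_norm_fderiv_le hFd (show f (φ.symm y₀) = 0 by rw [hx₀, h0])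
  have hcont : ContinuousAt φ x₀ := continuousAt_extChartAt x₀
  filter_upwards [hcont.eventually hz, extChartAt_source_mem_nhds (I := 𝓡 4) x₀] with x hx hxs
  rw [hFdef, Function.comp_apply, φ.left_inv hxs] at hx
  exact hx

end SpinSpacetime
end

/-! ### The converse of Goldberg–Sachs, and the type D case. -/

noncomputable section

namespace SpinSpacetime

variable {M : Type*} [TopologicalSpace M] [ChartedSpace (EuclideanSpace ℝ (Fin 4)) M]
  [IsManifold (𝓡 4) ∞ M] {S : SpinSpacetime M} {o ι : M → Spinor}

lemma psiForm_eq_zero {lam : ℝ} (hE : ∀ x i j, S.ricci i j x = lam * minkowski i j)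
    (hd : IsSpinDyad o ι) {x : M} (h : ∀ k, S.psi o ι k x = 0) (a b c d : Spinor) :
    S.psiForm x a b c d = 0 := by
  have e : ∀ a : Spinor, a = fun B => spinProd a (ι x) * o x B + spinProd (o x) a * ι x B :=
    fun a => funext fun B => spinor_expansion (hd.normalized x) a B
  rw [e a, e b, e c, e d, psiForm_dyad hE]
  simp only [h]
  ring

lemma weylSpinor_eq_psiForm (x : M) (A B C D : Fin 2) : S.weylSpinor A B C D x =
    S.psiForm x (Pi.single A 1) (Pi.single B 1) (Pi.single C 1) (Pi.single D 1) := by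
  fin_cases A <;> fin_cases B <;> fin_cases C <;> fin_cases D <;>
    simp [psiForm, Fin.sum_univ_two]

lemma weylNonzeroAt_iff {lam : ℝ} (hE : ∀ x i j, S.ricci i j x = lam * minkowski i j)
    (hd : IsSpinDyad o ι) (x : M) : S.WeylNonzeroAt x ↔ ∃ k, S.psi o ι k x ≠ 0 := by
  constructor
  · rintro ⟨A, B, C, D, h⟩
    by_contra! hk
    exact h (by rw [weylSpinor_eq_psiForm, psiForm_eq_zero hE hd hk])
  · rintro ⟨k, hk⟩
    by_contra hW
    have h : ∀ A B C D, S.weylSpinor A B C D x = 0 := by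
      intro A B C D
      by_contra h
      exact hW ⟨A, B, C, D, h⟩
    apply hk
    fin_cases k <;> simp [psi, psiForm, h]

/-- The free index need only be tested against the basis `o`, `ι`, which gives Ψ₀ and Ψ₁. -/
lemma isRepeatedPrincipal_iff {lam : ℝ} (hE : ∀ x i j, S.ricci i j x = lam * minkowski i j)
    (hd : IsSpinDyad o ι) : S.IsRepeatedPrincipal o ↔
      ∀ x, S.psi o ι 0 x = 0 ∧ S.psi o ι 1 x = 0 := by
  have hs : ∀ (a : Spinor) (x : M), S.psiForm x a (o x) (o x) (o x) =
      ∑ A, a A * ∑ B, ∑ C, ∑ D, S.weylSpinor A B C D x * o x B * o x C * o x D := by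
    intro a x
    simp only [psiForm, Fin.sum_univ_two]
    ring
  have h1 : ∀ x, S.psiForm x (ι x) (o x) (o x) (o x) = S.psi o ι 1 x := fun x => by
    have h := psiForm_swap hE x
    rw [(h _ _ _ _).1, (h _ _ _ _).2.1, (h _ _ _ _).2.2]
    rfl
  constructor
  · intro h x
    have key : ∀ a, S.psiForm x a (o x) (o x) (o x) = 0 := fun a => by
      rw [hs]
      exact Finset.sum_eq_zero fun A _ => by rw [h x A, mul_zero]
    exact ⟨key _, by rw [← h1]; exact key _⟩
  · intro h x A
    have key : S.psiForm x (fun B => spinProd (Pi.single A 1) (ι x) * o x B +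
        spinProd (o x) (Pi.single A 1) * ι x B) (o x) (o x) (o x) = 0 := by
      rw [psiForm_comb_left, h1, (h x).2]
      have : S.psiForm x (o x) (o x) (o x) (o x) = 0 := (h x).1
      rw [this]; ring
    have e : (fun B => spinProd (Pi.single A 1) (ι x) * o x B +
        spinProd (o x) (Pi.single A 1) * ι x B) = Pi.single A 1 :=
      (funext fun B => spinor_expansion (hd.normalized x) _ B).symm
    rw [e, hs] at key
    simpa [Pi.single_apply] using key

/-- The dyad `(ι, -o)`. -/
lemma isSpinDyad_prime (hd : IsSpinDyad o ι) : IsSpinDyad ι (fun x => -o x) where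
  smooth_o := hd.smooth_ι
  smooth_ι := hd.smooth_o.neg
  normalized x := by
    have h := hd.normalized x
    simp only [spinProd, Fin.sum_univ_two, spinEps_table, Pi.neg_apply] at h ⊢
    linear_combination h

/-- Passing to the dyad `(ι, -o)` reverses the order of the Weyl scalars, so results about `o` carry
over to `ι`. -/
lemma psi_prime {lam : ℝ} (hE : ∀ x i j, S.ricci i j x = lam * minkowski i j) (x : M) :
    S.psi ι (fun x => -o x) 0 x = S.psi o ι 4 x ∧ S.psi ι (fun x => -o x) 1 x = -S.psi o ι 3 x := by
  have h := psiForm_swap hE x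
  refine ⟨rfl, ?_⟩
  have h1 : S.psi o ι 3 x = S.psiForm x (ι x) (ι x) (ι x) (o x) := by
    change S.psiForm x (o x) (ι x) (ι x) (ι x) = _
    rw [(h _ _ _ _).1, (h _ _ _ _).2.1, (h _ _ _ _).2.2]
  rw [h1]
  change S.psiForm x (ι x) (ι x) (ι x) (-o x) = _
  simp only [psiForm, Fin.sum_univ_two, Pi.neg_apply]
  ring

lemma dyadB_prime (i : Fin 4) (x : M) : S.dyadB ι i x = -S.dyadC ι i x := by
  rw [dyadB, dyadC, spinProd_swap]

lemma pair_dyadB_prime (κ ξ : M → Spinor) (x : M) :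
    pair (S.dyadB ι) κ ξ x = -pair (S.dyadC ι) κ ξ x := by
  simp only [pair, dyadB_prime, mul_neg, Finset.sum_neg_distrib]

lemma pair_neg_right (θ : Fin 4 → M → ℂ) (κ ξ : M → Spinor) (x : M) :
    pair θ κ (fun x => -ξ x) x = -pair θ κ ξ x := by
  simp only [pair, nullVec, Fin.sum_univ_two, Fin.sum_univ_four, Pi.neg_apply, map_neg]
  ring

open Filter Topology in
lemma along_eq_zero {κ ξ : M → Spinor} {f : M → ℂ} {x : M} (h : ∀ᶠ y in 𝓝 x, f y = 0) :
    S.along κ ξ f x = 0 := by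
  have : ∀ i, S.frameDeriv i f x = 0 := fun i => by
    rw [S.fd_congr i (g := fun _ => (0 : ℂ)) h, S.fd_const]
  simp only [along, this, mul_zero, Finset.sum_const_zero]

open Filter Topology in
/-- The converse of the Goldberg–Sachs theorem, where the Weyl spinor is densely nonzero. -/
lemma geodesic_shearfree_of_psi {lam : ℝ} (hE : ∀ x i j, S.ricci i j x = lam * minkowski i j)
    (hd : IsSpinDyad o ι) (hW : Dense {x | S.WeylNonzeroAt x})
    (h : ∀ x, S.psi o ι 0 x = 0 ∧ S.psi o ι 1 x = 0) {ξ : M → Spinor}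
    (hξ : ∀ B, Sm (fun y => ξ y B)) (x : M) : pair (S.dyadB o) o ξ x = 0 := by
  by_contra hx
  have hcont : Continuous (pair (S.dyadB o) o ξ) :=
    (Sm_pair (Sm_dyadB hd) (sm_component hd.smooth_o) hξ).continuous
  have hb : ∀ᶠ y in 𝓝 x, pair (S.dyadB o) o ξ y ≠ 0 := hcont.continuousAt.eventually_ne hx
  have h0 : ∀ κ ξ : M → Spinor, ∀ y, S.along κ ξ (S.psi o ι 0) y = 0 := fun κ ξ y =>
    along_eq_zero (Eventually.of_forall fun y => (h y).1)
  have h1 : ∀ κ ξ : M → Spinor, ∀ y, S.along κ ξ (S.psi o ι 1) y = 0 := fun κ ξ y =>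
    along_eq_zero (Eventually.of_forall fun y => (h y).2)
  -- Successive Bianchi identities reduce to `B(oξ̄)` times Ψ₂, then Ψ₃, then Ψ₄. Vanishing on a
  -- neighbourhood is needed so that derivatives of the earlier scalars vanish as well.
  have e2 : ∀ᶠ y in 𝓝 x, S.psi o ι 2 y = 0 := by
    filter_upwards [hb] with y hy
    have hB := (bianchi_dyad hE hd ξ y).1
    rw [(pair_dpsi o ξ y).2.1, (pair_dpsi ι ξ y).1, h0, h1, (h y).1, (h y).2] at hB
    exact (mul_eq_zero.1 (by linear_combination (-1 / 3) * hB :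
      pair (S.dyadB o) o ξ y * S.psi o ι 2 y = 0)).resolve_left hy
  have e3 : ∀ᶠ y in 𝓝 x, S.psi o ι 3 y = 0 := by
    filter_upwards [hb, e2, e2.eventually_nhds] with y hy h2 h2'
    have hB := (bianchi_dyad hE hd ξ y).2.1
    rw [(pair_dpsi o ξ y).2.2.1, (pair_dpsi ι ξ y).2.1, along_eq_zero h2', h1, (h y).1, (h y).2,
      h2] at hB
    exact (mul_eq_zero.1 (by linear_combination (-1 / 2) * hB :
      pair (S.dyadB o) o ξ y * S.psi o ι 3 y = 0)).resolve_left hy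
  have e4 : ∀ᶠ y in 𝓝 x, S.psi o ι 4 y = 0 := by
    filter_upwards [hb, e2, e2.eventually_nhds, e3, e3.eventually_nhds] with y hy h2 h2' h3 h3'
    have hB := (bianchi_dyad hE hd ξ y).2.2.1
    rw [(pair_dpsi o ξ y).2.2.2.1, (pair_dpsi ι ξ y).2.2.1, along_eq_zero h2', along_eq_zero h3',
      (h y).2, h2, h3] at hB
    exact (mul_eq_zero.1 (by linear_combination -hB :
      pair (S.dyadB o) o ξ y * S.psi o ι 4 y = 0)).resolve_left hy
  obtain ⟨V, hV, hVo, hxV⟩ := mem_nhds_iff.1 ((e2.and (e3.and e4)))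
  obtain ⟨y, hyV, hy⟩ := hW.inter_open_nonempty V hVo ⟨x, hxV⟩
  obtain ⟨k, hk⟩ := (weylNonzeroAt_iff hE hd y).1 hy
  have hz := hV hyV
  fin_cases k
  · exact hk (h y).1
  · exact hk (h y).2
  · exact hk hz.1
  · exact hk hz.2.1
  · exact hk hz.2.2

/-- Algebraically special spacetimes. -/
lemma isRepeatedPrincipal_iff_geodesic_shearfree {lam : ℝ}
    (hE : ∀ x i j, S.ricci i j x = lam * minkowski i j)
    (hd : IsSpinDyad o ι) (hW : Dense {x | S.WeylNonzeroAt x}) : S.IsRepeatedPrincipal o ↔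
      ∀ x, pair (S.dyadB o) o o x = 0 ∧ pair (S.dyadB o) o ι x = 0 := by
  rw [isRepeatedPrincipal_iff hE hd]
  constructor
  · intro h x
    exact ⟨geodesic_shearfree_of_psi hE hd hW h (sm_component hd.smooth_o) x,
      geodesic_shearfree_of_psi hE hd hW h (sm_component hd.smooth_ι) x⟩
  · intro h x
    exact psi_eq_zero_of_geodesic_shearfree hE hd (fun x => (h x).1) (fun x => (h x).2) x

lemma isRepeatedPrincipal_prime_iff {lam : ℝ}
    (hE : ∀ x i j, S.ricci i j x = lam * minkowski i j)
    (hd : IsSpinDyad o ι) (hW : Dense {x | S.WeylNonzeroAt x}) : S.IsRepeatedPrincipal ι ↔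
      ∀ x, pair (S.dyadC ι) ι o x = 0 ∧ pair (S.dyadC ι) ι ι x = 0 := by
  rw [isRepeatedPrincipal_iff_geodesic_shearfree hE (isSpinDyad_prime hd) hW]
  simp only [pair_dyadB_prime, pair_neg_right, neg_neg, neg_eq_zero]
  exact forall_congr' fun x => and_comm

/-- The derivative of `Ψ₂` in a spacetime of type D. -/
lemma frameDeriv_psi_two {lam : ℝ} (hE : ∀ x i j, S.ricci i j x = lam * minkowski i j)
    (hd : IsSpinDyad o ι) (h : ∀ x, S.psi o ι 0 x = 0 ∧ S.psi o ι 1 x = 0)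
    (h' : ∀ x, S.psi o ι 3 x = 0 ∧ S.psi o ι 4 x = 0) (ξ : M → Spinor) (x : M) :
    S.along o ξ (S.psi o ι 2) x = -3 * pair (S.dyadB o) ι ξ x * S.psi o ι 2 x ∧
    S.along ι ξ (S.psi o ι 2) x = -3 * pair (S.dyadC ι) o ξ x * S.psi o ι 2 x := by
  have h1 : ∀ κ ξ : M → Spinor, S.along κ ξ (S.psi o ι 1) x = 0 := fun κ ξ =>
    along_eq_zero (Filter.Eventually.of_forall fun y => (h y).2)
  have h3 : ∀ κ ξ : M → Spinor, S.along κ ξ (S.psi o ι 3) x = 0 := fun κ ξ =>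
    along_eq_zero (Filter.Eventually.of_forall fun y => (h' y).1)
  have hB := bianchi_dyad hE hd ξ x
  rw [(pair_dpsi o ξ x).2.2.1, (pair_dpsi o ξ x).2.2.2.1, (pair_dpsi ι ξ x).2.1,
    (pair_dpsi ι ξ x).2.2.1, h1, h3, (h x).1, (h x).2, (h' x).1, (h' x).2] at hB
  exact ⟨by linear_combination hB.2.1, by linear_combination -hB.2.2.1⟩

/-- The identity matrix splits along the null tetrad because `ι_A o_B - o_A ι_B` is a multiple of ε,
for both unprimed and primed indices. -/
lemma completeness {o ι : Spinor} (h : spinProd o ι = 1) (i j : Fin 4) :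
    lower (nullVec ι ι) i * nullVec o o j + lower (nullVec o o) i * nullVec ι ι j -
      lower (nullVec ι o) i * nullVec o ι j - lower (nullVec o ι) i * nullVec ι o j =
      if i = j then 1 else 0 := by
  have h' := congrArg conj h
  have e : ∀ A B, ι A * o B - o A * ι B = -spinEps A B := by
    simp only [spinProd, Fin.sum_univ_two, spinEps_table] at h
    intro A B
    fin_cases A <;> fin_cases B <;> simp only [Fin.zero_eta, Fin.mk_one, spinEps_table]
    · ring
    · linear_combination -h
    · linear_combination h
    · ring
  have e' : ∀ A B, conj (ι A) * conj (o B) - conj (o A) * conj (ι B) = -conj (spinEps A B) :=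
    fun A B => by simpa using congrArg conj (e A B)
  have key : lower (nullVec ι ι) i * nullVec o o j + lower (nullVec o o) i * nullVec ι ι j -
      lower (nullVec ι o) i * nullVec o ι j - lower (nullVec o ι) i * nullVec ι o j =
      (minkowskiSign i : ℂ) * ∑ A, ∑ A', ∑ B, ∑ B', infeldInv i A A' * infeldInv j B B' *
        ((ι A * o B - o A * ι B) * (conj (ι A') * conj (o B') - conj (o A') * conj (ι B'))) := by
    simp only [lower, nullVec, Fin.sum_univ_two]
    ring
  rw [key]
  simp only [e, e', Fin.sum_univ_two, spinEps_table, map_zero, map_one, map_neg]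
  fin_cases i <;> fin_cases j <;>
  · simp only [Fin.zero_eta, Fin.mk_one, Fin.isValue, Fin.reduceFinMk, infeldInv_table,
      minkowskiSign_table]
    push_cast
    ring_nf
    try simp only [Complex.I_sq, invSqrtTwo_sq]
    try norm_num
    try decide

lemma form_expansion (hd : IsSpinDyad o ι) (θ : Fin 4 → M → ℂ) (i : Fin 4) (x : M) :
    θ i x = lower (nullVec (ι x) (ι x)) i * pair θ o o x +
      lower (nullVec (o x) (o x)) i * pair θ ι ι x -
      lower (nullVec (ι x) (o x)) i * pair θ o ι x - lower (nullVec (o x) (ι x)) i * pair θ ι o x := by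
  have h := completeness (hd.normalized x) i
  have e : θ i x = ∑ j, (if i = j then 1 else 0) * θ j x := by simp
  rw [e]
  simp only [← h, pair, Fin.sum_univ_four]
  ring

lemma Sm_lower {f : Fin 4 → M → ℂ} (hf : ∀ i, Sm (f i)) (i : Fin 4) :
    Sm (fun x => lower (fun j => f j x) i) := by
  unfold lower
  fun_prop

/-- All four tetrad derivatives of Ψ₂ are smooth multiples of Ψ₂, so a zero would spread to an open
set on which all Weyl scalars vanish, against density. -/
lemma psi_two_ne_zero {lam : ℝ} (hE : ∀ x i j, S.ricci i j x = lam * minkowski i j)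
    (hd : IsSpinDyad o ι) (hW : Dense {x | S.WeylNonzeroAt x})
    (h : ∀ x, S.psi o ι 0 x = 0 ∧ S.psi o ι 1 x = 0)
    (h' : ∀ x, S.psi o ι 3 x = 0 ∧ S.psi o ι 4 x = 0) (x : M) : S.psi o ι 2 x ≠ 0 := by
  intro hx
  have ho := sm_component hd.smooth_o
  have hi := sm_component hd.smooth_ι
  let b := pair (S.dyadB o)
  let c := pair (S.dyadC ι)
  have hbs : ∀ {κ ξ : M → Spinor}, (∀ B, Sm (fun y => κ y B)) → (∀ B, Sm (fun y => ξ y B)) →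
      Sm (b κ ξ) := fun h1 h2 => Sm_pair (Sm_dyadB hd) h1 h2
  have hcs : ∀ {κ ξ : M → Spinor}, (∀ B, Sm (fun y => κ y B)) → (∀ B, Sm (fun y => ξ y B)) →
      Sm (c κ ξ) := fun h1 h2 => Sm_pair (Sm_dyadC hd) h1 h2
  let H : Fin 4 → M → ℂ := fun i y => -3 * (lower (nullVec (ι y) (ι y)) i * b ι o y +
    lower (nullVec (o y) (o y)) i * c o ι y - lower (nullVec (ι y) (o y)) i * b ι ι y -
    lower (nullVec (o y) (ι y)) i * c o o y)
  have hH : ∀ i, Sm (H i) := by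
    intro i
    have h1 := hbs hi ho
    have h2 := hcs ho hi
    have h3 := hbs hi hi
    have h4 := hcs ho ho
    have l1 := Sm_lower (Sm_nullVec hi hi) i
    have l2 := Sm_lower (Sm_nullVec ho ho) i
    have l3 := Sm_lower (Sm_nullVec hi ho) i
    have l4 := Sm_lower (Sm_nullVec ho hi) i
    exact (Sm.const _).mul ((((l1.mul h1).add (l2.mul h2)).sub (l3.mul h3)).sub (l4.mul h4))
  have hz := eventually_eq_zero_of_frameDeriv (S := S) (Sm_psi hd 2) hH (fun i y => by
    have e := form_expansion hd (fun i => S.frameDeriv i (S.psi o ι 2)) i y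
    have f1 := frameDeriv_psi_two hE hd h h' o y
    have f2 := frameDeriv_psi_two hE hd h h' ι y
    have hal : ∀ κ ξ : M → Spinor, pair (fun j => S.frameDeriv j (S.psi o ι 2)) κ ξ y =
      S.along κ ξ (S.psi o ι 2) y := fun _ _ => rfl
    rw [hal, hal, hal, hal, f1.1, f1.2, f2.1, f2.2] at e
    rw [e]
    simp only [H, b, c]
    ring) hx
  obtain ⟨V, hV, hVo, hxV⟩ := mem_nhds_iff.1 hz
  obtain ⟨y, hyV, hy⟩ := hW.inter_open_nonempty V hVo ⟨x, hxV⟩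
  obtain ⟨k, hk⟩ := (weylNonzeroAt_iff hE hd y).1 hy
  fin_cases k
  · exact hk (h y).1
  · exact hk (h y).2
  · exact hk (hV hyV)
  · exact hk (h' y).1
  · exact hk (h' y).2

lemma isRepeatedPrincipal_prime_iff_psi {lam : ℝ}
    (hE : ∀ x i j, S.ricci i j x = lam * minkowski i j) (hd : IsSpinDyad o ι) :
    S.IsRepeatedPrincipal ι ↔ ∀ x, S.psi o ι 3 x = 0 ∧ S.psi o ι 4 x = 0 := by
  rw [isRepeatedPrincipal_iff hE (isSpinDyad_prime hd)]
  refine forall_congr' fun x => ?_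
  rw [(psi_prime hE x).1, (psi_prime hE x).2, neg_eq_zero, and_comm]

/-- Spacetimes of type D. -/
lemma isTypeD_iff {lam : ℝ} (hE : ∀ x i j, S.ricci i j x = lam * minkowski i j)
    (hd : IsSpinDyad o ι) (hW : Dense {x | S.WeylNonzeroAt x}) : S.IsTypeD o ι ↔
      (∀ x, pair (S.dyadB o) o o x = 0 ∧ pair (S.dyadB o) o ι x = 0) ∧
      (∀ x, pair (S.dyadC ι) ι o x = 0 ∧ pair (S.dyadC ι) ι ι x = 0) := by
  rw [← isRepeatedPrincipal_iff_geodesic_shearfree hE hd hW, ← isRepeatedPrincipal_prime_iff hE hd hW]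
  refine ⟨fun h => h.2, fun h => ⟨fun x => ?_, h⟩⟩
  exact (weylNonzeroAt_iff hE hd x).2 ⟨2, psi_two_ne_zero hE hd hW
    ((isRepeatedPrincipal_iff hE hd).1 h.1) ((isRepeatedPrincipal_prime_iff_psi hE hd).1 h.2) x⟩

end SpinSpacetime
end

/-! ### The almost-complex structure and its Weyl form in a dyad. -/

noncomputable section

lemma sum_lower_nullVec (κ ξ η ζ : Spinor) :
    ∑ b, lower (nullVec κ ξ) b * nullVec η ζ b = spinProd κ η * conj (spinProd ξ ζ) := by
  have e : ∀ A A' B B', ∑ b, (minkowskiSign b : ℂ) * infeldInv b A A' * infeldInv b B B' =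
      spinEps A B * spinEps A' B' := by
    intro A A' B B'
    fin_cases A <;> fin_cases A' <;> fin_cases B <;> fin_cases B' <;>
    · simp only [Fin.zero_eta, Fin.mk_one, Fin.isValue, Fin.sum_univ_four, infeldInv_table,
        minkowskiSign_table, spinEps_table]
      push_cast
      ring_nf
      try simp only [Complex.I_sq, invSqrtTwo_sq]
      try norm_num
  have h : ∑ b, lower (nullVec κ ξ) b * nullVec η ζ b = ∑ A, ∑ A', ∑ B, ∑ B',
      κ A * conj (ξ A') * η B * conj (ζ B') *
        ∑ b, (minkowskiSign b : ℂ) * infeldInv b A A' * infeldInv b B B' := by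
    simp only [lower, nullVec, Fin.sum_univ_two, Fin.sum_univ_four]
    ring
  rw [h]
  simp only [e, spinProd, Fin.sum_univ_two, spinEps_table, map_add, map_mul, map_neg, map_zero,
    map_one]
  ring

namespace SpinSpacetime

variable {M : Type*} [TopologicalSpace M] [ChartedSpace (EuclideanSpace ℝ (Fin 4)) M]
  [IsManifold (𝓡 4) ∞ M] {S : SpinSpacetime M} {o ι : M → Spinor}

lemma nablaVec_nullVec {κ ξ : M → Spinor} (hκ : ∀ B, Sm (fun y => κ y B))
    (hξ : ∀ B, Sm (fun y => ξ y B)) (x : M) (i j : Fin 4) :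
    S.nablaVec (fun y => nullVec (κ y) (ξ y)) x i j =
      nullVec (S.nablaSpin κ x i) (ξ x) j + nullVec (κ x) (S.nablaSpin ξ x i) j := by
  rw [nablaVec, fd_nullVec hκ hξ]
  ring

lemma fd_lower {X : M → Fin 4 → ℂ} (hX : ∀ j, Sm (fun y => X y j)) (x : M) (i j : Fin 4) :
    S.frameDeriv i (fun y => lower (X y) j) x =
      lower (S.nablaVec X x i) j + ∑ m, (S.christoffel i j m x : ℂ) * lower (X x) m := by
  have ha := S.isLorentzAlg_christoffel i x
  have h : ∀ m, (minkowskiSign j : ℂ) * (S.christoffel i m j x : ℂ) =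
      -((minkowskiSign m : ℂ) * (S.christoffel i j m x : ℂ)) := fun m => by
    have := ha m j
    exact_mod_cast this
  have h2 : S.frameDeriv i (fun y => lower (X y) j) x =
      (minkowskiSign j : ℂ) * S.frameDeriv i (fun y => X y j) x := S.fd_const_mul i _ (hX j) x
  have h3 : lower (S.nablaVec X x i) j = (minkowskiSign j : ℂ) * S.frameDeriv i (fun y => X y j) x +
      ∑ m, (minkowskiSign j : ℂ) * (S.christoffel i m j x : ℂ) * X x m := by
    rw [lower, nablaVec, mul_add, Finset.mul_sum]
    simp only [mul_assoc]
  rw [h2, h3, add_assoc, ← Finset.sum_add_distrib]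
  simp only [h, lower]
  rw [Finset.sum_eq_zero, add_zero]
  intro m _
  ring

lemma nablaEnd_mul {X Y : M → Fin 4 → ℂ} (hX : ∀ j, Sm (fun y => X y j))
    (hY : ∀ j, Sm (fun y => Y y j)) (x : M) (i j k : Fin 4) :
    S.nablaEnd (fun y j k => lower (X y) j * Y y k) x i j k =
      lower (S.nablaVec X x i) j * Y x k + lower (X x) j * S.nablaVec Y x i k := by
  have h1 : Sm (fun y => lower (X y) j) := (Sm.const _).mul (hX j)
  rw [nablaEnd, S.fd_mul i h1 (hY k), fd_lower hX, nablaVec]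
  simp only [Fin.sum_univ_four]
  ring

lemma nablaEnd_comb {J₁ J₂ J₃ J₄ : M → Fin 4 → Fin 4 → ℂ} (c : ℂ) (h₁ : ∀ j k, Sm (fun y => J₁ y j k))
    (h₂ : ∀ j k, Sm (fun y => J₂ y j k)) (h₃ : ∀ j k, Sm (fun y => J₃ y j k))
    (h₄ : ∀ j k, Sm (fun y => J₄ y j k)) (x : M) (i j k : Fin 4) :
    S.nablaEnd (fun y j k => c * (J₁ y j k - J₂ y j k + J₃ y j k - J₄ y j k)) x i j k =
      c * (S.nablaEnd J₁ x i j k - S.nablaEnd J₂ x i j k + S.nablaEnd J₃ x i j k -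
        S.nablaEnd J₄ x i j k) := by
  rw [nablaEnd, S.fd_const_mul i c ((((h₁ j k).sub (h₂ j k)).add (h₃ j k)).sub (h₄ j k)),
    S.fd_sub i (((h₁ j k).sub (h₂ j k)).add (h₃ j k)) (h₄ j k),
    S.fd_add i ((h₁ j k).sub (h₂ j k)) (h₃ j k), S.fd_sub i (h₁ j k) (h₂ j k)]
  simp only [nablaEnd, Fin.sum_univ_four]
  ring

/-- The covariant derivatives of the null tetrad of a dyad. -/
lemma nablaVec_dyad (hd : IsSpinDyad o ι) (x : M) (i : Fin 4) :
    (∀ j, S.nablaVec (fun y => nullVec (o y) (o y)) x i j =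
      (S.dyadA o ι i x + conj (S.dyadA o ι i x)) * nullVec (o x) (o x) j +
      S.dyadB o i x * nullVec (ι x) (o x) j + conj (S.dyadB o i x) * nullVec (o x) (ι x) j) ∧
    (∀ j, S.nablaVec (fun y => nullVec (ι y) (ι y)) x i j =
      -(S.dyadA o ι i x + conj (S.dyadA o ι i x)) * nullVec (ι x) (ι x) j +
      S.dyadC ι i x * nullVec (o x) (ι x) j + conj (S.dyadC ι i x) * nullVec (ι x) (o x) j) ∧
    (∀ j, S.nablaVec (fun y => nullVec (o y) (ι y)) x i j =
      (S.dyadA o ι i x - conj (S.dyadA o ι i x)) * nullVec (o x) (ι x) j +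
      S.dyadB o i x * nullVec (ι x) (ι x) j + conj (S.dyadC ι i x) * nullVec (o x) (o x) j) ∧
    (∀ j, S.nablaVec (fun y => nullVec (ι y) (o y)) x i j =
      (conj (S.dyadA o ι i x) - S.dyadA o ι i x) * nullVec (ι x) (o x) j +
      conj (S.dyadB o i x) * nullVec (ι x) (ι x) j + S.dyadC ι i x * nullVec (o x) (o x) j) := by
  have so := sm_component hd.smooth_o
  have si := sm_component hd.smooth_ι
  refine ⟨fun j => ?_, fun j => ?_, fun j => ?_, fun j => ?_⟩ <;>
  · rw [nablaVec_nullVec (by assumption) (by assumption)]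
    simp only [nablaSpin_o hd, nablaSpin_ι hd, nullVec_left, nullVec_right, map_neg]
    ring

/-- The covariant derivative of the almost-complex structure. -/
lemma nablaEnd_acs (hd : IsSpinDyad o ι) (x : M) (i a b : Fin 4) :
    S.nablaEnd (acs o ι) x i a b = 2 * Complex.I *
      (S.dyadB o i x * (lower (nullVec (ι x) (o x)) a * nullVec (ι x) (ι x) b -
        lower (nullVec (ι x) (ι x)) a * nullVec (ι x) (o x) b) +
      S.dyadC ι i x * (lower (nullVec (o x) (o x)) a * nullVec (o x) (ι x) b -
        lower (nullVec (o x) (ι x)) a * nullVec (o x) (o x) b)) := by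
  have so := sm_component hd.smooth_o
  have si := sm_component hd.smooth_ι
  have sl := Sm_nullVec so so
  have sn := Sm_nullVec si si
  have sm := Sm_nullVec so si
  have sm' := Sm_nullVec si so
  have sp : ∀ {X Y : M → Fin 4 → ℂ}, (∀ j, Sm (fun y => X y j)) → (∀ j, Sm (fun y => Y y j)) →
      ∀ j k, Sm (fun y => lower (X y) j * Y y k) := fun hX hY j k =>
    ((Sm.const _).mul (hX j)).mul (hY k)
  have h := nablaEnd_comb (S := S) Complex.I (sp sl sn) (sp sn sl) (sp sm' sm) (sp sm sm') x i a b
  refine h.trans ?_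
  rw [nablaEnd_mul sl sn, nablaEnd_mul sn sl, nablaEnd_mul sm' sm, nablaEnd_mul sm sm']
  -- The terms in `A` cancel since `J` is invariant under GHP rescalings, and the conjugate terms
  -- cancel since `J` acts on the unprimed index only.
  obtain ⟨h1, h2, h3, h4⟩ := nablaVec_dyad (S := S) hd x i
  simp only [lower, h1, h2, h3, h4]
  ring

/-- `J` acts on the unprimed spinor index alone, with eigenvalue -i on `o` and i on `ι`, whatever
the primed factor. -/
lemma sum_acs_nullVec (hd : IsSpinDyad o ι) (x : M) (ξ : Spinor) (c : Fin 4) :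
    ∑ b, acs o ι x b c * nullVec (o x) ξ b = -Complex.I * nullVec (o x) ξ c ∧
    ∑ b, acs o ι x b c * nullVec (ι x) ξ b = Complex.I * nullVec (ι x) ξ c := by
  have hn := hd.normalized x
  have hn' : spinProd (ι x) (o x) = -1 := by rw [spinProd_swap, hn]
  have key : ∀ η : Spinor, ∑ b, acs o ι x b c * nullVec η ξ b = Complex.I *
      ((∑ b, lower (nullVec (o x) (o x)) b * nullVec η ξ b) * nullVec (ι x) (ι x) c
      - (∑ b, lower (nullVec (ι x) (ι x)) b * nullVec η ξ b) * nullVec (o x) (o x) c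
      + (∑ b, lower (nullVec (ι x) (o x)) b * nullVec η ξ b) * nullVec (o x) (ι x) c
      - (∑ b, lower (nullVec (o x) (ι x)) b * nullVec η ξ b) * nullVec (ι x) (o x) c) := by
    intro η
    simp only [acs, Fin.sum_univ_four]
    ring
  have hξ : ξ = fun B => spinProd ξ (ι x) * o x B + spinProd (o x) ξ * ι x B :=
    funext fun B => spinor_expansion hn ξ B
  have hξ' : ∀ η, nullVec η ξ c = conj (spinProd ξ (ι x)) * nullVec η (o x) c +
      conj (spinProd (o x) ξ) * nullVec η (ι x) c := fun η => by
    conv_lhs => rw [hξ]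
    rw [nullVec_right]
  constructor
  · rw [key, hξ']
    simp only [sum_lower_nullVec, spinProd_self, hn']
    rw [spinProd_swap ξ (ι x), map_neg]
    ring
  · rw [key, hξ']
    simp only [sum_lower_nullVec, spinProd_self, hn]
    rw [spinProd_swap ξ (ι x), map_neg]
    ring

/-- The 1-form of the preferred Weyl connection in a dyad. -/
lemma weylForm_eq (hd : IsSpinDyad o ι) (x : M) (a : Fin 4) :
    S.weylForm o ι x a = lower (nullVec (ι x) (o x)) a * pair (S.dyadB o) ι ι x -
      lower (nullVec (ι x) (ι x)) a * pair (S.dyadB o) ι o x -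
      lower (nullVec (o x) (o x)) a * pair (S.dyadC ι) o ι x +
      lower (nullVec (o x) (ι x)) a * pair (S.dyadC ι) o o x := by
  have ho := fun ξ c => (sum_acs_nullVec hd x ξ c).1
  have hi := fun ξ c => (sum_acs_nullVec hd x ξ c).2
  have h : S.weylForm o ι x a = -Complex.I * ∑ c, (
      S.dyadB o c x * (lower (nullVec (ι x) (o x)) a * (∑ b, acs o ι x b c * nullVec (ι x) (ι x) b) -
        lower (nullVec (ι x) (ι x)) a * (∑ b, acs o ι x b c * nullVec (ι x) (o x) b)) +
      S.dyadC ι c x * (lower (nullVec (o x) (o x)) a * (∑ b, acs o ι x b c * nullVec (o x) (ι x) b) -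
        lower (nullVec (o x) (ι x)) a * (∑ b, acs o ι x b c * nullVec (o x) (o x) b))) := by
    rw [weylForm, Finset.sum_comm, Finset.mul_sum, Finset.mul_sum]
    refine Finset.sum_congr rfl fun c _ => ?_
    simp only [nablaEnd_acs hd, Fin.sum_univ_four]
    ring
  rw [h]
  simp only [ho, hi, pair, Fin.sum_univ_four]
  ring_nf
  simp only [Complex.I_sq]
  ring

end SpinSpacetime
end

/-! ### The conformal GHP derivatives of the dyad spinors. -/

noncomputable section

lemma sum_infeld_mul (η ξ : Spinor) (B : Fin 2) (G : Fin 2 → ℂ) :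
    ∑ a, nullVec η ξ a * ∑ A', infeld a B A' * G A' = η B * ∑ A', conj (ξ A') * G A' := by
  have h := sum_nullVec_infeld η ξ B
  have e : ∑ a, nullVec η ξ a * ∑ A', infeld a B A' * G A' =
      ∑ A', (∑ a, nullVec η ξ a * infeld a B A') * G A' := by
    simp only [Fin.sum_univ_two, Fin.sum_univ_four]
    ring
  rw [e]
  simp only [h, Fin.sum_univ_two]
  ring

namespace SpinSpacetime

variable {M : Type*} [TopologicalSpace M] [ChartedSpace (EuclideanSpace ℝ (Fin 4)) M]
  [IsManifold (𝓡 4) ∞ M] {S : SpinSpacetime M} {o ι : M → Spinor}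

/-- The Weyl 1-form on the null vectors of the dyad. -/
lemma pair_weylForm (hd : IsSpinDyad o ι) (x : M) :
    (∑ a, nullVec (o x) (o x) a * S.weylForm o ι x a = -pair (S.dyadB o) ι o x) ∧
    (∑ a, nullVec (o x) (ι x) a * S.weylForm o ι x a = -pair (S.dyadB o) ι ι x) ∧
    (∑ a, nullVec (ι x) (o x) a * S.weylForm o ι x a = -pair (S.dyadC ι) o o x) ∧
    (∑ a, nullVec (ι x) (ι x) a * S.weylForm o ι x a = -pair (S.dyadC ι) o ι x) := by
  have hn := hd.normalized x
  have hn' : spinProd (ι x) (o x) = -1 := by rw [spinProd_swap, hn]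
  have key : ∀ η ξ : Spinor, ∑ a, nullVec η ξ a * S.weylForm o ι x a =
      (∑ a, lower (nullVec (ι x) (o x)) a * nullVec η ξ a) * pair (S.dyadB o) ι ι x -
      (∑ a, lower (nullVec (ι x) (ι x)) a * nullVec η ξ a) * pair (S.dyadB o) ι o x -
      (∑ a, lower (nullVec (o x) (o x)) a * nullVec η ξ a) * pair (S.dyadC ι) o ι x +
      (∑ a, lower (nullVec (o x) (ι x)) a * nullVec η ξ a) * pair (S.dyadC ι) o o x := by
    intro η ξ
    simp only [weylForm_eq hd, Fin.sum_univ_four]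
    ring
  simp only [key, sum_lower_nullVec, spinProd_self, hn, hn', map_neg, map_one, map_zero]
  refine ⟨?_, ?_, ?_, ?_⟩ <;> ring

lemma sum_lower_weylVec (ζ : Fin 4 → ℂ) (v : M → Fin 4 → ℂ) (x : M) (a : Fin 4) :
    ∑ b, lower ζ b * S.weylVec o ι v x a b = ∑ b, lower ζ b * S.nablaVec v x a b +
      S.weylForm o ι x a * ∑ b, lower ζ b * v x b +
      lower ζ a * (∑ c, v x c * S.weylForm o ι x c) -
      (∑ c, ζ c * S.weylForm o ι x c) * lower (v x) a := by
  have hs : ∀ b, (minkowskiSign b : ℂ) * (minkowskiSign b : ℂ) = 1 := fun b => by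
    exact_mod_cast minkowskiSign_sq b
  have e : ∀ b, lower ζ b * S.weylVec o ι v x a b = lower ζ b * S.nablaVec v x a b +
      S.weylForm o ι x a * (lower ζ b * v x b) +
      (if b = a then lower ζ b else 0) * (∑ c, v x c * S.weylForm o ι x c) -
      ζ b * S.weylForm o ι x b * lower (v x) a := by
    intro b
    have h1 : ∑ c, (S.weylForm o ι x a * (if b = c then 1 else 0) +
        S.weylForm o ι x c * (if b = a then 1 else 0)
        - (minkowskiSign b : ℂ) * S.weylForm o ι x b * (minkowski a c : ℂ)) * v x c =
        S.weylForm o ι x a * v x b + (if b = a then 1 else 0) * (∑ c, v x c * S.weylForm o ι x c) -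
        (minkowskiSign b : ℂ) * S.weylForm o ι x b * lower (v x) a := by
      simp only [sub_mul, add_mul, Finset.sum_sub_distrib, Finset.sum_add_distrib]
      congr 1
      · congr 1
        · simp [mul_ite]
        · rw [Finset.mul_sum]
          exact Finset.sum_congr rfl fun c _ => by ring
      · simp only [mul_assoc, ← Finset.mul_sum]
        congr 2
        rw [Finset.sum_eq_single a (fun c _ hc => by simp [minkowski, hc.symm]) (by simp)]
        simp [minkowski, lower]
    rw [weylVec, h1]
    simp only [lower]
    split_ifs with hba
    · linear_combination (-ζ b * S.weylForm o ι x b * (minkowskiSign a * v x a)) * hs b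
    · linear_combination (-ζ b * S.weylForm o ι x b * (minkowskiSign a * v x a)) * hs b
  simp only [e, Finset.sum_sub_distrib, Finset.sum_add_distrib, ← Finset.mul_sum, ← Finset.sum_mul,
    Finset.sum_ite_eq', Finset.mem_univ, if_true]

/-- The connection forms on densities with the weights of `o` and of `ι`. -/
lemma densityForm_eq (hd : IsSpinDyad o ι) {w₀ w₁ : ℝ} (hw : w₀ + w₁ + 1 = 0) (x : M) (a : Fin 4) :
    S.densityForm w₀ w₁ o ι w₀ 1 0 x a = -S.dyadA o ι a x +
      lower (nullVec (ι x) (ι x)) a * pair (S.dyadB o) ι o x -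
      lower (nullVec (ι x) (o x)) a * pair (S.dyadB o) ι ι x ∧
    S.densityForm w₀ w₁ o ι w₁ (-1) 0 x a = S.dyadA o ι a x +
      lower (nullVec (o x) (o x)) a * pair (S.dyadC ι) o ι x -
      lower (nullVec (o x) (ι x)) a * pair (S.dyadC ι) o o x := by
  have hn := hd.normalized x
  have hn' : spinProd (ι x) (o x) = -1 := by rw [spinProd_swap, hn]
  -- The weights enter only through their sum -1: after this substitution `w₀` drops out of both
  -- forms.
  have hw1 : (w₁ : ℂ) = -1 - w₀ := by
    have : w₁ = -1 - w₀ := by linarith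
    rw [this]; push_cast; ring
  obtain ⟨f1, f2, f3, f4⟩ := pair_weylForm (S := S) hd x
  obtain ⟨h1, h2, h3, h4⟩ := nablaVec_dyad (S := S) hd x a
  have dist : ∀ (ζ u v w : Fin 4 → ℂ) (p q r : ℂ), ∑ b, lower ζ b * (p * u b + q * v b + r * w b) =
      p * (∑ b, lower ζ b * u b) + q * (∑ b, lower ζ b * v b) + r * ∑ b, lower ζ b * w b := by
    intro ζ u v w p q r
    simp only [Fin.sum_univ_four]
    ring
  simp only [densityForm, boostForm, spinForm, sum_lower_weylVec, f1, f2, f3, f4, h1, h2, h3, h4,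
    dist, sum_lower_nullVec, spinProd_self, hn, hn', hw1, map_neg, map_one, map_zero]
  rw [weylForm_eq hd]
  push_cast
  constructor <;> ring

/-- Contracting `f_{A'C} κ^C ε_A{}^B` with `η^A ξ̄^{A'}` moves `κ` into the argument of `f` and
leaves `η` as the spinor. -/
lemma sum_weylSpin (κ : M → Spinor) (x : M) (η ξ : Spinor) (B : Fin 2) :
    ∑ a, nullVec η ξ a * S.weylSpin o ι κ x a B = ∑ a, nullVec η ξ a * S.nablaSpin κ x a B +
      η B * ∑ a, nullVec (κ x) ξ a * S.weylForm o ι x a := by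
  have h := sum_infeld_mul η ξ B (fun A' => ∑ C, (∑ j, S.weylForm o ι x j * infeldInv j C A') * κ x C)
  have e : ∑ a, nullVec (κ x) ξ a * S.weylForm o ι x a =
      ∑ A', conj (ξ A') * ∑ C, (∑ j, S.weylForm o ι x j * infeldInv j C A') * κ x C := by
    simp only [nullVec, Fin.sum_univ_two, Fin.sum_univ_four]
    ring
  rw [e, ← h, ← Finset.sum_add_distrib]
  refine Finset.sum_congr rfl fun a _ => ?_
  rw [weylSpin, mul_add]
  congr 2
  refine Finset.sum_congr rfl fun A' _ => ?_
  rw [Finset.mul_sum]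
  exact Finset.sum_congr rfl fun C _ => by ring

lemma eq_zero_of_pair (hd : IsSpinDyad o ι) (x : M) (θ : Fin 4 → ℂ)
    (h1 : ∑ a, nullVec (o x) (o x) a * θ a = 0) (h2 : ∑ a, nullVec (o x) (ι x) a * θ a = 0)
    (h3 : ∑ a, nullVec (ι x) (o x) a * θ a = 0) (h4 : ∑ a, nullVec (ι x) (ι x) a * θ a = 0)
    (a : Fin 4) : θ a = 0 := by
  have h := form_expansion hd (fun i _ => θ i) a x
  simp only [pair, h1, h2, h3, h4] at h
  rw [h]
  ring

/-- The contractions of `𝒞 o` and `𝒞 ι` with the null vectors of the dyad. -/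
lemma sum_confGHP (hd : IsSpinDyad o ι) {w₀ w₁ : ℝ} (hw : w₀ + w₁ + 1 = 0) (x : M) (B : Fin 2) :
    ((∑ a, nullVec (o x) (o x) a * S.confGHP w₀ w₁ o ι w₀ 1 0 o x a B =
      pair (S.dyadB o) o o x * ι x B) ∧
    (∑ a, nullVec (o x) (ι x) a * S.confGHP w₀ w₁ o ι w₀ 1 0 o x a B =
      pair (S.dyadB o) o ι x * ι x B) ∧
    (∑ a, nullVec (ι x) (o x) a * S.confGHP w₀ w₁ o ι w₀ 1 0 o x a B = 0) ∧
    (∑ a, nullVec (ι x) (ι x) a * S.confGHP w₀ w₁ o ι w₀ 1 0 o x a B = 0)) ∧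
    ((∑ a, nullVec (o x) (o x) a * S.confGHP w₀ w₁ o ι w₁ (-1) 0 ι x a B = 0) ∧
    (∑ a, nullVec (o x) (ι x) a * S.confGHP w₀ w₁ o ι w₁ (-1) 0 ι x a B = 0) ∧
    (∑ a, nullVec (ι x) (o x) a * S.confGHP w₀ w₁ o ι w₁ (-1) 0 ι x a B =
      pair (S.dyadC ι) ι o x * o x B) ∧
    (∑ a, nullVec (ι x) (ι x) a * S.confGHP w₀ w₁ o ι w₁ (-1) 0 ι x a B =
      pair (S.dyadC ι) ι ι x * o x B)) := by
  have hn := hd.normalized x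
  have hn' : spinProd (ι x) (o x) = -1 := by rw [spinProd_swap, hn]
  obtain ⟨f1, f2, f3, f4⟩ := pair_weylForm (S := S) hd x
  have hsplit : ∀ (w : ℝ) (p : ℤ) (κ : M → Spinor) (η ξ : Spinor),
      ∑ a, nullVec η ξ a * S.confGHP w₀ w₁ o ι w p 0 κ x a B =
      ∑ a, nullVec η ξ a * S.nablaSpin κ x a B + η B * (∑ a, nullVec (κ x) ξ a * S.weylForm o ι x a) +
        (∑ a, nullVec η ξ a * S.densityForm w₀ w₁ o ι w p 0 x a) * κ x B := by
    intro w p κ η ξ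
    rw [← sum_weylSpin, Finset.sum_mul, ← Finset.sum_add_distrib]
    exact Finset.sum_congr rfl fun a _ => by rw [confGHP]; ring
  have d0 : ∀ η ξ : M → Spinor, ∑ a, nullVec (η x) (ξ x) a * S.densityForm w₀ w₁ o ι w₀ 1 0 x a =
      -pair (S.dyadA o ι) η ξ x + (∑ a, lower (nullVec (ι x) (ι x)) a * nullVec (η x) (ξ x) a) *
        pair (S.dyadB o) ι o x - (∑ a, lower (nullVec (ι x) (o x)) a * nullVec (η x) (ξ x) a) *
        pair (S.dyadB o) ι ι x := by
    intro η ξ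
    simp only [(densityForm_eq hd hw x _).1]
    have hp : pair (S.dyadA o ι) η ξ x = ∑ a, nullVec (η x) (ξ x) a * S.dyadA o ι a x := rfl
    rw [hp]
    simp only [Fin.sum_univ_four]
    ring
  have d1 : ∀ η ξ : M → Spinor, ∑ a, nullVec (η x) (ξ x) a * S.densityForm w₀ w₁ o ι w₁ (-1) 0 x a =
      pair (S.dyadA o ι) η ξ x + (∑ a, lower (nullVec (o x) (o x)) a * nullVec (η x) (ξ x) a) *
        pair (S.dyadC ι) o ι x - (∑ a, lower (nullVec (o x) (ι x)) a * nullVec (η x) (ξ x) a) *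
        pair (S.dyadC ι) o o x := by
    intro η ξ
    simp only [(densityForm_eq hd hw x _).2]
    have hp : pair (S.dyadA o ι) η ξ x = ∑ a, nullVec (η x) (ξ x) a * S.dyadA o ι a x := rfl
    rw [hp]
    simp only [Fin.sum_univ_four]
    ring
  have n0 : ∀ η ξ : M → Spinor, ∑ a, nullVec (η x) (ξ x) a * S.nablaSpin o x a B =
      pair (S.dyadA o ι) η ξ x * o x B + pair (S.dyadB o) η ξ x * ι x B := by
    intro η ξ
    simp only [nablaSpin_o hd, pair, Fin.sum_univ_four]
    ring
  have n1 : ∀ η ξ : M → Spinor, ∑ a, nullVec (η x) (ξ x) a * S.nablaSpin ι x a B =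
      pair (S.dyadC ι) η ξ x * o x B - pair (S.dyadA o ι) η ξ x * ι x B := by
    intro η ξ
    simp only [nablaSpin_ι hd, pair, Fin.sum_univ_four]
    ring
  simp only [hsplit, f1, f2, f3, f4, d0, d1, n0, n1, sum_lower_nullVec, spinProd_self, hn, hn',
    map_neg, map_one, map_zero]
  refine ⟨⟨?_, ?_, ?_, ?_⟩, ?_, ?_, ?_, ?_⟩ <;> ring

/-- Only the contractions with ℓ and m survive, and these are multiples of `ι`, which is nowhere
zero; the four contractions determine a covector. -/
lemma confGHP_o_eq_zero_iff (hd : IsSpinDyad o ι) {w₀ w₁ : ℝ} (hw : w₀ + w₁ + 1 = 0) :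
    (∀ x a B, S.confGHP w₀ w₁ o ι w₀ 1 0 o x a B = 0) ↔
      ∀ x, pair (S.dyadB o) o o x = 0 ∧ pair (S.dyadB o) o ι x = 0 := by
  constructor
  · intro h x
    have h0 := fun B => (sum_confGHP (S := S) hd hw x B).1
    simp only [h, mul_zero, Finset.sum_const_zero] at h0
    have hz : ∀ c : ℂ, (∀ B, 0 = c * ι x B) → c = 0 := by
      intro c hc
      have hn := hd.normalized x
      simp only [spinProd, Fin.sum_univ_two, spinEps_table] at hn
      linear_combination (-c) * hn - o x 0 * hc 1 + o x 1 * hc 0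
    exact ⟨hz _ fun B => (h0 B).1, hz _ fun B => (h0 B).2.1⟩
  · intro h x a B
    obtain ⟨h1, h2, h3, h4⟩ := (sum_confGHP (S := S) hd hw x B).1
    rw [(h x).1, zero_mul] at h1
    rw [(h x).2, zero_mul] at h2
    exact eq_zero_of_pair hd x _ h1 h2 h3 h4 a

lemma confGHP_ι_eq_zero_iff (hd : IsSpinDyad o ι) {w₀ w₁ : ℝ} (hw : w₀ + w₁ + 1 = 0) :
    (∀ x a B, S.confGHP w₀ w₁ o ι w₁ (-1) 0 ι x a B = 0) ↔
      ∀ x, pair (S.dyadC ι) ι o x = 0 ∧ pair (S.dyadC ι) ι ι x = 0 := by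
  constructor
  · intro h x
    have h0 := fun B => (sum_confGHP (S := S) hd hw x B).2
    simp only [h, mul_zero, Finset.sum_const_zero] at h0
    have hz : ∀ c : ℂ, (∀ B, 0 = c * o x B) → c = 0 := by
      intro c hc
      have hn := hd.normalized x
      simp only [spinProd, Fin.sum_univ_two, spinEps_table] at hn
      linear_combination (-c) * hn - ι x 1 * hc 0 + ι x 0 * hc 1
    exact ⟨hz _ fun B => (h0 B).2.2.1, hz _ fun B => (h0 B).2.2.2⟩
  · intro h x a B
    obtain ⟨h1, h2, h3, h4⟩ := (sum_confGHP (S := S) hd hw x B).2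
    rw [(h x).1, zero_mul] at h3
    rw [(h x).2, zero_mul] at h4
    exact eq_zero_of_pair hd x _ h1 h2 h3 h4 a

end SpinSpacetime
end

/-! ### Behaviour of the connection under conformal rescaling. -/

noncomputable section

/-- The change of the spin connection under a conformal rescaling. -/
lemma spinOf_rescale (i : Fin 4) (u : Fin 4 → ℝ) (C B : Fin 2) :
    spinOf (fun j k => (if i = k then 1 else 0) * u j - minkowskiSign k * u k * minkowski i j) C B =
      (∑ A', infeld i B A' * ∑ j, (u j : ℂ) * infeldInv j C A') -
        if C = B then 1 / 2 * (u i : ℂ) else 0 := by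
  fin_cases i <;> fin_cases C <;> fin_cases B <;>
  · simp only [Fin.zero_eta, Fin.mk_one, Fin.isValue, Fin.reduceFinMk, spinOf, Fin.sum_univ_two,
      Fin.sum_univ_four, infeldInv_table, infeld_table, minkowski, minkowskiSign_table]
    simp
    ring_nf
    try simp only [Complex.I_sq, invSqrtTwo_sq]
    try ring

namespace SpinSpacetime

variable {M : Type*} [TopologicalSpace M] [ChartedSpace (EuclideanSpace ℝ (Fin 4)) M]
  [IsManifold (𝓡 4) ∞ M] {S : SpinSpacetime M} {o ι : M → Spinor}

section Rescale

variable {Ω : M → ℝ} (hΩ : ContMDiff (𝓡 4) 𝓘(ℝ, ℝ) ∞ Ω) (hpos : ∀ x, 0 < Ω x)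

lemma frameDeriv_rescale {F : Type*} [NormedAddCommGroup F] [NormedSpace ℝ F] (i : Fin 4)
    (f : M → F) (x : M) :
    (S.rescale Ω hΩ hpos).frameDeriv i f x = (Ω x)⁻¹ • S.frameDeriv i f x :=
  map_smul (mfderiv (𝓡 4) 𝓘(ℝ, F) f x) (Ω x)⁻¹ (S.e i x)

/-- Expand the bracket of the fields `Ω⁻¹ e_i` by the Leibniz rule. The factor Ω² of the metric
absorbs two of the factors `Ω⁻¹`. -/
lemma structureFun_rescale (i j k : Fin 4) (x : M) :
    (S.rescale Ω hΩ hpos).structureFun i j k x = (Ω x)⁻¹ * S.structureFun i j k x +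
      S.frameDeriv i (fun y => (Ω y)⁻¹) x * minkowski j k -
      S.frameDeriv j (fun y => (Ω y)⁻¹) x * minkowski i k := by
  have : IsManifold (𝓡 4) 1 M := IsManifold.of_le (n := ∞) (by simp)
  have : IsManifold (𝓡 4) 2 M := IsManifold.of_le (n := ∞) two_le_smooth
  have hφ : ContMDiff (𝓡 4) 𝓘(ℝ, ℝ) ∞ (fun x => (Ω x)⁻¹) := hΩ.inv₀ (fun x => (hpos x).ne')
  have h0 := (hpos x).ne'
  have he : ∀ i, (S.rescale Ω hΩ hpos).e i = (fun y => (Ω y)⁻¹) • S.e i := fun i => rfl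
  have hb : mlieBracket (𝓡 4) ((fun y => (Ω y)⁻¹) • S.e i) ((fun y => (Ω y)⁻¹) • S.e j) x =
      ((Ω x)⁻¹ * S.frameDeriv i (fun y => (Ω y)⁻¹) x) • S.e j x + (Ω x)⁻¹ •
        (-(S.frameDeriv j (fun y => (Ω y)⁻¹) x) • S.e i x +
          (Ω x)⁻¹ • mlieBracket (𝓡 4) (S.e i) (S.e j) x) := by
    rw [mlieBracket_smul_right (hφ.mdifferentiable (by simp) x)
        ((S.smooth_e j).mdifferentiable (by simp) x),
      mlieBracket_smul_left (hφ.mdifferentiable (by simp) x)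
        ((S.smooth_e i).mdifferentiable (by simp) x)]
    congr 2
    exact map_smul (mfderiv (𝓡 4) 𝓘(ℝ, ℝ) (fun y => (Ω y)⁻¹) x) (Ω x)⁻¹ (S.e i x)
  have hS : (S.rescale Ω hΩ hpos).structureFun i j k x = Ω x ^ 2 * ((Ω x)⁻¹ *
      S.g x (mlieBracket (𝓡 4) ((fun y => (Ω y)⁻¹) • S.e i) ((fun y => (Ω y)⁻¹) • S.e j) x)
        (S.e k x)) := by
    rw [structureFun, he, he, he]
    exact congrArg (Ω x ^ 2 * ·) (map_smul (S.g x _) (Ω x)⁻¹ (S.e k x))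
  rw [hS, hb]
  simp only [map_add, map_smul, LinearMap.add_apply, LinearMap.smul_apply, S.orthonormal,
    smul_eq_mul, structureFun]
  field_simp
  ring

lemma christoffel_rescale (i j k : Fin 4) (x : M) :
    (S.rescale Ω hΩ hpos).christoffel i j k x = (Ω x)⁻¹ * S.christoffel i j k x -
      ((if i = k then 1 else 0) * S.frameDeriv j (fun y => (Ω y)⁻¹) x -
      minkowskiSign k * S.frameDeriv k (fun y => (Ω y)⁻¹) x * minkowski i j) := by
  simp only [christoffel, structureFun_rescale]
  have h1 : ∀ i j, minkowski i j = minkowski j i := fun i j => by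
    simp only [minkowski, eq_comm (a := i) (b := j)]
    split_ifs with h
    · rw [h]
    · rfl
  have h2 : minkowskiSign k * minkowski i k = if i = k then 1 else 0 := by
    simp only [minkowski]
    split_ifs with h
    · rw [h, minkowskiSign_sq]
    · ring
  rw [← h2, h1 j i, h1 k i, h1 k j]
  ring

lemma spinConn_rescale (i : Fin 4) (C B : Fin 2) (x : M) :
    (S.rescale Ω hΩ hpos).spinConn i C B x = ((Ω x)⁻¹ : ℝ) * S.spinConn i C B x -
      ((∑ A', infeld i B A' * ∑ j, ((S.frameDeriv j (fun y => (Ω y)⁻¹) x : ℝ) : ℂ) * infeldInv j C A') -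
        if C = B then 1 / 2 * ((S.frameDeriv i (fun y => (Ω y)⁻¹) x : ℝ) : ℂ) else 0) := by
  rw [← spinOf_rescale, S.spinConn_eq, ← spinOf_smul, ← spinOf_sub, spinConn_eq]
  simp only [christoffel_rescale]

/-- Under a conformal rescaling and a rescaling of the spinor by a function, the contraction of
`κ_B ∇ κ^B` with `κ ξ̄` is multiplied by a function. -/
lemma sum_dyadB_rescale {κ : M → Spinor} (hκ : ∀ B, Sm (fun y => κ y B)) {μ : M → ℂ} (hμ : Sm μ)
    (x : M) (ξ : Spinor) :
    ∑ i, nullVec (κ x) ξ i * (S.rescale Ω hΩ hpos).dyadB (fun y => μ y • κ y) i x =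
      μ x ^ 2 * ((Ω x)⁻¹ : ℝ) * ∑ i, nullVec (κ x) ξ i * S.dyadB κ i x := by
  have hd : ∀ i B, (S.rescale Ω hΩ hpos).frameDeriv i (fun y => μ y * κ y B) x =
      ((Ω x)⁻¹ : ℝ) * (S.frameDeriv i μ x * κ x B + μ x * S.frameDeriv i (fun y => κ y B) x) := by
    intro i B
    rw [frameDeriv_rescale, Complex.real_smul, ← S.fd_mul i hμ (hκ B)]
  -- The derivative of `μ` and the trace term of the connection produce multiples of `κ`, which
  -- vanish against `κ`.
  have hB : ∀ i, (S.rescale Ω hΩ hpos).dyadB (fun y => μ y • κ y) i x =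
      μ x ^ 2 * ((Ω x)⁻¹ : ℝ) * S.dyadB κ i x - μ x ^ 2 * spinProd (κ x) (fun B => 
      ∑ A', infeld i B A' * ∑ C, κ x C *
        ∑ j, ((S.frameDeriv j (fun y => (Ω y)⁻¹) x : ℝ) : ℂ) * infeldInv j C A') := by
    intro i
    simp only [dyadB, nablaSpin, spinConn_rescale, spinProd, Fin.sum_univ_two, spinEps_table,
      Pi.smul_apply, smul_eq_mul, hd]
    simp only [Fin.isValue, zero_ne_one, one_ne_zero, if_true, if_false]
    ring
  -- Contraction with `κ ξ̄` turns the remaining inhomogeneous term into a multiple of `κ` too. This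
  -- is why only κ and σ rescale homogeneously here.
  have hs : ∀ G : Fin 2 → ℂ, ∑ i, nullVec (κ x) ξ i *
      spinProd (κ x) (fun B => ∑ A', infeld i B A' * G A') = 0 := by
    intro G
    have h0 := sum_infeld_mul (κ x) ξ 0 G
    have h1 := sum_infeld_mul (κ x) ξ 1 G
    simp only [Fin.sum_univ_four, Fin.sum_univ_two] at h0 h1
    simp only [spinProd, spinEps_table, Fin.sum_univ_four, Fin.sum_univ_two]
    linear_combination κ x 0 * h1 - κ x 1 * h0
  simp only [hB, mul_sub, Finset.sum_sub_distrib]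
  have h2 := hs (fun A' => ∑ C, κ x C *
        ∑ j, ((S.frameDeriv j (fun y => (Ω y)⁻¹) x : ℝ) : ℂ) * infeldInv j C A')
  have h3 : ∑ i, nullVec (κ x) ξ i * (μ x ^ 2 * spinProd (κ x) (fun B => 
      ∑ A', infeld i B A' * ∑ C, κ x C *
        ∑ j, ((S.frameDeriv j (fun y => (Ω y)⁻¹) x : ℝ) : ℂ) * infeldInv j C A')) = 0 := by
    rw [← mul_zero (μ x ^ 2), ← h2, Finset.mul_sum]
    exact Finset.sum_congr rfl fun i _ => by ring
  rw [h3, sub_zero, Finset.mul_sum]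
  exact Finset.sum_congr rfl fun i _ => by ring

end Rescale

end SpinSpacetime
end

/-! ### Gauge transformations and the characterisation in every gauge. -/

noncomputable section

lemma nullVec_smul (a b : ℂ) (κ ξ : Spinor) (i : Fin 4) :
    nullVec (a • κ) (b • ξ) i = a * conj b * nullVec κ ξ i := by
  simp only [nullVec, Fin.sum_univ_two, Pi.smul_apply, smul_eq_mul, map_mul]
  ring

lemma spinProd_smul (a b : ℂ) (κ ξ : Spinor) :
    spinProd (a • κ) (b • ξ) = a * b * spinProd κ ξ := by
  simp only [spinProd, Fin.sum_univ_two, Pi.smul_apply, smul_eq_mul]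
  ring

namespace SpinSpacetime

variable {M : Type*} [TopologicalSpace M] [ChartedSpace (EuclideanSpace ℝ (Fin 4)) M]
  [IsManifold (𝓡 4) ∞ M] {S : SpinSpacetime M} {o ι : M → Spinor}

/-- The scalar factor of a gauge transformation. -/
def gaugeFactor (w : ℝ) (p : ℤ) (Ω : M → ℝ) (lam : M → ℂ) (x : M) : ℂ :=
  ((Ω x ^ (w + 1 / 2) : ℝ) : ℂ) * lam x ^ p

variable {Ω : M → ℝ} {lam : M → ℂ}

lemma contMDiff_zpow (hlam : Sm lam) (hne : ∀ x, lam x ≠ 0) (p : ℤ) : Sm (fun x => lam x ^ p) := by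
  intro x
  have h : ContDiffAt ℝ ∞ (fun z : ℂ => z ^ p) (lam x) := by
    cases p with
    | ofNat n =>
      simp only [Int.ofNat_eq_natCast, zpow_natCast]
      exact contDiffAt_id.pow n
    | negSucc n =>
      simp only [zpow_negSucc]
      exact (contDiffAt_id.pow (n + 1)).inv (pow_ne_zero _ (hne x))
  exact h.contMDiffAt.comp x (hlam x)

lemma Sm_gaugeFactor (hΩ : ContMDiff (𝓡 4) 𝓘(ℝ, ℝ) ∞ Ω) (hpos : ∀ x, 0 < Ω x) (hlam : Sm lam)
    (hne : ∀ x, lam x ≠ 0) (w : ℝ) (p : ℤ) : Sm (gaugeFactor w p Ω lam) := by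
  have h1 : ContMDiff (𝓡 4) 𝓘(ℝ, ℝ) ∞ (fun x => Ω x ^ (w + 1 / 2)) := fun x =>
    (Real.contDiffAt_rpow_const_of_ne (n := ∞) (hpos x).ne').contMDiffAt.comp x (hΩ x)
  exact (Sm.ofReal h1).mul (contMDiff_zpow hlam hne p)

lemma gaugeFactor_ne_zero (hpos : ∀ x, 0 < Ω x) (hne : ∀ x, lam x ≠ 0) (w : ℝ) (p : ℤ) (x : M) :
    gaugeFactor w p Ω lam x ≠ 0 :=
  mul_ne_zero (Complex.ofReal_ne_zero.2 (Real.rpow_pos_of_pos (hpos x) _).ne')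
    (zpow_ne_zero _ (hne x))

/-- The exponents `w₀ + 1/2` and `w₁ + 1/2` add to zero: the halves from the rescaled spin frame
compensate `w₀ + w₁ = -1`. -/
lemma isSpinDyad_gaugeTransform (hΩ : ContMDiff (𝓡 4) 𝓘(ℝ, ℝ) ∞ Ω) (hpos : ∀ x, 0 < Ω x)
    (hlam : Sm lam) (hne : ∀ x, lam x ≠ 0) (hd : IsSpinDyad o ι) {w₀ w₁ : ℝ}
    (hw : w₀ + w₁ + 1 = 0) :
    IsSpinDyad (gaugeTransform w₀ 1 Ω lam o) (gaugeTransform w₁ (-1) Ω lam ι) where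
  smooth_o := contMDiff_pi_space.2 fun B =>
    (Sm_gaugeFactor hΩ hpos hlam hne w₀ 1).mul (sm_component hd.smooth_o B)
  smooth_ι := contMDiff_pi_space.2 fun B =>
    (Sm_gaugeFactor hΩ hpos hlam hne w₁ (-1)).mul (sm_component hd.smooth_ι B)
  normalized x := by
    change spinProd (gaugeFactor w₀ 1 Ω lam x • o x) (gaugeFactor w₁ (-1) Ω lam x • ι x) = 1
    rw [spinProd_smul, hd.normalized, mul_one, gaugeFactor, gaugeFactor]
    have h1 : (Ω x ^ (w₀ + 1 / 2) : ℝ) * (Ω x ^ (w₁ + 1 / 2) : ℝ) = 1 := by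
      rw [← Real.rpow_add (hpos x), show w₀ + 1 / 2 + (w₁ + 1 / 2) = 0 by linarith, Real.rpow_zero]
    have h2 : lam x ^ (1 : ℤ) * lam x ^ (-1 : ℤ) = 1 := by
      rw [← zpow_add₀ (hne x)]; simp
    have h1' : ((Ω x ^ (w₀ + 1 / 2) : ℝ) : ℂ) * ((Ω x ^ (w₁ + 1 / 2) : ℝ) : ℂ) = 1 := by
      exact_mod_cast h1
    linear_combination (lam x ^ (1 : ℤ) * lam x ^ (-1 : ℤ)) * h1' + h2

/-- The geodesic and shear-free condition is invariant under gauge transformations. -/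
lemma pair_dyadB_rescale_eq_zero_iff (hΩ : ContMDiff (𝓡 4) 𝓘(ℝ, ℝ) ∞ Ω) (hpos : ∀ x, 0 < Ω x)
    {κ ξ : M → Spinor} (hκ : ∀ B, Sm (fun y => κ y B)) {μ : M → ℂ} (hμ : Sm μ)
    (hμ0 : ∀ x, μ x ≠ 0) {ν : M → ℂ} (hν0 : ∀ x, ν x ≠ 0) (x : M) :
    pair ((S.rescale Ω hΩ hpos).dyadB (fun y => μ y • κ y)) (fun y => μ y • κ y)
      (fun y => ν y • ξ y) x = 0 ↔ pair (S.dyadB κ) κ ξ x = 0 := by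
  have h := sum_dyadB_rescale (S := S) hΩ hpos hκ hμ x (ξ x)
  have e : pair ((S.rescale Ω hΩ hpos).dyadB (fun y => μ y • κ y)) (fun y => μ y • κ y)
      (fun y => ν y • ξ y) x = μ x * conj (ν x) * (μ x ^ 2 * ((Ω x)⁻¹ : ℝ) *
        pair (S.dyadB κ) κ ξ x) := by
    rw [pair, pair, ← h, Finset.mul_sum]
    exact Finset.sum_congr rfl fun i _ => by rw [nullVec_smul]; ring
  have h1 : conj (ν x) ≠ 0 := (map_ne_zero _).2 (hν0 x)
  have h2 : (((Ω x)⁻¹ : ℝ) : ℂ) ≠ 0 := Complex.ofReal_ne_zero.2 (inv_ne_zero (hpos x).ne')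
  rw [e]
  simp [h1, hμ0 x, (hpos x).ne']

/-- The characterisation of algebraically special and of type D spacetimes in an arbitrary gauge. -/
theorem confGHP_characterisation (S : SpinSpacetime M) (hE : S.IsEinstein) (hd : IsSpinDyad o ι)
    (hW : Dense {x | S.WeylNonzeroAt x}) {w₀ w₁ : ℝ} (hw : w₀ + w₁ + 1 = 0)
    (hΩ : ContMDiff (𝓡 4) 𝓘(ℝ, ℝ) ∞ Ω) (hpos : ∀ x, 0 < Ω x)
    (hlam : Sm lam) (hne : ∀ x, lam x ≠ 0) {o' ι' : M → Spinor}
    (ho' : o' = gaugeTransform w₀ 1 Ω lam o) (hι' : ι' = gaugeTransform w₁ (-1) Ω lam ι) :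
    (S.IsRepeatedPrincipal o ↔
      ∀ x a B, (S.rescale Ω hΩ hpos).confGHP w₀ w₁ o' ι' w₀ 1 0 o' x a B = 0) ∧
    (S.IsTypeD o ι ↔
      (∀ x a B, (S.rescale Ω hΩ hpos).confGHP w₀ w₁ o' ι' w₀ 1 0 o' x a B = 0) ∧
      (∀ x a B, (S.rescale Ω hΩ hpos).confGHP w₀ w₁ o' ι' w₁ (-1) 0 ι' x a B = 0)) := by
  obtain ⟨l, hE⟩ := hE
  have hd' : IsSpinDyad o' ι' := by
    rw [ho', hι']; exact isSpinDyad_gaugeTransform hΩ hpos hlam hne hd hw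
  have hμ := Sm_gaugeFactor hΩ hpos hlam hne w₀ 1
  have hν := Sm_gaugeFactor hΩ hpos hlam hne w₁ (-1)
  have hμ0 := gaugeFactor_ne_zero hpos hne w₀ 1
  have hν0 := gaugeFactor_ne_zero hpos hne w₁ (-1)
  have eo : o' = fun y => gaugeFactor w₀ 1 Ω lam y • o y := ho'
  have eι : ι' = fun y => gaugeFactor w₁ (-1) Ω lam y • ι y := hι'
  have so := sm_component hd.smooth_o
  have si := sm_component hd.smooth_ι
  have h1 : (∀ x a B, (S.rescale Ω hΩ hpos).confGHP w₀ w₁ o' ι' w₀ 1 0 o' x a B = 0) ↔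
      ∀ x, pair (S.dyadB o) o o x = 0 ∧ pair (S.dyadB o) o ι x = 0 := by
    rw [confGHP_o_eq_zero_iff hd' hw]
    refine forall_congr' fun x => ?_
    rw [eo, eι, pair_dyadB_rescale_eq_zero_iff hΩ hpos so hμ hμ0 hμ0,
      pair_dyadB_rescale_eq_zero_iff hΩ hpos so hμ hμ0 hν0]
  have h2 : (∀ x a B, (S.rescale Ω hΩ hpos).confGHP w₀ w₁ o' ι' w₁ (-1) 0 ι' x a B = 0) ↔
      ∀ x, pair (S.dyadC ι) ι o x = 0 ∧ pair (S.dyadC ι) ι ι x = 0 := by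
    rw [confGHP_ι_eq_zero_iff hd' hw]
    refine forall_congr' fun x => ?_
    have hn : ∀ {S : SpinSpacetime M} {κ ξ : M → Spinor}, pair (S.dyadC κ) κ ξ x = 0 ↔
        pair (S.dyadB κ) κ ξ x = 0 := fun {S κ ξ} => by
      rw [pair_dyadB_prime, neg_eq_zero]
    rw [hn, hn, hn, hn, eo, eι, pair_dyadB_rescale_eq_zero_iff hΩ hpos si hν hν0 hμ0,
      pair_dyadB_rescale_eq_zero_iff hΩ hpos si hν hν0 hν0]
  rw [h1, h2]
  exact ⟨isRepeatedPrincipal_iff_geodesic_shearfree hE hd hW, isTypeD_iff hE hd hW⟩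

end SpinSpacetime
end

noncomputable section

/-! ### Products and symmetrisation -/

lemma prod_update_spinor {n : ℕ} (y : Fin n → Spinor) (r : Fin n) (f : Spinor) (z : Fin n → Fin 2) :
    ∏ s, Function.update y r f s (z s) = f (z r) * ∏ s ∈ Finset.univ.erase r, y s (z s) := by
  rw [← Finset.mul_prod_erase Finset.univ _ (Finset.mem_univ r), Function.update_self]
  congr 1
  exact Finset.prod_congr rfl fun s hs => by
    rw [Function.update_of_ne (Finset.ne_of_mem_erase hs)]

lemma prod_update_comb {n : ℕ} (y : Fin n → Spinor) (r : Fin n) (f : Spinor) (a b : ℂ)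
    (z : Fin n → Fin 2) :
    ∏ s, Function.update y r (fun B => a * y r B + b * f B) s (z s) =
      a * ∏ s, y s (z s) + b * ∏ s, Function.update y r f s (z s) := by
  rw [prod_update_spinor, prod_update_spinor,
    ← Finset.mul_prod_erase Finset.univ (fun s => y s (z s)) (Finset.mem_univ r)]
  ring

/-- Exchanging a factor with the first slot does not change a total symmetrisation. -/
lemma sum_perm_exchange {n : ℕ} (y : Fin n → Spinor) (r : Fin n) (f : Spinor)
    (σ : Equiv.Perm (Fin n)) (B : Fin (n + 1) → Fin 2) :
    ∑ π : Equiv.Perm (Fin (n + 1)), f (B (π 0)) * ∏ s, y s (B (π (σ s).succ)) =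
      ∑ π : Equiv.Perm (Fin (n + 1)),
        y r (B (π 0)) * ∏ s, Function.update y r f s (B (π (σ s).succ)) := by
  -- Reindexing by the transposition of slot 0 with the slot of the factor `r` exchanges the two
  -- spinors and fixes all other slots.
  rw [← Equiv.sum_comp (Equiv.mulRight (Equiv.swap 0 (σ r).succ))]
  refine Finset.sum_congr rfl fun π _ => ?_
  rw [prod_update_spinor y r f (fun s => B (π (σ s).succ)),
    ← Finset.mul_prod_erase Finset.univ _ (Finset.mem_univ r)]
  simp only [Equiv.coe_mulRight, Equiv.Perm.mul_apply, Equiv.swap_apply_left,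
    Equiv.swap_apply_right]
  have h : ∏ s ∈ Finset.univ.erase r, y s (B (π (Equiv.swap 0 (σ r).succ (σ s).succ))) =
      ∏ s ∈ Finset.univ.erase r, y s (B (π (σ s).succ)) :=
    Finset.prod_congr rfl fun s hs => by
      rw [Equiv.swap_apply_of_ne_of_ne (Fin.succ_ne_zero _)]
      intro hc
      exact Finset.ne_of_mem_erase hs (σ.injective (Fin.succ_injective _ hc))
  rw [h]
  ring

/-! ### Raising the unprimed index of a 1-form -/

/-- The components `θ^A{}_{A'} = ε^{AC} θ_{CA'}` of a 1-form. -/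
def raise (θ : Fin 4 → ℂ) (A' A : Fin 2) : ℂ :=
  ∑ C, spinEps A C * ∑ a, infeldInv a C A' * θ a

lemma raise_comb (p q : ℂ) (θ η : Fin 4 → ℂ) (A' A : Fin 2) :
    raise (fun a => p * θ a + q * η a) A' A = p * raise θ A' A + q * raise η A' A := by
  simp only [raise, Fin.sum_univ_two, Fin.sum_univ_four]
  ring

lemma raise_sum {κ : Type*} (s : Finset κ) (θ : κ → Fin 4 → ℂ) (A' A : Fin 2) :
    raise (fun a => ∑ r ∈ s, θ r a) A' A = ∑ r ∈ s, raise (θ r) A' A := by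
  classical
  induction s using Finset.induction_on with
  | empty => simp [raise]
  | insert r s hr ih =>
    simp only [Finset.sum_insert hr]
    have h := raise_comb 1 1 (θ r) (fun a => ∑ r ∈ s, θ r a) A' A
    simp only [one_mul, ih] at h
    exact h

lemma sum_nullVec_eq_raise (θ : Fin 4 → ℂ) (κ ξ : Spinor) :
    ∑ i, nullVec κ ξ i * θ i = ∑ A', spinProd (raise θ A') κ * conj (ξ A') := by
  simp only [nullVec, spinProd, raise, Fin.sum_univ_two, Fin.sum_univ_four, spinEps_table]
  ring

/-- The conjugates of `o` and `ι` are a basis of primed spinors, so two contractions determine both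
values of `A'`. -/
lemma spinProd_raise_eq {o ι : Spinor} (h : spinProd o ι = 1) {θ η : Fin 4 → ℂ} {κ ζ : Spinor} {c : ℂ}
    (ho : ∑ i, nullVec κ o i * θ i = c * ∑ i, nullVec ζ o i * η i)
    (hι : ∑ i, nullVec κ ι i * θ i = c * ∑ i, nullVec ζ ι i * η i) (A' : Fin 2) :
    spinProd (raise θ A') κ = c * spinProd (raise η A') ζ := by
  simp only [sum_nullVec_eq_raise, Fin.sum_univ_two] at ho hι
  have h' := congrArg conj h
  simp only [spinProd, Fin.sum_univ_two, spinEps_table, map_add, map_mul, map_one, map_neg,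
    zero_mul, one_mul, neg_mul, zero_add, add_zero] at h'
  match A' with
  | 0 => linear_combination conj (ι 1) * ho - conj (o 1) * hι -
      (spinProd (raise θ 0) κ - c * spinProd (raise η 0) ζ) * h'
  | 1 => linear_combination conj (o 0) * hι - conj (ι 0) * ho -
      (spinProd (raise θ 1) κ - c * spinProd (raise η 1) ζ) * h'

namespace SpinSpacetime

variable {M : Type*} [TopologicalSpace M] [ChartedSpace (EuclideanSpace ℝ (Fin 4)) M]
  [IsManifold (𝓡 4) ∞ M] {S : SpinSpacetime M} {o ι : M → Spinor}

/-! ### Pointwise derivatives -/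

/-- A pointwise version is needed because a branch of the cube root is smooth only on `U`. -/
lemma fd_mul_at (i : Fin 4) {f g : M → ℂ} {x : M} (hf : MDifferentiableAt (𝓡 4) 𝓘(ℝ, ℂ) f x)
    (hg : MDifferentiableAt (𝓡 4) 𝓘(ℝ, ℂ) g x) :
    S.frameDeriv i (fun y => f y * g y) x =
      S.frameDeriv i f x * g x + f x * S.frameDeriv i g x := by
  unfold frameDeriv
  have h : mfderiv (𝓡 4) 𝓘(ℝ, ℂ) (fun y => f y * g y) x = _ :=
    (hf.hasMFDerivAt.mul hg.hasMFDerivAt).mfderiv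
  rw [h]
  change f x * S.frameDeriv i g x + g x * S.frameDeriv i f x =
    S.frameDeriv i f x * g x + f x * S.frameDeriv i g x
  ring

lemma mdifferentiableAt_mul {f g : M → ℂ} {x : M} (hf : MDifferentiableAt (𝓡 4) 𝓘(ℝ, ℂ) f x)
    (hg : MDifferentiableAt (𝓡 4) 𝓘(ℝ, ℂ) g x) :
    MDifferentiableAt (𝓡 4) 𝓘(ℝ, ℂ) (fun y => f y * g y) x :=
  (hf.hasMFDerivAt.mul hg.hasMFDerivAt).mdifferentiableAt

/-- Powers of a function with logarithmic derivative `c`. -/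
lemma fd_pow_at (i : Fin 4) {f : M → ℂ} {x : M} {c : ℂ} (hf : MDifferentiableAt (𝓡 4) 𝓘(ℝ, ℂ) f x)
    (hc : S.frameDeriv i f x = c * f x) (k : ℕ) :
    MDifferentiableAt (𝓡 4) 𝓘(ℝ, ℂ) (fun y => f y ^ k) x ∧
      S.frameDeriv i (fun y => f y ^ k) x = k * c * f x ^ k := by
  induction k with
  | zero =>
    simp only [pow_zero]
    exact ⟨mdifferentiableAt_const, by simp [S.fd_const]⟩
  | succ k ih =>
    simp only [pow_succ]
    refine ⟨mdifferentiableAt_mul ih.1 hf, ?_⟩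
    rw [fd_mul_at i ih.1 hf, ih.2, hc]
    push_cast
    ring

/-- The logarithmic derivative of the inverse of a branch of a cube root. -/
lemma fd_inv_cbrt (i : Fin 4) {ψ F : M → ℂ} {U : Set M} (hU : IsOpen U)
    (hψ : ContMDiffOn (𝓡 4) 𝓘(ℝ, ℂ) ∞ ψ U) (h3 : ∀ x ∈ U, ψ x ^ 3 = F x) {x : M} (hx : x ∈ U)
    (hF : F x ≠ 0) : MDifferentiableAt (𝓡 4) 𝓘(ℝ, ℂ) (fun y => (ψ y)⁻¹) x ∧
      S.frameDeriv i (fun y => (ψ y)⁻¹) x = -(S.frameDeriv i F x / (3 * F x)) * (ψ x)⁻¹ := by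
  have hUx := hU.mem_nhds hx
  have hψx : ContMDiffAt (𝓡 4) 𝓘(ℝ, ℂ) ∞ ψ x := hψ.contMDiffAt hUx
  have h0 : ψ x ≠ 0 := fun h => hF (by rw [← h3 x hx, h]; ring)
  have hd : MDifferentiableAt (𝓡 4) 𝓘(ℝ, ℂ) ψ x := hψx.mdifferentiableAt (by simp)
  have hi : MDifferentiableAt (𝓡 4) 𝓘(ℝ, ℂ) (fun y => (ψ y)⁻¹) x :=
    ((contDiffAt_inv ℝ (n := ∞) h0).contMDiffAt.comp x hψx).mdifferentiableAt (by simp)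
  refine ⟨hi, ?_⟩
  have e1 : S.frameDeriv i F x = 3 * ψ x ^ 2 * S.frameDeriv i ψ x := by
    rw [← S.fd_congr i (f := fun y => ψ y * ψ y * ψ y) (Filter.eventually_of_mem hUx
      fun y hy => by rw [← h3 y hy]; ring), fd_mul_at i (mdifferentiableAt_mul hd hd) hd,
      fd_mul_at i hd hd]
    ring
  have e2 : S.frameDeriv i ψ x * (ψ x)⁻¹ + ψ x * S.frameDeriv i (fun y => (ψ y)⁻¹) x = 0 := by
    rw [← fd_mul_at i hd hi, S.fd_congr i (g := fun _ => (1 : ℂ)), S.fd_const]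
    filter_upwards [hψx.continuousAt.eventually_ne h0] with y hy using mul_inv_cancel₀ hy
  rw [e1, ← h3 x hx]
  field_simp at e2 ⊢
  linear_combination e2

lemma Sm_prod {κ : Type*} (s : Finset κ) {f : κ → M → ℂ} (hf : ∀ r, Sm (f r)) :
    Sm (fun x => ∏ r ∈ s, f r x) := by
  classical
  induction s using Finset.induction_on with
  | empty => simpa using Sm.const 1
  | insert a s ha ih =>
    simp only [Finset.prod_insert ha]
    exact (hf a).mul ih

lemma fd_prod {κ : Type*} [DecidableEq κ] (i : Fin 4) (s : Finset κ) {f : κ → M → ℂ}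
    (hf : ∀ r, Sm (f r)) (x : M) : S.frameDeriv i (fun y => ∏ r ∈ s, f r y) x =
      ∑ r ∈ s, S.frameDeriv i (f r) x * ∏ t ∈ s.erase r, f t x := by
  induction s using Finset.induction_on with
  | empty => simp [S.fd_const]
  | insert a s ha ih =>
    simp only [Finset.prod_insert ha]
    rw [S.fd_mul i (hf a) (Sm_prod s hf), ih, Finset.sum_insert ha, Finset.erase_insert ha,
      Finset.mul_sum]
    congr 1
    refine Finset.sum_congr rfl fun r hr => ?_
    have hne : a ≠ r := fun h => ha (h ▸ hr)
    rw [Finset.erase_insert_of_ne hne, Finset.prod_insert (fun h => ha (Finset.mem_of_mem_erase h))]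
    ring

/-- The Leibniz rule for a symmetrised product of spinor fields. -/
lemma nablaMulti_symProduct {n : ℕ} {Y : Fin n → M → Spinor} (hY : ∀ r B, Sm (fun y => Y r y B))
    (x : M) (i : Fin 4) (B : Fin n → Fin 2) :
    S.nablaMulti (fun y B => ∑ σ : Equiv.Perm (Fin n), ∏ s, Y s y (B (σ s))) x i B =
      ∑ σ : Equiv.Perm (Fin n), ∑ r,
        ∏ s, Function.update (fun s => Y s x) r (S.nablaSpin (Y r) x i) s (B (σ s)) := by
  unfold nablaMulti
  beta_reduce
  rw [S.fd_sum i Finset.univ (f := fun (σ : Equiv.Perm (Fin n)) y => ∏ s, Y s y (B (σ s)))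
    (fun σ => Sm_prod _ fun s => hY s (B (σ s)))]
  -- The connection acts on slots `t`, the Leibniz rule on factors `r`; for each σ they are matched
  -- by `t = σ r`.
  have e : ∑ t, ∑ C, S.spinConn i C (B t) x *
      ∑ σ : Equiv.Perm (Fin n), ∏ s, Y s x (Function.update B t C (σ s)) =
      ∑ σ : Equiv.Perm (Fin n), ∑ r, ∑ C, S.spinConn i C (B (σ r)) x *
        ∏ s, Y s x (Function.update B (σ r) C (σ s)) := by
    refine Eq.trans ?_ (Finset.sum_congr rfl fun (σ : Equiv.Perm (Fin n)) _ =>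
      (Equiv.sum_comp σ fun t => ∑ C, S.spinConn i C (B t) x *
        ∏ s, Y s x (Function.update B t C (σ s))).symm)
    conv_rhs => rw [Finset.sum_comm]
    refine Finset.sum_congr rfl fun t _ => ?_
    conv_rhs => rw [Finset.sum_comm]
    exact Finset.sum_congr rfl fun C _ => Finset.mul_sum _ _ _
  rw [e, ← Finset.sum_add_distrib]
  refine Finset.sum_congr rfl fun σ _ => ?_
  rw [fd_prod i _ (fun s => hY s (B (σ s))), ← Finset.sum_add_distrib]
  refine Finset.sum_congr rfl fun r _ => ?_
  rw [prod_update_spinor (fun s => Y s x) r _ (fun s => B (σ s)), nablaSpin, add_mul,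
    Finset.sum_mul]
  congr 1
  refine Finset.sum_congr rfl fun C _ => ?_
  rw [← Finset.mul_prod_erase Finset.univ _ (Finset.mem_univ r), Function.update_self, mul_assoc]
  congr 2
  refine Finset.prod_congr rfl fun s hs => ?_
  rw [Function.update_of_ne fun h => Finset.ne_of_mem_erase hs (σ.injective h)]

lemma nablaMulti_mul {n : ℕ} {φ : M → ℂ} {P : M → (Fin n → Fin 2) → ℂ} {x : M} {i : Fin 4} {c : ℂ}
    (hφ : MDifferentiableAt (𝓡 4) 𝓘(ℝ, ℂ) φ x) (hc : S.frameDeriv i φ x = c * φ x)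
    (hP : ∀ B, Sm (fun y => P y B)) (B : Fin n → Fin 2) :
    S.nablaMulti (fun y B => φ y * P y B) x i B =
      φ x * (c * P x B + S.nablaMulti P x i B) := by
  unfold nablaMulti
  rw [fd_mul_at i hφ ((hP B).mdiffAt x), hc]
  have e : ∑ r, ∑ C, S.spinConn i C (B r) x * (φ x * P x (Function.update B r C)) =
      φ x * ∑ r, ∑ C, S.spinConn i C (B r) x * P x (Function.update B r C) := by
    simp only [Finset.mul_sum]
    exact Finset.sum_congr rfl fun r _ => Finset.sum_congr rfl fun C _ => by ring
  rw [e]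
  ring

/-! ### The GHP and Teukolsky forms -/

/-- The four spin coefficients in the GHP form are the tetrad components of `A`, reassembled by
`form_expansion`. -/
lemma ghpForm_eq (hd : IsSpinDyad o ι) (x : M) (a : Fin 4) :
    S.ghpForm o ι x a = -S.dyadA o ι a x := by
  have e1 : ∀ u : Fin 4 → ℂ, S.spinCoeff ι o u x = ∑ i, u i * S.dyadA o ι i x := fun u => rfl
  have e2 : ∀ u : Fin 4 → ℂ, S.spinCoeff o ι u x = ∑ i, u i * S.dyadA o ι i x := fun u => by
    refine Finset.sum_congr rfl fun i _ => ?_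
    have h := hd.normalized x
    rw [nablaSpin_ι hd]
    simp only [spinProd, Fin.sum_univ_two, spinEps_table] at h ⊢
    linear_combination u i * S.dyadA o ι i x * h
  rw [ghpForm, e1, e1, e2, e2, form_expansion hd (S.dyadA o ι) a x]
  simp only [pair]
  ring

lemma pair_teukolskyForm (κ ξ : M → Spinor) (x : M) :
    ∑ i, nullVec (κ x) (ξ x) i * S.teukolskyForm o ι x i =
      pair (S.dyadB o) ι o x * (spinProd (ι x) (κ x) * conj (spinProd (ι x) (ξ x))) -
        pair (S.dyadB o) ι ι x * (spinProd (ι x) (κ x) * conj (spinProd (o x) (ξ x))) := by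
  have e : ∀ u : Fin 4 → ℂ, S.spinCoeff o o u x = -∑ i, u i * S.dyadB o i x := fun u => by
    rw [spinCoeff, ← Finset.sum_neg_distrib]
    refine Finset.sum_congr rfl fun i _ => ?_
    rw [dyadB, spinProd_swap]
    ring
  rw [← sum_lower_nullVec, ← sum_lower_nullVec]
  simp only [teukolskyForm, e, pair, Fin.sum_univ_four]
  ring

end SpinSpacetime
end

/-! ### Weighted Killing spinors in type D. -/

noncomputable section

namespace SpinSpacetime

variable {M : Type*} [TopologicalSpace M] [ChartedSpace (EuclideanSpace ℝ (Fin 4)) M]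
  [IsManifold (𝓡 4) ∞ M] {S : SpinSpacetime M} {o ι : M → Spinor}

lemma sum_fin_ite_lt {n k : ℕ} (hk : k ≤ n) (a b : ℂ) :
    ∑ r : Fin n, (if (r : ℕ) < k then a else b) = k * a + (n - k) * b := by
  obtain ⟨m, rfl⟩ := Nat.exists_eq_add_of_le hk
  rw [Fin.sum_univ_add]
  simp

/-- The logarithmic derivative of `Ψ₂^{1/3}`. -/
def logDerivPsi (S : SpinSpacetime M) (o ι : M → Spinor) (x : M) (i : Fin 4) : ℂ :=
  S.frameDeriv i (S.psi o ι 2) x / (3 * S.psi o ι 2 x)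

/-- The forms `β`, `γ`, `B` and `dΨ₂/(3Ψ₂)` of a type D Einstein spacetime. -/
lemma raise_forms {lam : ℝ} (hE : ∀ x i j, S.ricci i j x = lam * minkowski i j)
    (hd : IsSpinDyad o ι) (hD : S.IsTypeD o ι) (x : M) (A' A : Fin 2) :
    raise (fun a => S.dyadB o a x) A' A =
      spinProd (raise (fun a => S.dyadB o a x) A') (ι x) * o x A ∧
    raise (fun a => S.dyadC ι a x) A' A =
      -spinProd (raise (fun a => S.dyadC ι a x) A') (o x) * ι x A ∧
    raise (S.teukolskyForm o ι x) A' A =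
      -spinProd (raise (fun a => S.dyadB o a x) A') (ι x) * ι x A ∧
    raise (S.logDerivPsi o ι x) A' A =
      -spinProd (raise (fun a => S.dyadC ι a x) A') (o x) * o x A +
        spinProd (raise (fun a => S.dyadB o a x) A') (ι x) * ι x A := by
  have hW : Dense {x | S.WeylNonzeroAt x} := by
    rw [Set.eq_univ_of_forall (s := {x | S.WeylNonzeroAt x}) hD.1]
    exact dense_univ
  have h0 := (isRepeatedPrincipal_iff hE hd).1 hD.2.1
  have h1 := (isRepeatedPrincipal_prime_iff_psi hE hd).1 hD.2.2
  have hψ := psi_two_ne_zero hE hd hW h0 h1 x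
  obtain ⟨hB, hC⟩ := (isTypeD_iff hE hd hW).1 hD
  have hn := hd.normalized x
  have hn' : spinProd (ι x) (o x) = -1 := by rw [spinProd_swap, hn]
  have hl : ∀ κ ξ : M → Spinor, ∑ i, nullVec (κ x) (ξ x) i * S.logDerivPsi o ι x i =
      S.along κ ξ (S.psi o ι 2) x / (3 * S.psi o ι 2 x) := fun κ ξ => by
    simp only [along, logDerivPsi, Finset.sum_div, mul_div_assoc]
  -- The factor 3 in the Bianchi identities for Ψ₂ is what singles out the cube root.
  have hl1 : ∀ ξ : M → Spinor, ∑ i, nullVec (o x) (ξ x) i * S.logDerivPsi o ι x i =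
      -1 * pair (S.dyadB o) ι ξ x := fun ξ => by
    rw [hl, (frameDeriv_psi_two hE hd h0 h1 ξ x).1]
    field_simp
  have hl2 : ∀ ξ : M → Spinor, ∑ i, nullVec (ι x) (ξ x) i * S.logDerivPsi o ι x i =
      -1 * pair (S.dyadC ι) o ξ x := fun ξ => by
    rw [hl, (frameDeriv_psi_two hE hd h0 h1 ξ x).2]
    field_simp
  have b1 := spinProd_raise_eq hn (θ := fun a => S.dyadB o a x) (η := fun a => S.dyadB o a x)
    (c := 0) (ζ := o x) ((hB x).1.trans (zero_mul _).symm) ((hB x).2.trans (zero_mul _).symm) A'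
  have c1 := spinProd_raise_eq hn (θ := fun a => S.dyadC ι a x) (η := fun a => S.dyadC ι a x)
    (c := 0) (ζ := o x) ((hC x).1.trans (zero_mul _).symm) ((hC x).2.trans (zero_mul _).symm) A'
  have l1 := spinProd_raise_eq hn (θ := S.logDerivPsi o ι x) (η := fun a => S.dyadB o a x)
    (c := -1) (ζ := ι x) (hl1 o) (hl1 ι) A'
  have l2 := spinProd_raise_eq hn (θ := S.logDerivPsi o ι x) (η := fun a => S.dyadC ι a x)
    (c := -1) (ζ := o x) (hl2 o) (hl2 ι) A'
  have t1 := spinProd_raise_eq hn (θ := S.teukolskyForm o ι x) (η := fun a => S.dyadB o a x)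
    (c := 1) (κ := o x) (ζ := ι x)
    (by rw [pair_teukolskyForm, hn', spinProd_self]; simp [pair])
    (by rw [pair_teukolskyForm, hn', hn, spinProd_self]; simp [pair]) A'
  have t2 := spinProd_raise_eq hn (θ := S.teukolskyForm o ι x) (η := fun a => S.dyadB o a x)
    (c := 0) (κ := ι x) (ζ := ι x)
    (by rw [pair_teukolskyForm, spinProd_self]; simp)
    (by rw [pair_teukolskyForm, spinProd_self]; simp) A'
  refine ⟨?_, ?_, ?_, ?_⟩
  · rw [spinor_expansion hn (raise (fun a => S.dyadB o a x) A') A,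
      spinProd_swap (raise (fun a => S.dyadB o a x) A') (o x), b1]
    ring
  · rw [spinor_expansion hn (raise (fun a => S.dyadC ι a x) A') A, c1,
      spinProd_swap (raise (fun a => S.dyadC ι a x) A') (o x)]
    ring
  · rw [spinor_expansion hn (raise (S.teukolskyForm o ι x) A') A, t2,
      spinProd_swap (raise (S.teukolskyForm o ι x) A') (o x), t1]
    ring
  · rw [spinor_expansion hn (raise (S.logDerivPsi o ι x) A') A, l2,
      spinProd_swap (raise (S.logDerivPsi o ι x) A') (o x), l1]
    ring

/-- The Teukolsky derivative of `φ ι^{(B₁} ⋯ ι^{B_k} o^{B_{k+1}} ⋯ o^{B_n)}`. -/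
lemma teukolskyD_symDyadProduct (hd : IsSpinDyad o ι) {n k : ℕ} (hk : k ≤ n) {φ : M → ℂ} {x : M}
    {h : ℂ} {a : Fin 4} (hφ : MDifferentiableAt (𝓡 4) 𝓘(ℝ, ℂ) φ x)
    (hc : S.frameDeriv a φ x = -(k * h) * φ x) (B : Fin n → Fin 2) :
    S.teukolskyD o ι ((n : ℤ) - 2 * k) (fun y B => φ y * symDyadProduct n k (o y) (ι y) B) x a B =
      φ x * (n.factorial : ℂ)⁻¹ * ∑ σ : Equiv.Perm (Fin n), ∑ r : Fin n,
        ((if (r : ℕ) < k then S.dyadC ι a x else S.dyadB o a x) *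
            ∏ s, Function.update (fun s : Fin n => if (s : ℕ) < k then ι x else o x) r
              (if (r : ℕ) < k then o x else ι x) s (B (σ s)) +
          (if (r : ℕ) < k then -h - S.teukolskyForm o ι x a else S.teukolskyForm o ι x a) *
            ∏ s : Fin n, (if (s : ℕ) < k then ι x else o x) (B (σ s))) := by
  set Y : Fin n → M → Spinor := fun s => if (s : ℕ) < k then ι else o with hY
  have hYx : ∀ s x, Y s x = if (s : ℕ) < k then ι x else o x := fun s x => by
    simp only [hY]; split_ifs <;> rfl
  have hYs : ∀ r B, Sm (fun y => Y r y B) := fun r B => by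
    simp only [hY]
    split_ifs
    exacts [sm_component hd.smooth_ι B, sm_component hd.smooth_o B]
  have hP : (fun y (B : Fin n → Fin 2) => φ y * symDyadProduct n k (o y) (ι y) B) =
      fun y B => φ y * ((n.factorial : ℂ)⁻¹ * ∑ σ : Equiv.Perm (Fin n), ∏ s, Y s y (B (σ s))) := by
    funext y B
    simp only [symDyadProduct, hYx]
    congr 2
    refine Finset.sum_congr rfl fun σ _ => Finset.prod_congr rfl fun s _ => ?_
    split_ifs <;> rfl
  have hQ : ∀ B : Fin n → Fin 2, Sm (fun y => ∑ σ : Equiv.Perm (Fin n), ∏ s, Y s y (B (σ s))) :=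
    fun B => Sm.sum fun σ => Sm_prod _ fun s => hYs s (B (σ s))
  have hn : ∀ r, S.nablaSpin (Y r) x a = fun B =>
      (if (r : ℕ) < k then -S.dyadA o ι a x else S.dyadA o ι a x) * Y r x B +
        (if (r : ℕ) < k then S.dyadC ι a x else S.dyadB o a x) *
          (if (r : ℕ) < k then o x else ι x) B := fun r => by
    simp only [hY]
    split_ifs
    · rw [nablaSpin_ι hd]
      funext B
      ring
    · rw [nablaSpin_o hd]
  rw [hP, teukolskyD, nablaMulti_mul hφ hc (fun B => (Sm.const _).mul (hQ B)),
    nablaMulti_mul (φ := fun _ => (n.factorial : ℂ)⁻¹) (c := 0) mdifferentiableAt_const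
      (by rw [S.fd_const, zero_mul]) hQ, nablaMulti_symProduct hYs, ghpForm_eq hd]
  -- The weight `n - 2k` is spread over the factors, +1 for each `o` and -1 for each `ι`. The terms
  -- in `A` then cancel against the GHP form, and the factor `-kh` gives `-h` to each `ι`.
  simp only [← hYx, hn, prod_update_comb (fun s => Y s x), Finset.sum_add_distrib, ← Finset.sum_mul,
    sum_fin_ite_lt hk, ← Finset.mul_sum]
  push_cast
  ring

/-- The weighted Killing spinors of a type D Einstein spacetime. -/
theorem isWeightedKillingAt_symDyadProduct (hE : S.IsEinstein) (hd : IsSpinDyad o ι)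
    (hD : S.IsTypeD o ι) {n k : ℕ} (hk : k ≤ n) {U : Set M} (hU : IsOpen U) {ψ : M → ℂ}
    (hψ : ContMDiffOn (𝓡 4) 𝓘(ℝ, ℂ) ∞ ψ U) (h3 : ∀ x ∈ U, ψ x ^ 3 = S.psi2 o ι x) {x : M}
    (hx : x ∈ U) : S.IsWeightedKillingAt o ι ((n : ℤ) - 2 * k)
      (fun y B => (ψ y)⁻¹ ^ k * symDyadProduct n k (o y) (ι y) B) x := by
  obtain ⟨lam, hE⟩ := hE
  have hψ0 : S.psi o ι 2 x ≠ 0 := by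
    have h0 := (isRepeatedPrincipal_iff hE hd).1 hD.2.1 x
    have h1 := (isRepeatedPrincipal_prime_iff_psi hE hd).1 hD.2.2 x
    obtain ⟨j, hj⟩ := (weylNonzeroAt_iff hE hd x).1 (hD.1 x)
    fin_cases j
    exacts [absurd h0.1 hj, absurd h0.2 hj, hj, absurd h1.1 hj, absurd h1.2 hj]
  intro A' B
  set y : Fin n → Spinor := fun s => if (s : ℕ) < k then ι x else o x with hy
  set f : Fin n → Spinor := fun s => if (s : ℕ) < k then o x else ι x with hf
  set b := spinProd (raise (fun a => S.dyadB o a x) A') (ι x) with hb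
  set g := spinProd (raise (fun a => S.dyadC ι a x) A') (o x) with hg
  set ζ : Fin n → Fin 4 → ℂ := fun r a =>
    if (r : ℕ) < k then S.dyadC ι a x else S.dyadB o a x with hζ
  set η : Fin n → Fin 4 → ℂ := fun r a =>
    if (r : ℕ) < k then -S.logDerivPsi o ι x a - S.teukolskyForm o ι x a
    else S.teukolskyForm o ι x a with hη
  have hF := raise_forms hE hd hD x A'
  -- The raised `ζ r` and `η r` carry opposite coefficients on `y r` and `f r`. For an `ι` factor
  -- the `bι` parts of the logarithmic derivative and the Teukolsky form cancel, leaving `g o`.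
  have hζr : ∀ r A, raise (ζ r) A' A = -(if (r : ℕ) < k then g else -b) * y r A := fun r A => by
    simp only [hζ, hy]
    split_ifs
    · exact (hF A).2.1
    · rw [(hF A).1, neg_neg]
  have hηr : ∀ r A, raise (η r) A' A = (if (r : ℕ) < k then g else -b) * f r A := fun r A => by
    simp only [hη, hf]
    split_ifs
    · have h := raise_comb (-1) (-1) (S.logDerivPsi o ι x) (S.teukolskyForm o ι x) A' A
      rw [(hF A).2.2.1, (hF A).2.2.2] at h
      have e : (fun a => -S.logDerivPsi o ι x a - S.teukolskyForm o ι x a) =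
          fun a => -1 * S.logDerivPsi o ι x a + -1 * S.teukolskyForm o ι x a := by
        funext a
        ring
      rw [e, h]
      ring
    · exact (hF A).2.2.1
  have hT : ∀ a (B : Fin n → Fin 2), S.teukolskyD o ι ((n : ℤ) - 2 * k)
      (fun y B => (ψ y)⁻¹ ^ k * symDyadProduct n k (o y) (ι y) B) x a B =
      ∑ σ : Equiv.Perm (Fin n), ∑ r : Fin n, ((ψ x)⁻¹ ^ k * (n.factorial : ℂ)⁻¹) *
        ((∏ s, Function.update y r (f r) s (B (σ s))) * ζ r a + (∏ s, y s (B (σ s))) * η r a) := by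
    intro a B
    obtain ⟨hi, hi'⟩ := fd_inv_cbrt (S := S) a hU hψ (F := S.psi o ι 2) h3 hx hψ0
    obtain ⟨hp, hp'⟩ := fd_pow_at a hi hi' k
    rw [teukolskyD_symDyadProduct hd hk (h := S.logDerivPsi o ι x a) hp
      (by rw [hp', logDerivPsi]; ring)]
    simp only [Finset.mul_sum]
    refine Finset.sum_congr rfl fun σ _ => Finset.sum_congr rfl fun r _ => ?_
    simp only [hζ, hη, hy, hf]
    ring
  have hR : ∀ (A : Fin 2) (B : Fin n → Fin 2), ∑ C, spinEps A C * ∑ a, infeldInv a C A' *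
      S.teukolskyD o ι ((n : ℤ) - 2 * k)
        (fun y B => (ψ y)⁻¹ ^ k * symDyadProduct n k (o y) (ι y) B) x a B =
      ∑ σ : Equiv.Perm (Fin n), ∑ r : Fin n, ((ψ x)⁻¹ ^ k * (n.factorial : ℂ)⁻¹ *
        (if (r : ℕ) < k then g else -b)) * (f r A * ∏ s, y s (B (σ s)) -
          y r A * ∏ s, Function.update y r (f r) s (B (σ s))) := by
    intro A B
    refine (congrArg (fun θ => raise θ A' A) (funext fun a => hT a B)).trans ?_
    rw [raise_sum]
    refine Finset.sum_congr rfl fun σ _ => ?_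
    rw [raise_sum]
    refine Finset.sum_congr rfl fun r _ => ?_
    have h := raise_comb ((ψ x)⁻¹ ^ k * (n.factorial : ℂ)⁻¹ *
      ∏ s, Function.update y r (f r) s (B (σ s)))
      ((ψ x)⁻¹ ^ k * (n.factorial : ℂ)⁻¹ * ∏ s, y s (B (σ s))) (ζ r) (η r) A' A
    rw [hζr, hηr] at h
    simp only [mul_add, ← mul_assoc]
    simp only [← mul_assoc] at h
    rw [h]
    ring
  simp only [hR]
  -- The cancellation holds for each inner permutation σ and each factor `r` separately, so the
  -- outer symmetrisation is moved innermost.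
  rw [Finset.sum_comm]
  refine Finset.sum_eq_zero fun σ _ => ?_
  rw [Finset.sum_comm]
  refine Finset.sum_eq_zero fun r _ => ?_
  rw [← Finset.mul_sum, Finset.sum_sub_distrib, sum_perm_exchange y r (f r) σ B, sub_self, mul_zero]

end SpinSpacetime
end

theorem mainTheorem2 {M : Type*} [TopologicalSpace M]
    [ChartedSpace (EuclideanSpace ℝ (Fin 4)) M] [IsManifold (𝓡 4) ∞ M]
    (S : SpinSpacetime M) (hE : S.IsEinstein)
    (o ι : M → Spinor) (hoι : IsSpinDyad o ι) :
    -- characterisation of algebraically special and of type D spacetimes,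
    -- in every conformal and GHP gauge
    (Dense {x | S.WeylNonzeroAt x} →
      ∀ (w₀ w₁ : ℝ), w₀ + w₁ + 1 = 0 →
      ∀ (Ω : M → ℝ) (hΩ : ContMDiff (𝓡 4) 𝓘(ℝ, ℝ) ∞ Ω) (hpos : ∀ x, 0 < Ω x)
        (lam : M → ℂ), ContMDiff (𝓡 4) 𝓘(ℝ, ℂ) ∞ lam → (∀ x, lam x ≠ 0) →
      ∀ (o' ι' : M → Spinor), o' = gaugeTransform w₀ 1 Ω lam o →
        ι' = gaugeTransform w₁ (-1) Ω lam ι →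
        (S.IsRepeatedPrincipal o ↔
          ∀ x a B, (S.rescale Ω hΩ hpos).confGHP w₀ w₁ o' ι' w₀ 1 0 o' x a B = 0) ∧
        (S.IsTypeD o ι ↔
          (∀ x a B, (S.rescale Ω hΩ hpos).confGHP w₀ w₁ o' ι' w₀ 1 0 o' x a B = 0) ∧
          (∀ x a B, (S.rescale Ω hΩ hpos).confGHP w₀ w₁ o' ι' w₁ (-1) 0 ι' x a B = 0))) ∧
    -- weighted Killing spinors on type D spacetimes
    (S.IsTypeD o ι →
      ∀ (n k : ℕ), k ≤ n →
      ∀ (U : Set M), IsOpen U →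
      ∀ (ψ : M → ℂ), ContMDiffOn (𝓡 4) 𝓘(ℝ, ℂ) ∞ ψ U → (∀ x ∈ U, ψ x ^ 3 = S.psi2 o ι x) →
      ∀ x ∈ U, S.IsWeightedKillingAt o ι ((n : ℤ) - 2 * k)
        (fun y B => (ψ y)⁻¹ ^ k * symDyadProduct n k (o y) (ι y) B) x) := by
  refine ⟨fun hW w₀ w₁ hw Ω hΩ hpos lam hlam hne o' ι' ho' hι' =>
      SpinSpacetime.confGHP_characterisation S hE hoι hW hw hΩ hpos hlam hne ho' hι',
    fun hD n k hk U hU ψ hψ h3 x hx =>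
      SpinSpacetime.isWeightedKillingAt_symDyadProduct hE hoι hD hk hU hψ h3 hx⟩
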